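/- Let $h>0$, $\kappa=1/h$, and let $I_n,K_n$ ($n\in\mathbb N$) be the modified Bessel functions of the first and second kind. For $m\in\mathbb Z\setminus\{0\}$ and $\rho,\rho_0>0$ put $$G_m(\rho,\rho_0)=\frac{\rho\rho_0}{2\pi h^2}\begin{cases} I_{|m|}'\big(\tfrac{|m|\rho}{h}\big)K_{|m|}'\big(\tfrac{|m|\rho_0}{h}\big),&\rho\le\rho_0,\\ K_{|m|}'\big(\tfrac{|m|\rho}{h}\big)I_{|m|}'\big(\tfrac{|m|\rho_0}{h}\big),&\rho>\rho_0,\end{cases}$$ and $$G_0(\rho,\rho_0)=\begin{cases}0,&\rho\le\rho_0,\\ \frac1{2\pi}\int_{\rho_0}^{\rho}\frac{1+\kappa^2s^2}{s}\,ds,&\rho>\rho_0.\end{cases}$$ (1) For every $m\in\mathbb Z$ and $\rho_0>0$, the function $\rho\mapsto G_m(\rho,\rho_0)$ is continuous on $(0,\infty)$ and differentiable at every $\rho\neq\rho_0$, and for every $\varphi\in C_c^\infty((0,\infty))$ the following integrand is integrable and $$\int_0^\infty\Big(\frac{\rho}{1+\kappa^2\rho^2}\,\partial_\rho G_m(\rho,\rho_0)\,\varphi'(\rho)+\frac{m^2}{\rho}\,G_m(\rho,\rho_0)\,\varphi(\rho)\Big)d\rho=-\frac{\varphi(\rho_0)}{2\pi}.$$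 (2) For $\rho,\rho_0>0$ with $\rho\ne\rho_0$ and all $\phi,\phi_0\in\mathbb R$ the series $$G_H(\rho,\phi;\rho_0,\phi_0)=-\sum_{m\in\mathbb Z}G_m(\rho,\rho_0)e^{im(\phi-\phi_0)}$$ converges absolutely. Let $\Pi=(0,\infty)\times\mathbb T$ with $\mathbb T=\mathbb R/2\pi\mathbb Z$, integrals over $\Pi$ being taken over $(0,\infty)\times(0,2\pi)$, and let $f\in L^\infty((0,\infty)\times(0,2\pi))$ be (real- or complex-valued and) such that, for some $R$, $f(\rho,\phi)=0$ for almost every $(\rho,\phi)$ with $\rho>R$; this includes every compactly supported $f\in L^\infty$. Then for every $\rho>0$ and $\phi\in\mathbb R$ the integral $$\mathcal G_Hf(\rho,\phi)=\iint_\Pi G_H(\rho,\phi;\rho_0,\phi_0)f(\rho_0,\phi_0)\,\rho_0\,d\rho_0\,d\phi_0$$ converges absolutely, $\partial_\rho\mathcal G_Hf$ exists at every point with $\rho>0$, and $\mathcal G_Hf$ solves $$\mathcal L_{\rho,\phi}u:=-\frac1\rho\partial_\rho\Big(\frac{\rho}{1+\kappa^2\rho^2}\partial_\rho u\Big)-\frac1{\rho^2}\partial_\phi^2u=f$$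 weakly: for every $\psi\in C_c^\infty(\Pi)$ both terms of the integrand on the left are integrable and $$\iint_\Pi\Big\{\frac{\rho}{1+\kappa^2\rho^2}\,\partial_\rho(\mathcal G_Hf)\,\partial_\rho\psi-\frac1\rho\,\mathcal G_Hf\,\partial_\phi^2\psi\Big\}\,d\rho\,d\phi=\iint_\Pi f\,\psi\,\rho\,d\rho\,d\phi .$$ -/

import Mathlib

open Real Set MeasureTheory
open scoped ContDiff ENNReal

noncomputable section

/-- The modified Bessel function of the first kind `I_n`, of integer order `n ≥ 0`, by its power
series. For negative integer order one has `I_{-n} = I_n`. -/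
def besselI (n : ℕ) (z : ℝ) : ℝ :=
  ∑' k : ℕ, (z / 2) ^ (2 * k + n) / ((k.factorial : ℝ) * ((k + n).factorial : ℝ))

/-- The modified Bessel function of the second kind (Macdonald function) `K_n`, of integer order
`n ≥ 0`, on `z > 0`, by the classical integral `∫₀^∞ exp (-z cosh t) cosh (n t) dt`.
For negative integer order one has `K_{-n} = K_n`. -/
def besselK (n : ℕ) (z : ℝ) : ℝ :=
  ∫ t in Ioi (0 : ℝ), Real.exp (-z * Real.cosh t) * Real.cosh (n * t)

/-- The coefficients `G_m(ρ, ρ₀)`, `m ∈ ℤ`, for `ρ, ρ₀ > 0` and pitch `h > 0` (so `κ = 1 / h`).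
For `m ≠ 0` the two branches agree at `ρ = ρ₀`, and for `m = 0` both vanish there. -/
def greenCoeff (h : ℝ) (m : ℤ) (ρ ρ₀ : ℝ) : ℝ :=
  if m = 0 then
    if ρ ≤ ρ₀ then 0
    else 1 / (2 * π) * ∫ s in ρ₀..ρ, (1 + (1 / h) ^ 2 * s ^ 2) / s
  else
    ρ * ρ₀ / (2 * π * h ^ 2) *
      if ρ ≤ ρ₀ then
        deriv (besselI m.natAbs) (m.natAbs * ρ / h) * deriv (besselK m.natAbs) (m.natAbs * ρ₀ / h)
      else
        deriv (besselK m.natAbs) (m.natAbs * ρ / h) * deriv (besselI m.natAbs) (m.natAbs * ρ₀ / h)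

/-- The terms of the Fourier expansion of the Green function. -/
def greenTerm (h : ℝ) (ρ φ ρ₀ φ₀ : ℝ) (m : ℤ) : ℂ :=
  (greenCoeff h m ρ ρ₀ : ℂ) * Complex.exp (Complex.I * m * (φ - φ₀))

/-- `G_H(ρ, φ; ρ₀, φ₀) = - ∑_{m ∈ ℤ} G_m(ρ, ρ₀) e^{i m (φ - φ₀)}`. -/
def greenH (h : ℝ) (ρ φ ρ₀ φ₀ : ℝ) : ℂ :=
  -∑' m : ℤ, greenTerm h ρ φ ρ₀ φ₀ m

/-- The set `(0, ∞) × (0, 2π)` of polar coordinates `(ρ, φ)`, which represents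
`Π = (0, ∞) × 𝕋` up to a null set. -/
def polarStrip : Set (ℝ × ℝ) := Ioi 0 ×ˢ Ioo 0 (2 * π)

/-- The operator `𝒢_H f (ρ, φ) = ∬_Π G_H(ρ, φ; ρ₀, φ₀) f(ρ₀, φ₀) ρ₀ dρ₀ dφ₀`. -/
def greenOp (h : ℝ) (f : ℝ × ℝ → ℂ) (ρ φ : ℝ) : ℂ :=
  ∫ q in polarStrip, greenH h ρ φ q.1 q.2 * f q * (q.1 : ℂ)

/-- Test functions of class `C_c^∞` on `Π = (0, ∞) × 𝕋`, as smooth functions on `ℝ × ℝ` that are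
`2π`-periodic in the angle and supported in some `a ≤ ρ ≤ b` with `0 < a`. -/
structure IsPolarTestFunction (ψ : ℝ × ℝ → ℂ) : Prop where
  smooth : ContDiff ℝ ∞ ψ
  periodic : ∀ ρ φ : ℝ, ψ (ρ, φ + 2 * π) = ψ (ρ, φ)
  support : ∃ a b : ℝ, 0 < a ∧ ∀ ρ φ : ℝ, ψ (ρ, φ) ≠ 0 → a ≤ ρ ∧ ρ ≤ b

/-- The weak form on `Π` of the helical equation in polar coordinates
`-(1/ρ) ∂_ρ (ρ / (1 + κ² ρ²) ∂_ρ u) - (1/ρ²) ∂_φ² u = f`, with `κ = 1 / h`. The derivative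
`∂_ρ u` is the classical one, which is required to exist at every point of `Π`, and both terms on
the left are required to be integrable against every test function. -/
def IsWeakHelicalSolution (h : ℝ) (u : ℝ → ℝ → ℂ) (f : ℝ × ℝ → ℂ) : Prop :=
  (∀ ρ φ : ℝ, 0 < ρ → DifferentiableAt ℝ (fun r => u r φ) ρ) ∧
  ∀ ψ : ℝ × ℝ → ℂ, IsPolarTestFunction ψ →
    IntegrableOn (fun p : ℝ × ℝ => ((p.1 / (1 + (1 / h) ^ 2 * p.1 ^ 2) : ℝ) : ℂ) *
      deriv (fun r => u r p.2) p.1 * deriv (fun r => ψ (r, p.2)) p.1) polarStrip ∧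
    IntegrableOn (fun p : ℝ × ℝ => ((1 / p.1 : ℝ) : ℂ) *
      u p.1 p.2 * iteratedDeriv 2 (fun t => ψ (p.1, t)) p.2) polarStrip ∧
    ∫ p in polarStrip, (((p.1 / (1 + (1 / h) ^ 2 * p.1 ^ 2) : ℝ) : ℂ) *
        deriv (fun r => u r p.2) p.1 * deriv (fun r => ψ (r, p.2)) p.1 -
      ((1 / p.1 : ℝ) : ℂ) * u p.1 p.2 * iteratedDeriv 2 (fun t => ψ (p.1, t)) p.2) =
    ∫ p in polarStrip, f p * ψ p * (p.1 : ℂ)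

end

open Filter Topology

noncomputable section

/-! ### The modified Bessel functions `I_n` -/

/-! Separation of variables reduces the equation to the radial operators `u ↦ -(p u')' + (m²/ρ) u`
with `p = ρ/(1 + κ²ρ²)`, and `-G_m` is a fundamental solution of the `m`-th one. For `m ≠ 0` put `n
= |m|`, `U(z) = z I_n'(z)`, `W(z) = -z K_n'(z)`. Bessel's equation reads `U' = (z² + n²)/z · I_n`,
and likewise for `W`. At `z = nρ/h` one has `z² + n² = n²(1 + κ²ρ²)`, so a product of `U` and `W`
has a flux `p ∂_ρ G_m` built from `I_n` or `K_n` alone, and the derivative of that flux is `(m²/ρ)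
G_m`. The jump of the flux on the diagonal is the Wronskian `I_n W + U K_n = 1`, divided by `2π`.
The weak equation for `G_m` is then the fundamental theorem of calculus on either side of `ρ₀`
(`IsRadialKernel.integral_weak`); for `m = 0` a logarithm plus a quadratic term takes the place of
the Bessel functions.

Convergence rests on bounds uniform in `m`. The Wronskian gives `U W ≤ n + z` at a single point, and
a monotonicity property of `U` and of `W` moves one factor to another point at the cost of `q^n`,
where `q = √(min ρ s / max ρ s)`. Thus `G_m = O(q^n / n)` and `∂_ρ G_m = O(q^n)`. The estimate `q^n
≤ C n^(-3/4) |ρ - s|^(-3/4)` trades part of this decay for an integrable singularity. The series of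
the `G_m` converges absolutely after integration. The majorants of the derivatives are only square
summable in `m`, so they are paired by Cauchy–Schwarz with the angular Fourier coefficients of `f`,
whose squares have bounded sum by Bessel's inequality (`exists_sum_norm_radialModeDeriv_le`).

Hence `𝒢_H f` is a series of modes that can be differentiated in `ρ` term by term. Each mode
satisfies the weak equation with the matching Fourier mode of `f` on the right
(`integral_weak_mode`). Dominated convergence sums the left sides, and the Fourier series of the
test function sums the right sides. -/

/-- The entire function `∑ x^k / (k! (k + n)!)`, for which `I_n(z) = (z/2)^n f_n(z²/4)`. -/
def besselISeries (n : ℕ) (x : ℝ) : ℝ :=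
  ∑' k : ℕ, x ^ k / ((k.factorial : ℝ) * ((k + n).factorial : ℝ))

theorem summable_besselISeries (n : ℕ) (x : ℝ) :
    Summable fun k : ℕ => x ^ k / ((k.factorial : ℝ) * ((k + n).factorial : ℝ)) := by
  refine Summable.of_norm_bounded (Real.summable_pow_div_factorial |x|) fun k => ?_
  rw [norm_div, norm_pow, Real.norm_eq_abs, Real.norm_of_nonneg (by positivity)]
  gcongr
  have h1 : (1 : ℝ) ≤ ((k + n).factorial : ℝ) := by exact_mod_cast Nat.one_le_of_lt (k + n).factorial_pos
  have h2 : (0 : ℝ) < (k.factorial : ℝ) := by positivity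
  nlinarith

theorem besselI_eq_pow_mul_series (n : ℕ) (z : ℝ) :
    besselI n z = (z / 2) ^ n * besselISeries n (z ^ 2 / 4) := by
  rw [besselI, besselISeries, ← tsum_mul_left]
  refine tsum_congr fun k => ?_
  rw [pow_add, pow_mul]
  ring

theorem hasDerivAt_besselISeries (n : ℕ) (x : ℝ) :
    HasDerivAt (besselISeries n) (besselISeries (n + 1) x) x := by
  have hfac : ∀ k : ℕ, ((k + 1).factorial : ℝ) = (k + 1) * k.factorial := fun k => by
    rw [Nat.factorial_succ]; push_cast; ring
  set r : ℝ := |x| + 1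
  have hr : 0 ≤ r := by positivity
  let u : ℕ → ℝ := fun k => k * r ^ (k - 1) / ((k.factorial : ℝ) * ((k + n).factorial : ℝ))
  -- The factor `k + 1` cancels against `(k + 1)!`, so the differentiated series, shifted by one, is
  -- the series of order `n + 1`. This yields both the summable majorant and the value of the
  -- derivative.
  have hshift : ∀ y : ℝ, (fun k : ℕ => ((k + 1 : ℕ) : ℝ) * y ^ (k + 1 - 1) /
      (((k + 1).factorial : ℝ) * ((k + 1 + n).factorial : ℝ))) =
      fun k : ℕ => y ^ k / ((k.factorial : ℝ) * ((k + (n + 1)).factorial : ℝ)) := by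
    intro y
    funext k
    rw [hfac, Nat.add_sub_cancel, show k + 1 + n = k + (n + 1) by ring]
    have : (k.factorial : ℝ) ≠ 0 := by positivity
    have : ((k + (n + 1)).factorial : ℝ) ≠ 0 := by positivity
    push_cast
    field_simp
  have hu : Summable u := by
    rw [← summable_nat_add_iff 1]
    exact (hshift r) ▸ summable_besselISeries (n + 1) r
  have key := hasDerivAt_tsum_of_isPreconnected (𝕜 := ℝ) (F := ℝ)
    (g := fun k y => y ^ k / ((k.factorial : ℝ) * ((k + n).factorial : ℝ)))
    (g' := fun k y => k * y ^ (k - 1) / ((k.factorial : ℝ) * ((k + n).factorial : ℝ)))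
    (t := Metric.ball 0 r) (y₀ := 0) (y := x) hu Metric.isOpen_ball
    (convex_ball 0 r).isPreconnected (fun k y _ => (hasDerivAt_pow k y).div_const _)
    (fun k y hy => ?_) (Metric.mem_ball_self (by positivity)) (summable_besselISeries n 0)
    (by simp [r])
  · convert! key using 1
    rw [Summable.tsum_eq_zero_add]
    · simp only [Nat.cast_zero, zero_mul, zero_div, zero_add]
      rw [besselISeries, hshift x]
    · rw [← summable_nat_add_iff 1]
      exact (hshift x) ▸ summable_besselISeries (n + 1) x
  · rw [norm_div, norm_mul, norm_pow, Real.norm_of_nonneg (by positivity : (0 : ℝ) ≤ k),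
      Real.norm_of_nonneg (by positivity : (0 : ℝ) ≤ (k.factorial : ℝ) * ((k + n).factorial : ℝ))]
    have : ‖y‖ ≤ r := by simpa using (Metric.mem_ball.1 hy).le
    dsimp only [u]
    gcongr

/-- Coefficientwise this is the identity `k + n + 2 = (n + 1) + (k + 1)`; the constant term is
treated apart. It is the source of the three-term recurrence of the `I_n`. -/
theorem besselISeries_recurrence (n : ℕ) (x : ℝ) :
    besselISeries n x = (n + 1) * besselISeries (n + 1) x + x * besselISeries (n + 2) x := by
  have hfac : ∀ k : ℕ, ((k + 1).factorial : ℝ) = (k + 1) * k.factorial := fun k => by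
    rw [Nat.factorial_succ]; push_cast; ring
  have h1 := summable_besselISeries (n + 1) x
  have h2 := summable_besselISeries (n + 2) x
  have h3 := summable_besselISeries n x
  rw [besselISeries, besselISeries, besselISeries, ← tsum_mul_left, ← tsum_mul_left,
    h3.tsum_eq_zero_add, (h1.mul_left _).tsum_eq_zero_add, add_assoc,
    ← Summable.tsum_add ((summable_nat_add_iff 1).2 (h1.mul_left _)) (h2.mul_left _)]
  congr 1
  · have : (n.factorial : ℝ) ≠ 0 := by positivity
    simp only [zero_add, hfac, Nat.factorial_zero]
    push_cast
    field_simp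
  · refine tsum_congr fun k => ?_
    rw [show k + (n + 2) = k + 1 + n + 1 by ring, show k + 1 + (n + 1) = k + 1 + n + 1 by ring,
      hfac (k + 1 + n), hfac k]
    have : (k.factorial : ℝ) ≠ 0 := by positivity
    have : ((k + 1 + n).factorial : ℝ) ≠ 0 := by positivity
    push_cast
    field_simp
    ring

theorem besselISeries_pos (n : ℕ) {x : ℝ} (hx : 0 ≤ x) : 0 < besselISeries n x := by
  refine (summable_besselISeries n x).tsum_pos (fun k => by positivity) 0 ?_
  simp only [pow_zero]
  positivity

theorem besselISeries_le (n : ℕ) {x y : ℝ} (hx : 0 ≤ x) (hxy : x ≤ y) :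
    besselISeries n x ≤ besselISeries n y :=
  (summable_besselISeries n x).tsum_le_tsum (fun k => by gcongr) (summable_besselISeries n y)

theorem besselI_pos (n : ℕ) {z : ℝ} (hz : 0 < z) : 0 < besselI n z := by
  rw [besselI_eq_pow_mul_series]
  exact mul_pos (by positivity) (besselISeries_pos n (by positivity))

theorem mul_besselI_recurrence (n : ℕ) (z : ℝ) :
    z * besselI n z = 2 * (n + 1) * besselI (n + 1) z + z * besselI (n + 2) z := by
  simp only [besselI_eq_pow_mul_series]
  rw [besselISeries_recurrence n]
  ring

theorem hasDerivAt_besselI (n : ℕ) {z : ℝ} (hz : z ≠ 0) :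
    HasDerivAt (besselI n) (besselI (n + 1) z + n / z * besselI n z) z := by
  have h1 : HasDerivAt (fun z : ℝ => z / 2) (1 / 2) z := (hasDerivAt_id z).div_const 2
  have h2 : HasDerivAt (fun z : ℝ => z ^ 2 / 4) (z / 2) z := by
    convert! (hasDerivAt_pow 2 z).div_const 4 using 1
    simp; ring
  have h3 := (h1.pow n).mul ((hasDerivAt_besselISeries n (z ^ 2 / 4)).comp z h2)
  have he : besselI n = fun z => (z / 2) ^ n * besselISeries n (z ^ 2 / 4) :=
    funext (besselI_eq_pow_mul_series n)
  rw [he]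
  convert! h3 using 1
  simp only [besselI_eq_pow_mul_series, Function.comp, Pi.pow_apply]
  rcases n with _ | n
  · simp; ring
  · simp only [Nat.add_sub_cancel]
    push_cast
    field_simp
    ring

theorem hasDerivAt_besselI_succ (n : ℕ) {z : ℝ} (hz : z ≠ 0) :
    HasDerivAt (besselI (n + 1)) (besselI n z - (n + 1) / z * besselI (n + 1) z) z := by
  convert! hasDerivAt_besselI (n + 1) hz using 1
  have := mul_besselI_recurrence n z
  push_cast
  field_simp
  linarith

/-- `z I_n'(z)`. -/
def besselIFlux (n : ℕ) (z : ℝ) : ℝ := n * besselI n z + z * besselI (n + 1) z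

theorem mul_deriv_besselI (n : ℕ) {z : ℝ} (hz : z ≠ 0) :
    z * deriv (besselI n) z = besselIFlux n z := by
  rw [(hasDerivAt_besselI n hz).deriv, besselIFlux]
  field_simp
  ring

theorem hasDerivAt_besselI_flux (n : ℕ) {z : ℝ} (hz : z ≠ 0) :
    HasDerivAt (besselI n) (besselIFlux n z / z) z := by
  convert! hasDerivAt_besselI n hz using 1
  rw [besselIFlux]
  field_simp
  ring

/-- This is Bessel's equation in first-order form, `I_n` and its flux each having a derivative
proportional to the other. -/
theorem hasDerivAt_besselIFlux (n : ℕ) {z : ℝ} (hz : z ≠ 0) :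
    HasDerivAt (besselIFlux n) ((z ^ 2 + n ^ 2) / z * besselI n z) z := by
  convert! ((hasDerivAt_besselI n hz).const_mul (n : ℝ)).add
    ((hasDerivAt_id z).mul (hasDerivAt_besselI_succ n hz)) using 1
  simp only [id]
  field_simp
  ring

theorem mul_besselI_le_besselIFlux (n : ℕ) {z : ℝ} (hz : 0 < z) :
    n * besselI n z ≤ besselIFlux n z :=
  le_add_of_nonneg_right (mul_nonneg hz.le (besselI_pos _ hz).le)

theorem besselIFlux_pos (n : ℕ) {z : ℝ} (hz : 0 < z) : 0 < besselIFlux n z :=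
  add_pos_of_nonneg_of_pos (mul_nonneg (by positivity) (besselI_pos _ hz).le)
    (mul_pos hz (besselI_pos _ hz))

/-- The flux is `(z/2)^n` times a power series with nonnegative coefficients, which is nondecreasing
on `z > 0`. -/
theorem besselIFlux_le (n : ℕ) {z z' : ℝ} (hz : 0 < z) (hz' : z ≤ z') :
    besselIFlux n z ≤ (z / z') ^ n * besselIFlux n z' := by
  have hz0 : 0 < z' := hz.trans_le hz'
  have h : ∀ y : ℝ, 0 < y → besselIFlux n y = (y / 2) ^ n * (n * besselISeries n (y ^ 2 / 4) +
      y ^ 2 / 2 * besselISeries (n + 1) (y ^ 2 / 4)) := by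
    intro y _
    rw [besselIFlux, besselI_eq_pow_mul_series, besselI_eq_pow_mul_series]
    ring
  rw [h z hz, h z' hz0, ← mul_assoc, ← mul_pow, show z / z' * (z' / 2) = z / 2 by field_simp]
  have h1 := besselISeries_le n (x := z ^ 2 / 4) (y := z' ^ 2 / 4) (by positivity) (by gcongr)
  have h2 := besselISeries_le (n + 1) (x := z ^ 2 / 4) (y := z' ^ 2 / 4) (by positivity) (by gcongr)
  have h3 := besselISeries_pos (n + 1) (x := z ^ 2 / 4) (by positivity)
  gcongr

/-! ### The modified Bessel functions `K_ν` -/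

/-- The modified Bessel function of the second kind, of real order. -/
def besselKReal (ν : ℝ) (z : ℝ) : ℝ :=
  ∫ t in Ioi (0 : ℝ), Real.exp (-z * Real.cosh t) * Real.cosh (ν * t)

/-- Real orders keep `ν - 1` available in the recurrences; at order `0` it would leave the natural
numbers. -/
theorem besselK_eq_besselKReal (n : ℕ) : besselK n = besselKReal n := rfl

theorem quarter_sq_le_cosh (t : ℝ) : t ^ 2 / 4 ≤ Real.cosh t := by
  rw [← Real.cosh_abs, ← sq_abs, Real.cosh_eq]
  have h1 := Real.quadratic_le_exp_of_nonneg (abs_nonneg t)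
  have h2 := Real.add_one_le_exp (-|t|)
  linarith

theorem cosh_le_exp_abs (t : ℝ) : Real.cosh t ≤ Real.exp |t| := by
  rw [← Real.cosh_abs, Real.cosh_eq]
  have : Real.exp (-|t|) ≤ Real.exp |t| := Real.exp_le_exp.2 (by linarith [abs_nonneg t])
  linarith

theorem integrableOn_besselKReal (ν : ℝ) {z : ℝ} (hz : 0 < z) :
    IntegrableOn (fun t => Real.exp (-z * Real.cosh t) * Real.cosh (ν * t)) (Ioi 0) := by
  refine integrable_of_isBigO_exp_neg (b := 1) one_pos (by fun_prop) ?_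
  refine Asymptotics.IsBigO.of_bound 1 ?_
  -- Beyond this threshold `z t²/4 ≥ (|ν| + 1) t`, so the decay of `exp (-z cosh t)` absorbs `exp
  -- (|ν| t)` and still leaves `exp (-t)`.
  filter_upwards [eventually_ge_atTop (max 0 (4 * (|ν| + 1) / z))] with t ht
  have ht0 : 0 ≤ t := (le_max_left _ _).trans ht
  have ht1 : 4 * (|ν| + 1) ≤ z * t := by
    have := (le_max_right _ _).trans ht
    rw [div_le_iff₀ hz] at this
    linarith
  rw [Real.norm_of_nonneg (by positivity), Real.norm_of_nonneg (by positivity), one_mul]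
  calc _ ≤ Real.exp (-z * Real.cosh t) * Real.exp |ν * t| := by
        gcongr; exact cosh_le_exp_abs _
    _ = Real.exp (-z * Real.cosh t + |ν| * t) := by
        rw [← Real.exp_add, abs_mul, abs_of_nonneg ht0]
    _ ≤ _ := by
        refine Real.exp_le_exp.2 ?_
        have h1 := quarter_sq_le_cosh t
        nlinarith [mul_le_mul_of_nonneg_left h1 hz.le, mul_le_mul_of_nonneg_right ht1 ht0]

theorem besselKReal_pos (ν : ℝ) {z : ℝ} (hz : 0 < z) : 0 < besselKReal ν z := by
  rw [besselKReal, setIntegral_pos_iff_support_of_nonneg_ae]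
  · have : Function.support (fun t => Real.exp (-z * Real.cosh t) * Real.cosh (ν * t)) = univ := by
      ext t
      simp only [Function.mem_support, mem_univ, iff_true]
      positivity
    rw [this]
    simp
  · exact Eventually.of_forall fun t => by positivity
  · exact integrableOn_besselKReal ν hz

theorem besselKReal_le {ν ν' : ℝ} (hν : 0 ≤ ν) (h : ν ≤ ν') {z : ℝ} (hz : 0 < z) :
    besselKReal ν z ≤ besselKReal ν' z := by
  refine setIntegral_mono_on (integrableOn_besselKReal ν hz) (integrableOn_besselKReal ν' hz)
    measurableSet_Ioi fun t ht => ?_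
  have ht0 : (0 : ℝ) < t := ht
  gcongr
  rw [Real.cosh_le_cosh, abs_of_nonneg (by positivity), abs_of_nonneg (mul_nonneg (hν.trans h) ht0.le)]
  gcongr

theorem cosh_mul_cosh_mul (ν t : ℝ) : Real.cosh t * Real.cosh (ν * t) =
    (Real.cosh ((ν + 1) * t) + Real.cosh ((ν - 1) * t)) / 2 := by
  rw [add_mul, sub_mul, one_mul, Real.cosh_add, Real.cosh_sub]
  ring

theorem sinh_mul_sinh_mul (ν t : ℝ) : Real.sinh t * Real.sinh (ν * t) =
    (Real.cosh ((ν + 1) * t) - Real.cosh ((ν - 1) * t)) / 2 := by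
  rw [add_mul, sub_mul, one_mul, Real.cosh_add, Real.cosh_sub]
  ring

theorem hasDerivAt_besselKReal (ν : ℝ) {z : ℝ} (hz : 0 < z) :
    HasDerivAt (besselKReal ν) (-(besselKReal (ν + 1) z + besselKReal (ν - 1) z) / 2) z := by
  have hI : ∀ {x : ℝ}, 0 < x → IntegrableOn (fun t => Real.exp (-x * Real.cosh t) *
      (Real.cosh t * Real.cosh (ν * t))) (Ioi 0) := by
    intro x hx
    refine (((integrableOn_besselKReal (ν + 1) hx).add
      (integrableOn_besselKReal (ν - 1) hx)).div_const 2).congr (Eventually.of_forall fun t => ?_)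
    simp only [Pi.add_apply, cosh_mul_cosh_mul]
    ring
  have key := (hasDerivAt_integral_of_dominated_loc_of_deriv_le
    (μ := volume.restrict (Ioi (0 : ℝ))) (𝕜 := ℝ)
    (F := fun x t => Real.exp (-x * Real.cosh t) * Real.cosh (ν * t))
    (F' := fun x t => -(Real.exp (-x * Real.cosh t) * (Real.cosh t * Real.cosh (ν * t))))
    (bound := fun t => Real.exp (-(z / 2) * Real.cosh t) * (Real.cosh t * Real.cosh (ν * t)))
    (s := Ioi (z / 2)) (x₀ := z) (Ioi_mem_nhds (by linarith))
    (Eventually.of_forall fun x => (by fun_prop : Continuous _).aestronglyMeasurable)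
    (integrableOn_besselKReal ν hz)
    (by fun_prop : Continuous _).aestronglyMeasurable
    (Eventually.of_forall fun t x hx => ?_) (hI (by linarith)) (Eventually.of_forall fun t x _ => ?_)).2
  · convert! key using 1
    rw [integral_neg, neg_div, besselKReal, besselKReal,
      ← integral_add (integrableOn_besselKReal (ν + 1) hz) (integrableOn_besselKReal (ν - 1) hz),
      ← integral_div]
    congr 2
    funext t
    rw [cosh_mul_cosh_mul]
    ring
  · rw [norm_neg, Real.norm_of_nonneg (by positivity)]
    have : z / 2 ≤ x := (show z / 2 < x from hx).le
    gcongr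
  · have h1 : HasDerivAt (fun x : ℝ => -x * Real.cosh t) (-1 * Real.cosh t) x :=
      (hasDerivAt_neg x).mul_const _
    convert! (h1.exp.mul_const (Real.cosh (ν * t))) using 1
    ring

/-- The function `exp (-z cosh t) sinh (ν t)` vanishes at `0` and at infinity, so its derivative
integrates to zero; `sinh t sinh (ν t)` splits into the hyperbolic cosines of orders `ν ± 1`. -/
theorem mul_besselKReal_recurrence (ν : ℝ) {z : ℝ} (hz : 0 < z) :
    z * (besselKReal (ν + 1) z - besselKReal (ν - 1) z) = 2 * ν * besselKReal ν z := by
  have hp := integrableOn_besselKReal (ν + 1) hz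
  have hm := integrableOn_besselKReal (ν - 1) hz
  have h0 := integrableOn_besselKReal ν hz
  have hd : ∀ t : ℝ, HasDerivAt (fun t => Real.exp (-z * Real.cosh t) * Real.sinh (ν * t))
      (ν * (Real.exp (-z * Real.cosh t) * Real.cosh (ν * t)) - z / 2 *
        (Real.exp (-z * Real.cosh t) * Real.cosh ((ν + 1) * t) -
          Real.exp (-z * Real.cosh t) * Real.cosh ((ν - 1) * t))) t := by
    intro t
    have h1 := ((Real.hasDerivAt_cosh t).const_mul (-z)).exp
    have h2 : HasDerivAt (fun t => Real.sinh (ν * t)) (Real.cosh (ν * t) * (ν * 1)) t :=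
      ((hasDerivAt_id t).const_mul ν).sinh
    convert! h1.mul h2 using 1
    linear_combination (z * Real.exp (-z * Real.cosh t)) * sinh_mul_sinh_mul ν t
  have hi := (h0.const_mul ν).sub ((hp.sub hm).const_mul (z / 2))
  have hlim : Tendsto (fun t => Real.exp (-z * Real.cosh t) * Real.sinh (ν * t)) atTop (𝓝 0) := by
    refine tendsto_zero_of_hasDerivAt_of_integrableOn_Ioi (a := 0) (fun t _ => hd t) hi ?_
    refine Integrable.mono' h0 (by fun_prop : Continuous _).aestronglyMeasurable
      (Eventually.of_forall fun t => ?_)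
    rw [norm_mul, Real.norm_of_nonneg (by positivity)]
    gcongr
    rw [Real.norm_eq_abs, ← Real.cosh_abs (ν * t), Real.abs_sinh]
    exact (Real.sinh_lt_cosh _).le
  have key := integral_Ioi_of_hasDerivAt_of_tendsto' (fun t _ => hd t) hi hlim
  have hi' : IntegrableOn (fun t => z / 2 * (Real.exp (-z * Real.cosh t) * Real.cosh ((ν + 1) * t) -
      Real.exp (-z * Real.cosh t) * Real.cosh ((ν - 1) * t))) (Ioi 0) := (hp.sub hm).const_mul (z / 2)
  have hpm : ∫ t in Ioi (0 : ℝ), (Real.exp (-z * Real.cosh t) * Real.cosh ((ν + 1) * t) -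
      Real.exp (-z * Real.cosh t) * Real.cosh ((ν - 1) * t)) =
      besselKReal (ν + 1) z - besselKReal (ν - 1) z := integral_sub hp hm
  rw [integral_sub (h0.const_mul ν) hi',
    integral_const_mul, integral_const_mul, hpm] at key
  simp only [mul_zero, Real.sinh_zero, sub_zero] at key
  change ν * besselKReal ν z - _ = 0 at key
  linarith

theorem besselK_pos (n : ℕ) {z : ℝ} (hz : 0 < z) : 0 < besselK n z := besselKReal_pos n hz

theorem besselK_le_succ (n : ℕ) {z : ℝ} (hz : 0 < z) : besselK n z ≤ besselK (n + 1) z :=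
  besselKReal_le (by positivity) (by push_cast; linarith) hz

theorem mul_besselK_recurrence (n : ℕ) {z : ℝ} (hz : 0 < z) :
    z * besselK (n + 2) z = 2 * (n + 1) * besselK (n + 1) z + z * besselK n z := by
  have := mul_besselKReal_recurrence (n + 1) hz
  rw [add_sub_cancel_right] at this
  simp only [besselK_eq_besselKReal]
  push_cast
  rw [show (n : ℝ) + 2 = n + 1 + 1 by ring]
  linarith

theorem hasDerivAt_besselK (n : ℕ) {z : ℝ} (hz : 0 < z) :
    HasDerivAt (besselK n) (n / z * besselK n z - besselK (n + 1) z) z := by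
  convert! hasDerivAt_besselKReal n hz using 1
  have := mul_besselKReal_recurrence n hz
  simp only [besselK_eq_besselKReal]
  push_cast
  field_simp
  linarith

theorem hasDerivAt_besselK_succ (n : ℕ) {z : ℝ} (hz : 0 < z) :
    HasDerivAt (besselK (n + 1)) (-besselK n z - (n + 1) / z * besselK (n + 1) z) z := by
  convert! hasDerivAt_besselK (n + 1) hz using 1
  have := mul_besselK_recurrence n hz
  push_cast
  field_simp
  linarith

/-- `-z K_n'(z)`. -/
def besselKFlux (n : ℕ) (z : ℝ) : ℝ := z * besselK (n + 1) z - n * besselK n z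

theorem mul_deriv_besselK (n : ℕ) {z : ℝ} (hz : 0 < z) :
    z * deriv (besselK n) z = -besselKFlux n z := by
  rw [(hasDerivAt_besselK n hz).deriv, besselKFlux]
  field_simp
  ring

theorem hasDerivAt_besselK_flux (n : ℕ) {z : ℝ} (hz : 0 < z) :
    HasDerivAt (besselK n) (-besselKFlux n z / z) z := by
  convert! hasDerivAt_besselK n hz using 1
  rw [besselKFlux]
  field_simp
  ring

theorem hasDerivAt_besselKFlux (n : ℕ) {z : ℝ} (hz : 0 < z) :
    HasDerivAt (besselKFlux n) (-((z ^ 2 + n ^ 2) / z * besselK n z)) z := by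
  convert! ((hasDerivAt_id z).mul (hasDerivAt_besselK_succ n hz)).sub
    ((hasDerivAt_besselK n hz).const_mul (n : ℝ)) using 1
  simp only [id]
  field_simp
  ring

/-- The flux is defined as a difference; the recurrence turns it into a sum of positive terms, from
which the two-sided comparison with `K_n` can be read off. -/
theorem besselKFlux_succ (n : ℕ) {z : ℝ} (hz : 0 < z) :
    besselKFlux (n + 1) z = (n + 1) * besselK (n + 1) z + z * besselK n z := by
  have := mul_besselK_recurrence n hz
  rw [besselKFlux]
  push_cast
  linarith

theorem mul_besselK_le_besselKFlux {n : ℕ} (hn : n ≠ 0) {z : ℝ} (hz : 0 < z) :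
    n * besselK n z ≤ besselKFlux n z := by
  obtain ⟨n, rfl⟩ := Nat.exists_eq_succ_of_ne_zero hn
  rw [Nat.succ_eq_add_one, besselKFlux_succ n hz]
  push_cast
  exact le_add_of_nonneg_right (mul_nonneg hz.le (besselK_pos n hz).le)

theorem besselKFlux_le_mul {n : ℕ} (hn : n ≠ 0) {z : ℝ} (hz : 0 < z) :
    besselKFlux n z ≤ (n + z) * besselK n z := by
  obtain ⟨n, rfl⟩ := Nat.exists_eq_succ_of_ne_zero hn
  rw [Nat.succ_eq_add_one, besselKFlux_succ n hz]
  have := besselK_le_succ n hz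
  push_cast
  nlinarith

theorem besselKFlux_pos {n : ℕ} (hn : n ≠ 0) {z : ℝ} (hz : 0 < z) : 0 < besselKFlux n z :=
  (mul_pos (by positivity) (besselK_pos n hz)).trans_le (mul_besselK_le_besselKFlux hn hz)

/-- With `W` the flux, the derivative has the sign of `n W - 2 (z² + n²) K_n`, which is nonpositive
because `W ≤ (n + z) K_n` and `n (n + z) ≤ 2 (z² + n²)`. For `W z^n` the same argument would need `n
(n + z) ≤ z² + n²`, which fails for `z < n`; this is why only the rate `z^(-n/2)` is claimed, and
squaring avoids the half-integer power. -/
theorem antitoneOn_sq_besselKFlux_mul_pow {n : ℕ} (hn : n ≠ 0) :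
    AntitoneOn (fun z => besselKFlux n z ^ 2 * z ^ n) (Ioi 0) := by
  have hd : ∀ z ∈ Ioi (0 : ℝ), HasDerivAt (fun z => besselKFlux n z ^ 2 * z ^ n)
      (2 * besselKFlux n z * (-((z ^ 2 + n ^ 2) / z * besselK n z)) * z ^ n +
        besselKFlux n z ^ 2 * (n * z ^ (n - 1))) z := by
    intro z hz
    convert! ((hasDerivAt_besselKFlux n hz).pow 2).mul (hasDerivAt_pow n z) using 1
    simp
  refine antitoneOn_of_deriv_nonpos (convex_Ioi 0)
    (fun z hz => (hd z hz).continuousAt.continuousWithinAt)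
    (fun z hz => (hd z (interior_subset hz)).differentiableAt.differentiableWithinAt) ?_
  intro z hz
  rw [interior_Ioi] at hz
  have hz0 : (0 : ℝ) < z := hz
  rw [(hd z hz).deriv]
  have h1 := besselKFlux_le_mul hn hz0
  have h2 := besselKFlux_pos hn hz0
  have h3 := besselK_pos n hz0
  have hp : z ^ n = z * z ^ (n - 1) := by rw [← pow_succ', Nat.sub_add_cancel (Nat.pos_of_ne_zero hn)]
  have : 2 * besselKFlux n z * (-((z ^ 2 + n ^ 2) / z * besselK n z)) * z ^ n +
        besselKFlux n z ^ 2 * (n * z ^ (n - 1)) = -(z ^ (n - 1) * besselKFlux n z *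
        (2 * (z ^ 2 + n ^ 2) * besselK n z - n * besselKFlux n z)) := by
    rw [hp]
    field_simp
    ring
  rw [this, neg_nonpos]
  refine mul_nonneg (by positivity) ?_
  have h4 : (n : ℝ) * besselKFlux n z ≤ n * ((n + z) * besselK n z) := by gcongr
  have h5 : (n : ℝ) * (n + z) ≤ 2 * (z ^ 2 + n ^ 2) := by nlinarith [sq_nonneg ((n : ℝ) - z), sq_nonneg z]
  nlinarith

theorem besselKFlux_le {n : ℕ} (hn : n ≠ 0) {z z' : ℝ} (hz : 0 < z) (hz' : z ≤ z') :
    besselKFlux n z' ≤ √(z / z') ^ n * besselKFlux n z := by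
  have hz0 : 0 < z' := hz.trans_le hz'
  have h := antitoneOn_sq_besselKFlux_mul_pow hn (mem_Ioi.2 hz) (mem_Ioi.2 hz0) hz'
  have hpos := (besselKFlux_pos hn hz).le
  refine (sq_le_sq₀ (besselKFlux_pos hn hz0).le (by positivity)).1 ?_
  rw [mul_pow, ← pow_mul, mul_comm n 2, pow_mul, Real.sq_sqrt (by positivity), div_pow,
    div_mul_eq_mul_div, le_div_iff₀ (by positivity)]
  linarith

/-! ### The Wronskian -/

/-- With `sinh t` in place of `cosh t` the integral is exact and gives `exp (-z)`. The difference
`cosh t - sinh t = exp (-t)` contributes at most `z ∫ exp (-t) dt = z`. -/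
theorem tendsto_mul_besselK_one :
    Tendsto (fun z => z * besselK 1 z) (𝓝[>] 0) (𝓝 1) := by
  have hb : ∀ z : ℝ, 0 < z → Real.exp (-z) ≤ z * besselK 1 z ∧
      z * besselK 1 z ≤ Real.exp (-z) + z := by
    intro z hz
    have hd : ∀ t : ℝ, HasDerivAt (fun t => -Real.exp (-z * Real.cosh t))
        (z * (Real.exp (-z * Real.cosh t) * Real.sinh t)) t := by
      intro t
      convert! (((Real.hasDerivAt_cosh t).const_mul (-z)).exp).neg using 1
      ring
    have h1 := integrableOn_besselKReal 1 hz
    simp only [one_mul] at h1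
    have hs : IntegrableOn (fun t => Real.exp (-z * Real.cosh t) * Real.sinh t) (Ioi 0) := by
      refine Integrable.mono' h1 (by fun_prop : Continuous _).aestronglyMeasurable
        (Eventually.of_forall fun t => ?_)
      rw [norm_mul, Real.norm_of_nonneg (by positivity)]
      gcongr
      rw [Real.norm_eq_abs, ← Real.cosh_abs t, Real.abs_sinh]
      exact (Real.sinh_lt_cosh _).le
    have he : IntegrableOn (fun t : ℝ => Real.exp (-t)) (Ioi 0) := integrableOn_exp_neg_Ioi 0
    have hlim : Tendsto (fun t => -Real.exp (-z * Real.cosh t)) atTop (𝓝 0) := by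
      rw [← neg_zero]
      refine (Real.tendsto_exp_atBot.comp ?_).neg
      refine Tendsto.const_mul_atTop_of_neg (by linarith) ?_
      refine tendsto_atTop_mono quarter_sq_le_cosh ?_
      exact (tendsto_pow_atTop two_ne_zero).atTop_div_const four_pos
    have hS := integral_Ioi_of_hasDerivAt_of_tendsto' (fun t _ => hd t) (hs.const_mul z) hlim
    simp only [Real.cosh_zero, mul_one, zero_sub, neg_neg] at hS
    have hK : z * besselK 1 z = ∫ t in Ioi (0 : ℝ), z * (Real.exp (-z * Real.cosh t) * Real.cosh t) := by
      rw [besselK, integral_const_mul]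
      simp
    rw [hK, ← hS]
    constructor
    · refine setIntegral_mono (hs.const_mul z) (h1.const_mul z) fun t => ?_
      dsimp only
      gcongr
      exact (Real.sinh_lt_cosh t).le
    · have : ∫ t in Ioi (0 : ℝ), z * Real.exp (-t) = z := by
        rw [integral_const_mul, integral_exp_neg_Ioi]; simp
      refine le_trans ?_ (add_le_add_right this.le _)
      rw [← integral_add (hs.const_mul _) (he.const_mul _)]
      refine setIntegral_mono (h1.const_mul z) ((hs.const_mul z).add (he.const_mul z)) fun t => ?_
      have h3 : Real.cosh t = Real.sinh t + Real.exp (-t) := by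
        rw [← Real.cosh_sub_sinh]; ring
      have h4 : Real.exp (-z * Real.cosh t) ≤ 1 := by
        rw [Real.exp_le_one_iff]
        nlinarith [Real.cosh_pos t]
      have h5 : Real.exp (-z * Real.cosh t) * Real.exp (-t) ≤ Real.exp (-t) :=
        mul_le_of_le_one_left (by positivity) h4
      have h6 : Real.exp (-z * Real.cosh t) * Real.cosh t =
          Real.exp (-z * Real.cosh t) * Real.sinh t + Real.exp (-z * Real.cosh t) * Real.exp (-t) := by
        rw [← mul_add, ← h3]
      dsimp only
      nlinarith
  have hc : Tendsto (fun z : ℝ => Real.exp (-z)) (𝓝[>] 0) (𝓝 1) := by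
    have : ContinuousAt (fun z : ℝ => Real.exp (-z)) 0 := by fun_prop
    simpa [ContinuousAt] using this.tendsto.mono_left nhdsWithin_le_nhds
  have hc' : Tendsto (fun z : ℝ => Real.exp (-z) + z) (𝓝[>] 0) (𝓝 1) := by
    have : ContinuousAt (fun z : ℝ => Real.exp (-z) + z) 0 := by fun_prop
    simpa [ContinuousAt] using this.tendsto.mono_left nhdsWithin_le_nhds
  exact tendsto_of_tendsto_of_tendsto_of_le_of_le' hc hc'
    (eventually_nhdsWithin_of_forall fun z hz => (hb z hz).1)
    (eventually_nhdsWithin_of_forall fun z hz => (hb z hz).2)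

/-- The expression has zero derivative on `(0, ∞)`, and its constant value is found as `z → 0⁺`:
`I_0 → 1` and `z K_1 → 1`, while `z I_1 K_0 → 0` because `K_0 ≤ K_1` and `I_1 → 0`. -/
theorem wronskian_zero {z : ℝ} (hz : 0 < z) :
    z * (besselI 0 z * besselK 1 z + besselI 1 z * besselK 0 z) = 1 := by
  set w : ℝ → ℝ := fun z => z * (besselI 0 z * besselK 1 z + besselI 1 z * besselK 0 z) with hw
  have hd : ∀ z ∈ Ioi (0 : ℝ), HasDerivAt w 0 z := by
    intro z hz
    have hz0 : z ≠ 0 := ne_of_gt hz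
    convert! (hasDerivAt_id z).mul (((hasDerivAt_besselI 0 hz0).mul (hasDerivAt_besselK_succ 0 hz)).add
      ((hasDerivAt_besselI_succ 0 hz0).mul (hasDerivAt_besselK 0 hz))) using 1
    simp
    field_simp
    ring
  have hconst : ∀ y ∈ Ioi (0 : ℝ), w y = w z := fun y hy =>
    (isOpen_Ioi.is_const_of_deriv_eq_zero isPreconnected_Ioi
      (fun x hx => (hd x hx).differentiableAt.differentiableWithinAt)
      (fun x hx => (hd x hx).deriv) hy hz)
  have hcI : ∀ n, Continuous (besselISeries n) := fun n =>
    continuous_iff_continuousAt.2 fun x => (hasDerivAt_besselISeries n x).continuousAt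
  have hI0 : Tendsto (besselI 0) (𝓝[>] 0) (𝓝 1) := by
    have : Continuous (besselI 0) := by
      rw [funext (besselI_eq_pow_mul_series 0)]
      have := hcI 0
      fun_prop
    have h2 : besselI 0 0 = 1 := by
      rw [besselI_eq_pow_mul_series, besselISeries, tsum_eq_single 0 (by intro k hk; simp [hk])]
      simp
    simpa [h2] using (this.tendsto 0).mono_left nhdsWithin_le_nhds
  have hI1 : Tendsto (besselI 1) (𝓝[>] 0) (𝓝 0) := by
    have : Continuous (besselI 1) := by
      rw [funext (besselI_eq_pow_mul_series 1)]
      have := hcI 1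
      fun_prop
    have h2 : besselI 1 0 = 0 := by
      rw [besselI_eq_pow_mul_series]; simp
    simpa [h2] using (this.tendsto 0).mono_left nhdsWithin_le_nhds
  have hK0 : Tendsto (fun z => besselI 1 z * (z * besselK 0 z)) (𝓝[>] 0) (𝓝 0) := by
    have hu := hI1.mul tendsto_mul_besselK_one
    rw [zero_mul] at hu
    refine tendsto_of_tendsto_of_tendsto_of_le_of_le' tendsto_const_nhds hu
      (eventually_nhdsWithin_of_forall fun y hy => ?_)
      (eventually_nhdsWithin_of_forall fun y hy => ?_)
    · exact mul_nonneg (besselI_pos 1 hy).le (mul_nonneg (le_of_lt hy) (besselK_pos 0 hy).le)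
    · exact mul_le_mul_of_nonneg_left (mul_le_mul_of_nonneg_left (besselK_le_succ 0 hy) (le_of_lt hy))
        (besselI_pos 1 hy).le
  have h1 : Tendsto w (𝓝[>] 0) (𝓝 1) := by
    have := (hI0.mul tendsto_mul_besselK_one).add hK0
    rw [mul_one, add_zero] at this
    refine this.congr fun y => ?_
    rw [hw]
    ring
  have h2 : Tendsto w (𝓝[>] 0) (𝓝 (w z)) :=
    tendsto_const_nhds.congr' (eventually_nhdsWithin_of_forall fun y hy => (hconst y hy).symm)
  exact tendsto_nhds_unique h2 h1

/-- The recurrences of `I` and `K` in the order show that the expression does not change from `n` to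
`n + 1`. -/
theorem besselI_mul_besselK_wronskian (n : ℕ) {z : ℝ} (hz : 0 < z) :
    z * (besselI n z * besselK (n + 1) z + besselI (n + 1) z * besselK n z) = 1 := by
  induction n with
  | zero => exact wronskian_zero hz
  | succ n ih =>
    have h1 := mul_besselI_recurrence n z
    have h2 := mul_besselK_recurrence n hz
    rw [← ih]
    linear_combination besselI (n + 1) z * h2 - besselK (n + 1) z * h1

theorem bessel_wronskian (n : ℕ) {z : ℝ} (hz : 0 < z) :
    besselI n z * besselKFlux n z + besselIFlux n z * besselK n z = 1 := by
  rw [← besselI_mul_besselK_wronskian n hz, besselIFlux, besselKFlux]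
  ring

/-! ### Two-sided kernels of the radial operators -/

/-- The kernel which is `F₁` for `ρ ≤ s` and `F₂` for `ρ > s`. -/
def splice (F₁ F₂ : ℝ → ℝ → ℝ) (ρ s : ℝ) : ℝ := if ρ ≤ s then F₁ ρ s else F₂ ρ s

/-- `F₁` and `F₂` are the branches of a fundamental solution of
`u ↦ -(ρ / (1 + κ² ρ²) u')' + μ / ρ u`, and `P₁`, `P₂` are their fluxes `ρ / (1 + κ² ρ²) u'`. -/
structure IsRadialKernel (κ μ : ℝ) (F₁ F₂ P₁ P₂ : ℝ → ℝ → ℝ) : Prop where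
  hasDerivAt_left : ∀ ρ s, 0 < ρ → 0 < s →
    HasDerivAt (fun r => F₁ r s) ((1 + κ ^ 2 * ρ ^ 2) / ρ * P₁ ρ s) ρ
  hasDerivAt_right : ∀ ρ s, 0 < ρ → 0 < s →
    HasDerivAt (fun r => F₂ r s) ((1 + κ ^ 2 * ρ ^ 2) / ρ * P₂ ρ s) ρ
  hasDerivAt_flux_left : ∀ ρ s, 0 < ρ → 0 < s → HasDerivAt (fun r => P₁ r s) (μ / ρ * F₁ ρ s) ρ
  hasDerivAt_flux_right : ∀ ρ s, 0 < ρ → 0 < s → HasDerivAt (fun r => P₂ r s) (μ / ρ * F₂ ρ s) ρ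
  diag : ∀ s, 0 < s → F₁ s s = F₂ s s
  jump : ∀ s, 0 < s → P₂ s s - P₁ s s = 1 / (2 * π)
  continuousOn_left : ContinuousOn (Function.uncurry F₁) (Ioi 0 ×ˢ Ioi 0)
  continuousOn_right : ContinuousOn (Function.uncurry F₂) (Ioi 0 ×ˢ Ioi 0)
  continuousOn_flux_left : ContinuousOn (Function.uncurry P₁) (Ioi 0 ×ˢ Ioi 0)
  continuousOn_flux_right : ContinuousOn (Function.uncurry P₂) (Ioi 0 ×ˢ Ioi 0)

/-- The kernels are controlled only on the open quadrant. A measurable function on the whole plane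
that agrees with them there supplies the joint measurability needed for Fubini. -/
theorem exists_measurable_splice {F₁ F₂ : ℝ → ℝ → ℝ}
    (h₁ : ContinuousOn (Function.uncurry F₁) (Ioi 0 ×ˢ Ioi 0))
    (h₂ : ContinuousOn (Function.uncurry F₂) (Ioi 0 ×ˢ Ioi 0)) :
    ∃ G : ℝ × ℝ → ℝ, Measurable G ∧ ∀ ρ s, 0 < ρ → 0 < s → G (ρ, s) = splice F₁ F₂ ρ s := by
  classical
  have hQ : MeasurableSet (Ioi (0 : ℝ) ×ˢ Ioi (0 : ℝ)) := measurableSet_Ioi.prod measurableSet_Ioi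
  have hle : MeasurableSet {p : ℝ × ℝ | p.1 ≤ p.2} := measurableSet_le measurable_fst measurable_snd
  have m₁ := h₁.measurable_piecewise (g := 0) continuousOn_const hQ
  have m₂ := h₂.measurable_piecewise (g := 0) continuousOn_const hQ
  refine ⟨fun p => if p.1 ≤ p.2 then _ else _, Measurable.ite hle m₁ m₂, fun ρ s hρ hs => ?_⟩
  have : ((ρ, s) : ℝ × ℝ) ∈ Ioi (0 : ℝ) ×ˢ Ioi (0 : ℝ) := ⟨hρ, hs⟩
  simp only [piecewise_eq_of_mem _ _ _ this, splice, Function.uncurry]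

theorem splice_eventuallyEq {F₁ F₂ : ℝ → ℝ → ℝ} {ρ s : ℝ} :
    (ρ < s → (fun r => splice F₁ F₂ r s) =ᶠ[𝓝 ρ] fun r => F₁ r s) ∧
    (s < ρ → (fun r => splice F₁ F₂ r s) =ᶠ[𝓝 ρ] fun r => F₂ r s) := by
  constructor <;> intro h
  · filter_upwards [Iio_mem_nhds h] with r hr
    exact if_pos (le_of_lt hr)
  · filter_upwards [Ioi_mem_nhds h] with r hr
    exact if_neg (not_le.2 hr)

namespace IsRadialKernel

variable {κ μ : ℝ} {F₁ F₂ P₁ P₂ : ℝ → ℝ → ℝ}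

theorem hasDerivAt (H : IsRadialKernel κ μ F₁ F₂ P₁ P₂) {ρ s : ℝ} (hρ : 0 < ρ) (hs : 0 < s)
    (hne : ρ ≠ s) : HasDerivAt (fun r => splice F₁ F₂ r s)
      ((1 + κ ^ 2 * ρ ^ 2) / ρ * splice P₁ P₂ ρ s) ρ := by
  rcases lt_or_gt_of_ne hne with h | h
  · rw [splice, if_pos h.le]
    exact (H.hasDerivAt_left ρ s hρ hs).congr_of_eventuallyEq (splice_eventuallyEq.1 h)
  · rw [splice, if_neg (not_le.2 h)]
    exact (H.hasDerivAt_right ρ s hρ hs).congr_of_eventuallyEq (splice_eventuallyEq.2 h)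

theorem continuousOn (H : IsRadialKernel κ μ F₁ F₂ P₁ P₂) {s : ℝ} (hs : 0 < s) :
    ContinuousOn (fun r => splice F₁ F₂ r s) (Ioi 0) := by
  have h1 : ContinuousOn (fun r => F₁ r s) (Ioi 0) := fun r hr =>
    (H.hasDerivAt_left r s hr hs).continuousAt.continuousWithinAt
  have h2 : ContinuousOn (fun r => F₂ r s) (Ioi 0) := fun r hr =>
    (H.hasDerivAt_right r s hr hs).continuousAt.continuousWithinAt
  refine ContinuousOn.if' (s := Ioi 0) (p := fun r => r ≤ s) ?_ ?_ (h1.mono inter_subset_left)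
    (h2.mono inter_subset_left)
  · rintro a ⟨ha, hfr⟩
    have : a = s := by
      have := frontier_le_subset_eq continuous_id continuous_const hfr
      simpa using this
    subst this
    simpa using (h1 a ha).mono_left (nhdsWithin_mono _ inter_subset_left)
  · rintro a ⟨ha, hfr⟩
    have : a = s := by
      have := frontier_le_subset_eq continuous_id continuous_const hfr
      simpa using this
    subst this
    simpa [H.diag a hs] using (h2 a ha).mono_left (nhdsWithin_mono _ inter_subset_left)

variable {E : Type*} [NormedAddCommGroup E] [NormedSpace ℝ E] [CompleteSpace E]

/-- On each side of `s` the integrand is the derivative of `P φ`, since `P' = (μ/ρ) F`. The outer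
boundary terms vanish, and those at `s` combine to minus the jump of the flux. -/
theorem integral_weak (H : IsRadialKernel κ μ F₁ F₂ P₁ P₂) {s : ℝ} (hs : 0 < s)
    {φ φ' : ℝ → E} (hφ : ∀ x, HasDerivAt φ (φ' x) x) (hφ' : Continuous φ') {a b : ℝ} (ha : 0 < a)
    (hsupp : ∀ x, φ x ≠ 0 → a ≤ x ∧ x ≤ b) :
    IntegrableOn (fun ρ => splice P₁ P₂ ρ s • φ' ρ + (μ / ρ * splice F₁ F₂ ρ s) • φ ρ) (Ioi 0) ∧
    ∫ ρ in Ioi (0 : ℝ), (splice P₁ P₂ ρ s • φ' ρ + (μ / ρ * splice F₁ F₂ ρ s) • φ ρ) =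
      -(1 / (2 * π)) • φ s := by
  set Φ : ℝ → E := fun ρ => splice P₁ P₂ ρ s • φ' ρ + (μ / ρ * splice F₁ F₂ ρ s) • φ ρ with hΦ
  have hφc : Continuous φ := continuous_iff_continuousAt.2 fun x => (hφ x).continuousAt
  have hz : ∀ x, x ∉ Icc a b → φ x = 0 := fun x hx => by
    by_contra h
    exact hx (hsupp x h)
  have hz' : ∀ x, x ∉ Icc a b → φ' x = 0 := fun x hx => by
    have : φ =ᶠ[𝓝 x] fun _ => 0 := by
      filter_upwards [isClosed_Icc.isOpen_compl.mem_nhds hx] with y hy using hz y hy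
    exact ((hφ x).congr_of_eventuallyEq this.symm).unique (hasDerivAt_const x 0)
  -- The interval `[a', b']` strictly contains both `[a, b]` and `s`, so `φ` vanishes at its ends
  -- and the splitting at `s` makes sense even when `s` is outside the support.
  obtain ⟨a', ha'0, ha'⟩ := exists_between (lt_min ha hs)
  obtain ⟨ha'a, ha's⟩ := lt_min_iff.1 ha'
  obtain ⟨b', hb'⟩ := exists_gt (max b s)
  obtain ⟨hb'b, hb's⟩ := max_lt_iff.1 hb'
  have hd : ∀ {F P : ℝ → ℝ → ℝ}, (∀ ρ s, 0 < ρ → 0 < s →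
        HasDerivAt (fun r => F r s) ((1 + κ ^ 2 * ρ ^ 2) / ρ * P ρ s) ρ) →
      (∀ ρ s, 0 < ρ → 0 < s → HasDerivAt (fun r => P r s) (μ / ρ * F ρ s) ρ) →
      ∀ {c d : ℝ}, 0 < c → c ≤ d →
      ContinuousOn (fun ρ => P ρ s • φ' ρ + (μ / ρ * F ρ s) • φ ρ) (uIcc c d) ∧
      ∫ ρ in c..d, (P ρ s • φ' ρ + (μ / ρ * F ρ s) • φ ρ) = P d s • φ d - P c s • φ c := by
    intro F P hF hP c d hc hcd
    have hpos : ∀ x ∈ uIcc c d, 0 < x := fun x hx => by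
      rw [uIcc_of_le hcd] at hx
      exact hc.trans_le hx.1
    have hcont : ContinuousOn (fun ρ => P ρ s • φ' ρ + (μ / ρ * F ρ s) • φ ρ) (uIcc c d) := by
      intro x hx
      have hx0 := hpos x hx
      have c1 := (hF x s hx0 hs).continuousAt
      have c2 := (hP x s hx0 hs).continuousAt
      have c3 : ContinuousAt (fun ρ : ℝ => μ / ρ) x :=
        continuousAt_const.div continuousAt_id (ne_of_gt hx0)
      exact ((c2.smul hφ'.continuousAt).add
        ((c3.mul c1).smul hφc.continuousAt)).continuousWithinAt
    refine ⟨hcont, ?_⟩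
    exact intervalIntegral.integral_eq_sub_of_hasDerivAt
      (f := fun ρ => P ρ s • φ ρ)
      (fun x hx => (hP x s (hpos x hx) hs).smul (hφ x)) hcont.intervalIntegrable
  obtain ⟨hc1, hi1⟩ := hd H.hasDerivAt_left H.hasDerivAt_flux_left ha'0 ha's.le
  obtain ⟨hc2, hi2⟩ := hd H.hasDerivAt_right H.hasDerivAt_flux_right hs hb's.le
  have he1 : ∀ x ∈ uIoc a' s, P₁ x s • φ' x + (μ / x * F₁ x s) • φ x = Φ x := by
    intro x hx
    rw [uIoc_of_le ha's.le] at hx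
    simp only [hΦ, splice, if_pos hx.2]
  have he2 : ∀ x ∈ uIoc s b', P₂ x s • φ' x + (μ / x * F₂ x s) • φ x = Φ x := by
    intro x hx
    rw [uIoc_of_le hb's.le] at hx
    simp only [hΦ, splice, if_neg (not_le.2 hx.1)]
  have hI1 : IntervalIntegrable Φ volume a' s :=
    hc1.intervalIntegrable.congr he1
  have hI2 : IntervalIntegrable Φ volume s b' :=
    hc2.intervalIntegrable.congr he2
  have hsub : Ioc a' b' ⊆ Ioi 0 := fun x hx => ha'0.trans hx.1
  have hzero : ∀ x ∈ Ioi (0 : ℝ) \ Ioc a' b', Φ x = 0 := by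
    rintro x ⟨_, hx⟩
    have : x ∉ Icc a b := fun h => hx ⟨ha'a.trans_le h.1, h.2.trans hb'b.le⟩
    simp only [hΦ, hz x this, hz' x this, smul_zero, add_zero]
  have hI : IntegrableOn Φ (Ioc a' b') :=
    (intervalIntegrable_iff_integrableOn_Ioc_of_le (ha's.trans hb's).le).1 (hI1.trans hI2)
  refine ⟨hI.of_forall_sdiff_eq_zero measurableSet_Ioi hzero, ?_⟩
  have he : ∫ x in Ioi 0, Φ x = ∫ x in Ioc a' b', Φ x :=
    setIntegral_eq_of_subset_of_forall_sdiff_eq_zero measurableSet_Ioi hsub hzero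
  rw [he, ← intervalIntegral.integral_of_le (ha's.trans hb's).le,
    ← intervalIntegral.integral_add_adjacent_intervals hI1 hI2,
    
    ← intervalIntegral.integral_congr_ae (Eventually.of_forall he1),
    ← intervalIntegral.integral_congr_ae (Eventually.of_forall he2), hi1, hi2,
    hz a' (fun h => absurd h.1 (not_le.2 ha'a)), hz b' (fun h => absurd h.2 (not_le.2 hb'b)),
    smul_zero, smul_zero, sub_zero, zero_sub, neg_smul, ← H.jump s hs, sub_smul]
  abel

end IsRadialKernel

/-! ### The coefficients of the Green function as radial kernels -/

theorem besselI_continuousOn (n : ℕ) : ContinuousOn (besselI n) (Ioi 0) := fun _ hz =>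
  (hasDerivAt_besselI n (ne_of_gt hz)).continuousAt.continuousWithinAt

theorem besselK_continuousOn (n : ℕ) : ContinuousOn (besselK n) (Ioi 0) := fun _ hz =>
  (hasDerivAt_besselK n hz).continuousAt.continuousWithinAt

theorem besselIFlux_continuousOn (n : ℕ) : ContinuousOn (besselIFlux n) (Ioi 0) := fun _ hz =>
  (hasDerivAt_besselIFlux n (ne_of_gt hz)).continuousAt.continuousWithinAt

theorem besselKFlux_continuousOn (n : ℕ) : ContinuousOn (besselKFlux n) (Ioi 0) := fun _ hz =>
  (hasDerivAt_besselKFlux n hz).continuousAt.continuousWithinAt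

theorem continuousOn_uncurry_mul_const {f g : ℝ → ℝ} (hf : ContinuousOn f (Ioi 0))
    (hg : ContinuousOn g (Ioi 0)) {a : ℝ} (ha : 0 < a) (c : ℝ) :
    ContinuousOn (Function.uncurry fun ρ s => c * (f (a * ρ) * g (a * s))) (Ioi 0 ×ˢ Ioi 0) := by
  have h1 : ContinuousOn (fun p : ℝ × ℝ => f (a * p.1)) (Ioi 0 ×ˢ Ioi 0) :=
    hf.comp (by fun_prop) fun p hp => mul_pos ha hp.1
  have h2 : ContinuousOn (fun p : ℝ × ℝ => g (a * p.2)) (Ioi 0 ×ˢ Ioi 0) :=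
    hg.comp (by fun_prop) fun p hp => mul_pos ha hp.2
  exact continuousOn_const.mul (h1.mul h2)

/-- At `z = nρ/h` the coefficient in Bessel's equation is `z² + n² = n² (1 + ρ²/h²)`, which produces
the weight of the operator. The jump condition is the Wronskian in flux form. -/
theorem isRadialKernel_bessel {h : ℝ} (hh : 0 < h) {n : ℕ} (hn : n ≠ 0) :
    IsRadialKernel (1 / h) ((n : ℝ) ^ 2)
      (fun ρ s => -1 / (2 * π * n ^ 2) * (besselIFlux n (n / h * ρ) * besselKFlux n (n / h * s)))
      (fun ρ s => -1 / (2 * π * n ^ 2) * (besselKFlux n (n / h * ρ) * besselIFlux n (n / h * s)))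
      (fun ρ s => -1 / (2 * π) * (besselI n (n / h * ρ) * besselKFlux n (n / h * s)))
      (fun ρ s => 1 / (2 * π) * (besselK n (n / h * ρ) * besselIFlux n (n / h * s))) := by
  have hn0 : (0 : ℝ) < n := by positivity
  have ha : 0 < n / h := by positivity
  have hd : ∀ {f : ℝ → ℝ} {f' ρ : ℝ}, HasDerivAt f f' (n / h * ρ) →
      HasDerivAt (fun r => f (n / h * r)) (f' * (n / h)) ρ := by
    intro f f' ρ hf
    have := hf.comp ρ ((hasDerivAt_id ρ).const_mul ((n : ℝ) / h))
    rw [mul_one] at this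
    exact this
  constructor
  · intro ρ s hρ hs
    have hz : 0 < n / h * ρ := by positivity
    convert! (((hd (hasDerivAt_besselIFlux n hz.ne')).mul_const _).const_mul _) using 1
    field_simp
    ring
  · intro ρ s hρ hs
    have hz : 0 < n / h * ρ := by positivity
    convert! (((hd (hasDerivAt_besselKFlux n hz)).mul_const _).const_mul _) using 1
    field_simp
    ring
  · intro ρ s hρ hs
    have hz : 0 < n / h * ρ := by positivity
    convert! (((hd (hasDerivAt_besselI_flux n hz.ne')).mul_const _).const_mul _) using 1
    field_simp
  · intro ρ s hρ hs
    have hz : 0 < n / h * ρ := by positivity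
    convert! (((hd (hasDerivAt_besselK_flux n hz)).mul_const _).const_mul _) using 1
    field_simp
  · intro s hs
    ring
  · intro s hs
    have hz : 0 < n / h * s := by positivity
    have := bessel_wronskian n hz
    linear_combination 1 / (2 * π) * this
  · exact continuousOn_uncurry_mul_const (besselIFlux_continuousOn n) (besselKFlux_continuousOn n) ha _
  · exact continuousOn_uncurry_mul_const (besselKFlux_continuousOn n) (besselIFlux_continuousOn n) ha _
  · exact continuousOn_uncurry_mul_const (besselI_continuousOn n) (besselKFlux_continuousOn n) ha _
  · exact continuousOn_uncurry_mul_const (besselK_continuousOn n) (besselIFlux_continuousOn n) ha _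

theorem isRadialKernel_log (κ : ℝ) :
    IsRadialKernel κ 0 (fun _ _ => 0)
      (fun ρ s => 1 / (2 * π) * (Real.log ρ + κ ^ 2 * ρ ^ 2 / 2 - (Real.log s + κ ^ 2 * s ^ 2 / 2)))
      (fun _ _ => 0) (fun _ _ => 1 / (2 * π)) := by
  have hlog1 : ContinuousOn (fun p : ℝ × ℝ => Real.log p.1) (Ioi 0 ×ˢ Ioi 0) :=
    continuousOn_fst.log fun p hp => ne_of_gt hp.1
  have hlog2 : ContinuousOn (fun p : ℝ × ℝ => Real.log p.2) (Ioi 0 ×ˢ Ioi 0) :=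
    continuousOn_snd.log fun p hp => ne_of_gt hp.2
  constructor
  · intro ρ s _ _
    simpa using hasDerivAt_const ρ (0 : ℝ)
  · intro ρ s hρ _
    convert! ((((Real.hasDerivAt_log hρ.ne').add
      (((hasDerivAt_pow 2 ρ).const_mul (κ ^ 2)).div_const 2)).sub_const
      (Real.log s + κ ^ 2 * s ^ 2 / 2)).const_mul (1 / (2 * π))) using 1
    field_simp
    ring
  · intro ρ s _ _
    simpa using hasDerivAt_const ρ (0 : ℝ)
  · intro ρ s _ _
    simpa using hasDerivAt_const ρ (1 / (2 * π) : ℝ)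
  · intro s _
    simp
  · intro s _
    simp
  · exact continuousOn_const
  · exact continuousOn_const.mul ((hlog1.add (by fun_prop)).sub (hlog2.add (by fun_prop)))
  · exact continuousOn_const
  · exact continuousOn_const

/-- The prefactor `ρ s / h²` is the product of the two Bessel arguments divided by `m²`, so each
derivative becomes a flux; the minus sign comes from the convention `-z K_n'`. -/
theorem greenCoeff_eq_splice_bessel {h : ℝ} (hh : 0 < h) {m : ℤ} (hm : m ≠ 0) {ρ s : ℝ}
    (hρ : 0 < ρ) (hs : 0 < s) : greenCoeff h m ρ s = splice
      (fun ρ s => -1 / (2 * π * m.natAbs ^ 2) *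
        (besselIFlux m.natAbs (m.natAbs / h * ρ) * besselKFlux m.natAbs (m.natAbs / h * s)))
      (fun ρ s => -1 / (2 * π * m.natAbs ^ 2) *
        (besselKFlux m.natAbs (m.natAbs / h * ρ) * besselIFlux m.natAbs (m.natAbs / h * s))) ρ s := by
  have hn0 : (0 : ℝ) < m.natAbs := by
    exact_mod_cast Int.natAbs_pos.2 hm
  have key : ∀ r : ℝ, 0 < r → (m.natAbs : ℝ) * r / h = m.natAbs / h * r ∧ 0 < m.natAbs / h * r :=
    fun r hr => ⟨by ring, by positivity⟩
  simp only [greenCoeff, if_neg hm, splice, (key ρ hρ).1, (key s hs).1,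
    ← mul_deriv_besselI m.natAbs (key ρ hρ).2.ne', ← mul_deriv_besselI m.natAbs (key s hs).2.ne',
    ← neg_eq_iff_eq_neg.2 (mul_deriv_besselK m.natAbs (key ρ hρ).2),
    ← neg_eq_iff_eq_neg.2 (mul_deriv_besselK m.natAbs (key s hs).2)]
  split_ifs
  · field_simp
  · field_simp

theorem greenCoeff_eq_splice_log (h : ℝ) {ρ s : ℝ} (hρ : 0 < ρ) (hs : 0 < s) :
    greenCoeff h 0 ρ s = splice (fun _ _ => 0) (fun ρ s => 1 / (2 * π) *
      (Real.log ρ + (1 / h) ^ 2 * ρ ^ 2 / 2 - (Real.log s + (1 / h) ^ 2 * s ^ 2 / 2))) ρ s := by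
  simp only [greenCoeff, if_true, splice]
  refine if_congr Iff.rfl rfl ?_
  congr 1
  have hpos : ∀ x ∈ uIcc s ρ, 0 < x := fun x hx =>
    (lt_min hs hρ).trans_le hx.1
  rw [intervalIntegral.integral_eq_sub_of_hasDerivAt
    (f := fun x => Real.log x + (1 / h) ^ 2 * x ^ 2 / 2)]
  · intro x hx
    convert! (Real.hasDerivAt_log (hpos x hx).ne').add
      (((hasDerivAt_pow 2 x).const_mul ((1 / h) ^ 2)).div_const 2) using 1
    have := hpos x hx
    push_cast
    field_simp
  · refine ContinuousOn.intervalIntegrable (ContinuousOn.div (by fun_prop) continuousOn_id ?_)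
    exact fun x hx => (hpos x hx).ne'

theorem exists_isRadialKernel_greenCoeff {h : ℝ} (hh : 0 < h) (m : ℤ) :
    ∃ F₁ F₂ P₁ P₂, IsRadialKernel (1 / h) ((m : ℝ) ^ 2) F₁ F₂ P₁ P₂ ∧
      ∀ ρ s, 0 < ρ → 0 < s → greenCoeff h m ρ s = splice F₁ F₂ ρ s := by
  rcases eq_or_ne m 0 with rfl | hm
  · refine ⟨_, _, fun _ _ => 0, fun _ _ => 1 / (2 * π), ?_,
      fun ρ s hρ hs => greenCoeff_eq_splice_log h hρ hs⟩
    simpa using isRadialKernel_log (1 / h)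
  · have hk := isRadialKernel_bessel hh (Int.natAbs_ne_zero.2 hm)
    have hc : ((m.natAbs : ℕ) : ℝ) ^ 2 = (m : ℝ) ^ 2 := by
      rw [Nat.cast_natAbs, Int.cast_abs, sq_abs]
    rw [hc] at hk
    exact ⟨_, _, _, _, hk, fun ρ s hρ hs => by rw [greenCoeff_eq_splice_bessel hh hm hρ hs, hc]⟩

/-- `∂_ρ G_m(ρ, s)`. -/
def greenDeriv (h : ℝ) (m : ℤ) (ρ s : ℝ) : ℝ := deriv (fun r => greenCoeff h m r s) ρ

theorem IsRadialKernel.hasDerivAt_greenCoeff {h : ℝ} {m : ℤ} {κ μ : ℝ} {F₁ F₂ P₁ P₂ : ℝ → ℝ → ℝ}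
    (H : IsRadialKernel κ μ F₁ F₂ P₁ P₂)
    (hF : ∀ ρ s, 0 < ρ → 0 < s → greenCoeff h m ρ s = splice F₁ F₂ ρ s) {ρ s : ℝ} (hρ : 0 < ρ)
    (hs : 0 < s) (hne : ρ ≠ s) : HasDerivAt (fun r => greenCoeff h m r s)
      ((1 + κ ^ 2 * ρ ^ 2) / ρ * splice P₁ P₂ ρ s) ρ := by
  refine (H.hasDerivAt hρ hs hne).congr_of_eventuallyEq ?_
  filter_upwards [Ioi_mem_nhds hρ] with r hr using hF r s hr hs

theorem hasDerivAt_greenCoeff {h : ℝ} (hh : 0 < h) (m : ℤ) {ρ s : ℝ} (hρ : 0 < ρ) (hs : 0 < s)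
    (hne : ρ ≠ s) : HasDerivAt (fun r => greenCoeff h m r s) (greenDeriv h m ρ s) ρ := by
  obtain ⟨F₁, F₂, P₁, P₂, H, hF⟩ := exists_isRadialKernel_greenCoeff hh m
  exact (H.hasDerivAt_greenCoeff hF hρ hs hne).differentiableAt.hasDerivAt

theorem continuousOn_greenCoeff {h : ℝ} (hh : 0 < h) (m : ℤ) {s : ℝ} (hs : 0 < s) :
    ContinuousOn (fun r => greenCoeff h m r s) (Ioi 0) := by
  obtain ⟨F₁, F₂, P₁, P₂, H, hF⟩ := exists_isRadialKernel_greenCoeff hh m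
  exact (H.continuousOn hs).congr fun r hr => hF r s hr hs

theorem exists_measurable_greenCoeff {h : ℝ} (hh : 0 < h) (m : ℤ) :
    ∃ G : ℝ × ℝ → ℝ, Measurable G ∧ ∀ ρ s, 0 < ρ → 0 < s → G (ρ, s) = greenCoeff h m ρ s := by
  obtain ⟨F₁, F₂, P₁, P₂, H, hF⟩ := exists_isRadialKernel_greenCoeff hh m
  obtain ⟨G, hG, hG'⟩ := exists_measurable_splice H.continuousOn_left H.continuousOn_right
  exact ⟨G, hG, fun ρ s hρ hs => by rw [hG' ρ s hρ hs, hF ρ s hρ hs]⟩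

theorem exists_measurable_greenDeriv {h : ℝ} (hh : 0 < h) (m : ℤ) :
    ∃ D : ℝ × ℝ → ℝ, Measurable D ∧
      ∀ ρ s, 0 < ρ → 0 < s → ρ ≠ s → D (ρ, s) = greenDeriv h m ρ s := by
  obtain ⟨F₁, F₂, P₁, P₂, H, hF⟩ := exists_isRadialKernel_greenCoeff hh m
  obtain ⟨P, hP, hP'⟩ := exists_measurable_splice H.continuousOn_flux_left H.continuousOn_flux_right
  refine ⟨fun p => (1 + (1 / h) ^ 2 * p.1 ^ 2) / p.1 * P p, by fun_prop, fun ρ s hρ hs hne => ?_⟩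
  rw [greenDeriv, (H.hasDerivAt_greenCoeff hF hρ hs hne).deriv, ← hP' ρ s hρ hs]

theorem greenCoeff_integral_weak {E : Type*} [NormedAddCommGroup E] [NormedSpace ℝ E]
    [CompleteSpace E] {h : ℝ} (hh : 0 < h) (m : ℤ) {s : ℝ} (hs : 0 < s)
    {φ φ' : ℝ → E} (hφ : ∀ x, HasDerivAt φ (φ' x) x) (hφ' : Continuous φ') {a b : ℝ} (ha : 0 < a)
    (hsupp : ∀ x, φ x ≠ 0 → a ≤ x ∧ x ≤ b) :
    IntegrableOn (fun ρ => (ρ / (1 + (1 / h) ^ 2 * ρ ^ 2) * greenDeriv h m ρ s) • φ' ρ +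
      ((m : ℝ) ^ 2 / ρ * greenCoeff h m ρ s) • φ ρ) (Ioi 0) ∧
    ∫ ρ in Ioi (0 : ℝ), ((ρ / (1 + (1 / h) ^ 2 * ρ ^ 2) * greenDeriv h m ρ s) • φ' ρ +
      ((m : ℝ) ^ 2 / ρ * greenCoeff h m ρ s) • φ ρ) = -(1 / (2 * π)) • φ s := by
  obtain ⟨F₁, F₂, P₁, P₂, H, hF⟩ := exists_isRadialKernel_greenCoeff hh m
  have hae : (fun ρ => splice P₁ P₂ ρ s • φ' ρ + ((m : ℝ) ^ 2 / ρ * splice F₁ F₂ ρ s) • φ ρ)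
      =ᵐ[volume.restrict (Ioi 0)] fun ρ => (ρ / (1 + (1 / h) ^ 2 * ρ ^ 2) * greenDeriv h m ρ s) • φ' ρ +
      ((m : ℝ) ^ 2 / ρ * greenCoeff h m ρ s) • φ ρ := by
    have hne : ∀ᵐ ρ ∂(volume.restrict (Ioi (0 : ℝ))), ρ ≠ s := Measure.ae_ne _ s
    filter_upwards [hne, ae_restrict_mem measurableSet_Ioi] with ρ hρs hρ
    have hρ0 : (0 : ℝ) < ρ := hρ
    rw [greenDeriv, (H.hasDerivAt_greenCoeff hF hρ hs hρs).deriv, hF ρ s hρ hs]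
    congr 2
    have : 0 < 1 + (1 / h) ^ 2 * ρ ^ 2 := by positivity
    field_simp
  obtain ⟨h1, h2⟩ := H.integral_weak hs hφ hφ' ha hsupp
  exact ⟨h1.congr hae, by rw [← integral_congr_ae hae, h2]⟩

/-! ### Bounds for the coefficients -/

/-- Replace the flux of `K_n` by `(n + z) K_n`; the remaining product is one of the two positive
terms of the Wronskian, hence at most `1`. -/
theorem besselIFlux_mul_besselKFlux_le {n : ℕ} (hn : n ≠ 0) {z : ℝ} (hz : 0 < z) :
    besselIFlux n z * besselKFlux n z ≤ n + z := by
  have h1 := bessel_wronskian n hz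
  have h2 : 0 ≤ besselI n z * besselKFlux n z :=
    mul_nonneg (besselI_pos n hz).le (besselKFlux_pos hn hz).le
  calc _ ≤ besselIFlux n z * ((n + z) * besselK n z) :=
        mul_le_mul_of_nonneg_left (besselKFlux_le_mul hn hz) (besselIFlux_pos n hz).le
    _ = (n + z) * (besselIFlux n z * besselK n z) := by ring
    _ ≤ (n + z) * 1 := by
        refine mul_le_mul_of_nonneg_left (by linarith) (by positivity)
    _ = _ := mul_one _

/-- The factor evaluated at `s` is compared with its value at `ρ`, at the cost of `q^n`; the product
at `ρ` is then at most `n (1 + ρ/h)`. For the derivative one flux is replaced by `I_n` or `K_n`,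
which is smaller by a factor `n`, but the prefactor `1/n²` is lost. -/
theorem abs_greenCoeff_le {h : ℝ} (hh : 0 < h) {m : ℤ} (hm : m ≠ 0) {ρ s : ℝ}
    (hρ : 0 < ρ) (hs : 0 < s) (hne : ρ ≠ s) :
    |greenCoeff h m ρ s| ≤ (1 + ρ / h) / (2 * π) * (√(min ρ s / max ρ s) ^ m.natAbs / m.natAbs) ∧
    |greenDeriv h m ρ s| ≤ (1 + (1 / h) ^ 2 * ρ ^ 2) / ρ *
      ((1 + ρ / h) / (2 * π) * √(min ρ s / max ρ s) ^ m.natAbs) := by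
  have hn : m.natAbs ≠ 0 := Int.natAbs_ne_zero.2 hm
  have hF := fun ρ s => greenCoeff_eq_splice_bessel hh hm (ρ := ρ) (s := s)
  rw [greenDeriv, ((isRadialKernel_bessel hh hn).hasDerivAt_greenCoeff hF hρ hs hne).deriv, hF ρ s hρ hs,
    abs_mul, abs_of_nonneg (a := (1 + (1 / h) ^ 2 * ρ ^ 2) / ρ) (by positivity)]
  generalize m.natAbs = n at hn
  have hn0 : (0 : ℝ) < n := by positivity
  set a : ℝ := n / h with ha
  have ha0 : 0 < a := by positivity
  have hz : 0 < a * ρ := by positivity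
  have hzs : 0 < a * s := by positivity
  have hUW := besselIFlux_mul_besselKFlux_le hn hz
  have haρ : (n : ℝ) + a * ρ = n * (1 + ρ / h) := by rw [ha]; ring
  rw [haρ] at hUW
  have hU := besselIFlux_pos n hz
  have hUs := besselIFlux_pos n hzs
  have hW := besselKFlux_pos hn hz
  have hWs := besselKFlux_pos hn hzs
  have hI := besselI_pos n hz
  have hK := besselK_pos n hz
  have hIU := mul_besselI_le_besselIFlux n hz
  have hKW := mul_besselK_le_besselKFlux hn hz
  set q := √(min ρ s / max ρ s) with hq
  have hq0 : 0 ≤ q := Real.sqrt_nonneg _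
  have hcancel : ∀ {x y : ℝ}, a * x / (a * y) = x / y := fun {x y} => by
    rw [mul_div_mul_left _ _ ha0.ne']
  have main : ∀ {A B f : ℝ}, 0 < A → 0 < B → A * B ≤ q ^ n * (n * (1 + ρ / h)) →
      n * f ≤ A → 0 < f → |-1 / (2 * π * n ^ 2) * (A * B)| ≤ (1 + ρ / h) / (2 * π) * (q ^ n / n) ∧
      f * B / (2 * π) ≤ (1 + ρ / h) / (2 * π) * q ^ n := by
    intro A B f hA hB hAB hfA hf
    constructor
    · rw [abs_mul, abs_div, abs_neg, abs_one, abs_of_pos (a := 2 * π * (n : ℝ) ^ 2) (by positivity),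
        abs_of_pos (mul_pos hA hB)]
      calc _ ≤ 1 / (2 * π * n ^ 2) * (q ^ n * (n * (1 + ρ / h))) := by gcongr
        _ = _ := by field_simp
    · have : n * (f * B) ≤ n * ((1 + ρ / h) * q ^ n) := by nlinarith
      have := le_of_mul_le_mul_left this hn0
      calc _ ≤ ((1 + ρ / h) * q ^ n) / (2 * π) := by gcongr
        _ = _ := by ring
  rcases le_or_gt ρ s with hle | hgt
  · have hW' := besselKFlux_le hn hz (mul_le_mul_of_nonneg_left hle ha0.le)
    rw [hcancel] at hW'
    rw [min_eq_left hle, max_eq_right hle] at hq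
    rw [← hq] at hW'
    have := main hU hWs (f := besselI n (a * ρ)) (by
      calc _ ≤ besselIFlux n (a * ρ) * (q ^ n * besselKFlux n (a * ρ)) := by gcongr
        _ = q ^ n * (besselIFlux n (a * ρ) * besselKFlux n (a * ρ)) := by ring
        _ ≤ _ := by gcongr) hIU hI
    simp only [splice, if_pos hle]
    refine ⟨this.1, ?_⟩
    gcongr
    refine le_trans (le_of_eq ?_) this.2
    rw [abs_mul, abs_div, abs_neg, abs_one, abs_of_pos (a := 2 * π) (by positivity),
        abs_of_pos (mul_pos hI hWs)]
    ring
  · have hU' := besselIFlux_le n hzs (mul_le_mul_of_nonneg_left hgt.le ha0.le)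
    rw [hcancel] at hU'
    rw [min_eq_right hgt.le, max_eq_left hgt.le] at hq
    -- On this side the comparison of the `I`-fluxes gives the better ratio `s/ρ`; it is weakened to
    -- its square root so that both sides share one bound.
    have h01 : s / ρ ≤ q := by
      rw [hq]
      refine Real.le_sqrt_of_sq_le ?_
      have : s / ρ ≤ 1 := (div_le_one hρ).2 hgt.le
      have : 0 ≤ s / ρ := by positivity
      nlinarith
    have := main hW hUs (f := besselK n (a * ρ)) (by
      calc _ ≤ besselKFlux n (a * ρ) * (q ^ n * besselIFlux n (a * ρ)) := by
            gcongr
            exact hU'.trans (by gcongr)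
        _ = q ^ n * (besselIFlux n (a * ρ) * besselKFlux n (a * ρ)) := by ring
        _ ≤ _ := by gcongr) hKW hK
    simp only [splice, if_neg (not_le.2 hgt)]
    refine ⟨this.1, ?_⟩
    gcongr
    refine le_trans (le_of_eq ?_) this.2
    rw [abs_mul, abs_of_pos (a := 1 / (2 * π)) (by positivity), abs_of_pos (mul_pos hK hUs)]
    ring

/-- The coefficient is logarithmically singular as `s → 0`; the factor `s` of the area element
absorbs this, since `s log (ρ/s) ≤ ρ`. -/
theorem abs_greenCoeff_zero_le (h : ℝ) {ρ s : ℝ} (hρ : 0 < ρ) (hs : 0 < s) (hne : ρ ≠ s) :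
    |greenCoeff h 0 ρ s| * s ≤ 1 / (2 * π) * (ρ + (1 / h) ^ 2 * ρ ^ 3 / 2) ∧
    |greenDeriv h 0 ρ s| ≤ (1 + (1 / h) ^ 2 * ρ ^ 2) / ρ * (1 / (2 * π)) := by
  have hF := fun ρ s => greenCoeff_eq_splice_log h (ρ := ρ) (s := s)
  rw [greenDeriv, ((isRadialKernel_log (1 / h)).hasDerivAt_greenCoeff hF hρ hs hne).deriv, hF ρ s hρ hs,
    abs_mul, abs_of_nonneg (a := (1 + (1 / h) ^ 2 * ρ ^ 2) / ρ) (by positivity)]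
  rcases le_or_gt ρ s with hle | hgt
  · simp only [splice, if_pos hle, abs_zero, zero_mul, mul_zero]
    constructor <;> positivity
  · simp only [splice, if_neg (not_le.2 hgt)]
    constructor
    · have h1 := Real.log_le_sub_one_of_pos (show 0 < ρ / s by positivity)
      rw [Real.log_div hρ.ne' hs.ne'] at h1
      have h2 : s * (Real.log ρ - Real.log s) ≤ ρ := by
        calc _ ≤ s * (ρ / s) := by gcongr; linarith
          _ = ρ := by field_simp
      have h3 : 0 ≤ Real.log ρ - Real.log s := sub_nonneg.2 (Real.log_le_log hs hgt.le)
      have h4 : s ^ 2 ≤ ρ ^ 2 := by gcongr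
      have h6 : 0 ≤ (1 / h) ^ 2 * (ρ ^ 2 - s ^ 2) := mul_nonneg (by positivity) (by linarith)
      have h5 : (1 / h) ^ 2 * (ρ ^ 2 - s ^ 2) * s ≤ (1 / h) ^ 2 * ρ ^ 3 := by
        calc _ ≤ (1 / h) ^ 2 * ρ ^ 2 * ρ := by
              gcongr
              · have := sq_nonneg s
                linarith
          _ = _ := by ring
      rw [abs_of_nonneg (mul_nonneg (by positivity) (by linarith)), mul_assoc]
      gcongr
      linarith
    · rw [abs_of_pos (by positivity)]

/-! ### Bounds that are uniform in the angular frequency -/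

/-- The weight `|m|^(-3/4)`, and `1` for `m = 0`. -/
def freqWeight (m : ℤ) : ℝ := if m = 0 then 1 else (m.natAbs : ℝ) ^ (-(3 / 4) : ℝ)

theorem freqWeight_pos (m : ℤ) : 0 < freqWeight m := by
  rw [freqWeight]
  split_ifs with hm
  · exact one_pos
  · have : (0 : ℝ) < m.natAbs := by exact_mod_cast Int.natAbs_pos.2 hm
    positivity

/-- The exponent `3/4` must exceed `1/2` for this sum to converge, and be below `1` for `singWeight`
to be integrable; any value strictly between would serve. -/
theorem summable_freqWeight_sq : Summable fun m => freqWeight m ^ 2 := by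
  have h := Real.summable_abs_int_rpow (b := 3 / 2) (by norm_num)
  refine (h.congr_cofinite ?_)
  filter_upwards [(finite_singleton (0 : ℤ)).compl_mem_cofinite] with m hm
  have hm0 : m ≠ 0 := hm
  rw [freqWeight, if_neg hm0, Nat.cast_natAbs, Int.cast_abs, ← Real.rpow_natCast,
    ← Real.rpow_mul (abs_nonneg _)]
  norm_num

/-- The weakly singular weight `|t|^(-3/4)`. -/
def singWeight (t : ℝ) : ℝ := |t| ^ (-(3 / 4) : ℝ)

theorem singWeight_nonneg (t : ℝ) : 0 ≤ singWeight t := Real.rpow_nonneg (abs_nonneg t) _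

theorem integrableOn_singWeight (L : ℝ) : IntegrableOn singWeight (Ioo (-L) L) := by
  have h1 : IntegrableOn singWeight (Ioo 0 L) := by
    rcases le_or_gt L 0 with hL | hL
    · simp [Ioo_eq_empty (not_lt.2 hL)]
    have := (intervalIntegral.intervalIntegrable_rpow' (a := 0) (b := L) (r := -(3 / 4)) (by norm_num))
    rw [intervalIntegrable_iff_integrableOn_Ioo_of_le hL.le] at this
    refine this.congr_fun (fun t ht => ?_) measurableSet_Ioo
    rw [singWeight, abs_of_pos ht.1]
  have h2 : IntegrableOn singWeight (Ioo (-L) 0) := by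
    have h3 : IntegrableOn (fun t => singWeight (-t)) (Ioo (-L) 0) := by
      have := (Measure.measurePreserving_neg (volume : Measure ℝ)).integrableOn_comp_preimage
        (Homeomorph.neg ℝ).measurableEmbedding (f := singWeight) (s := Ioo 0 L)
      rw [show (Neg.neg : ℝ → ℝ) ⁻¹' (Ioo 0 L) = Ioo (-L) 0 by ext; simp] at this
      exact this.2 h1
    exact h3.congr_fun (fun t _ => by simp [singWeight]) measurableSet_Ioo
  refine IntegrableOn.mono_set ((h2.union h1).union (integrableOn_singleton (x := (0 : ℝ)) (by simp) (by simp)))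
    fun t ht => ?_
  rcases lt_trichotomy t 0 with h | h | h
  · exact Or.inl (Or.inl ⟨ht.1, h⟩)
  · exact Or.inr h
  · exact Or.inl (Or.inr ⟨h, ht.2⟩)

/-- The integrals of the weight over `(0, R)`, with the singularity anywhere in `[α, β]`, have a
common bound. -/
theorem exists_integral_singWeight_le (β R : ℝ) (hR : 0 < R) : ∃ J : ℝ, 0 ≤ J ∧ ∀ ρ, 0 < ρ → ρ ≤ β →
    IntegrableOn (fun s => singWeight (ρ - s)) (Ioo 0 R) ∧
    ∫ s in Ioo 0 R, singWeight (ρ - s) ≤ J := by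
  -- For `0 < ρ ≤ β` and `0 < s < R` the difference `ρ - s` lies in `(-L, L)`, so every integral is
  -- dominated by that of the truncated weight over the line, which is translation invariant.
  set L := β + R
  set k : ℝ → ℝ := (Ioo (-L) L).indicator singWeight with hk
  have hki : Integrable k := (integrableOn_singWeight L).integrable_indicator measurableSet_Ioo
  have hk0 : ∀ t, 0 ≤ k t := fun t => indicator_nonneg (fun t _ => singWeight_nonneg t) t
  refine ⟨∫ t, k t, integral_nonneg hk0, fun ρ hρ hρβ => ?_⟩
  have hc : Integrable fun s => k (ρ - s) := hki.comp_sub_left ρ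
  have he : EqOn (fun s => k (ρ - s)) (fun s => singWeight (ρ - s)) (Ioo 0 R) := by
    intro s hs
    refine indicator_of_mem ?_ _
    simp only [L]
    constructor <;> linarith [hs.1, hs.2]
  refine ⟨hc.integrableOn.congr_fun he measurableSet_Ioo, ?_⟩
  rw [← setIntegral_congr_fun measurableSet_Ioo he, ← integral_sub_left_eq_self k volume ρ]
  exact setIntegral_le_integral hc (Eventually.of_forall fun s => hk0 _)

/-- With `y = |ρ - s| / L` the base is at most `√(1 - y) ≤ 1 - y/2`. Bernoulli applied to `(1 +
y/2)^n` gives `q^n · n y/2 ≤ (1 - y²/4)^n ≤ 1`. Together with `q^n ≤ 1` this yields every power `(n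
y/2)^(-θ)` with `0 ≤ θ ≤ 1`. -/
theorem sqrt_min_div_max_pow_le {ρ s L : ℝ} (hρ : 0 < ρ) (hs : 0 < s) (hne : ρ ≠ s)
    (hL : max ρ s ≤ L) {n : ℕ} (hn : n ≠ 0) :
    √(min ρ s / max ρ s) ^ n ≤
      (2 * L) ^ (3 / 4 : ℝ) * ((n : ℝ) ^ (-(3 / 4) : ℝ) * singWeight (ρ - s)) := by
  have hM : 0 < max ρ s := lt_max_of_lt_left hρ
  have hn0 : (0 : ℝ) < n := by positivity
  have hd : 0 < |ρ - s| := abs_pos.2 (sub_ne_zero.2 hne)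
  set y : ℝ := |ρ - s| / L with hy
  have hL0 : 0 < L := hM.trans_le hL
  have hy0 : 0 < y := by positivity
  have hm : min ρ s / max ρ s = 1 - |ρ - s| / max ρ s := by
    rw [← max_sub_min_eq_abs', sub_div, div_self hM.ne']
    ring
  have hm1 : min ρ s / max ρ s ≤ 1 - y := by
    rw [hm, hy]
    gcongr
  have hm0 : 0 ≤ min ρ s / max ρ s := div_nonneg (lt_min hρ hs).le hM.le
  have hq : √(min ρ s / max ρ s) ≤ 1 - y / 2 := by
    refine Real.sqrt_le_iff.2 ⟨by linarith, by nlinarith⟩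
  set q := √(min ρ s / max ρ s)
  have hq0 : 0 ≤ q := Real.sqrt_nonneg _
  have h1 : q ^ n ≤ 1 := pow_le_one₀ hq0 (by linarith)
  have h2 : q ^ n * (n * (y / 2)) ≤ 1 := by
    have hb := one_add_mul_le_pow (show (-2 : ℝ) ≤ y / 2 by linarith) n
    calc q ^ n * (n * (y / 2)) ≤ (1 - y / 2) ^ n * (1 + y / 2) ^ n := by
          have : q ^ n ≤ (1 - y / 2) ^ n := by gcongr
          have h0 : 0 ≤ (1 - y / 2) ^ n := pow_nonneg (hq0.trans hq) n
          gcongr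
          linarith
      _ = (1 - y ^ 2 / 4) ^ n := by rw [← mul_pow]; ring
      _ ≤ 1 := pow_le_one₀ (by nlinarith [hq0.trans hq]) (by nlinarith)
  set b : ℝ := n * (y / 2) with hb
  have hb0 : 0 < b := by positivity
  have h3 : q ^ n ≤ b ^ (-(3 / 4) : ℝ) := by
    calc q ^ n = (q ^ n) ^ (1 : ℝ) := (Real.rpow_one _).symm
      _ ≤ (q ^ n) ^ (3 / 4 : ℝ) :=
          Real.rpow_le_rpow_of_exponent_ge' (by positivity) h1 (by norm_num) (by norm_num)
      _ ≤ (b⁻¹) ^ (3 / 4 : ℝ) := by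
          refine Real.rpow_le_rpow (by positivity) ?_ (by norm_num)
          rw [← one_div, le_div_iff₀ hb0]
          exact h2
      _ = _ := by rw [Real.inv_rpow hb0.le, Real.rpow_neg hb0.le]
  refine h3.trans (le_of_eq ?_)
  rw [hb, hy, singWeight, show (n : ℝ) * (|ρ - s| / L / 2) = (2 * L)⁻¹ * (n * |ρ - s|) by
    field_simp, Real.mul_rpow (by positivity) (by positivity), Real.mul_rpow hn0.le hd.le,
    Real.inv_rpow (by positivity), ← Real.rpow_neg (by positivity), neg_neg]

/-- The two plain bounds serve domination and Lipschitz estimates for a fixed mode; the two weighted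
ones control the sum over `m`. The coefficient gains a second `freqWeight` from its extra `1/n ≤
n^(-3/4)`; the derivative has only one, which is not summable by itself. -/
theorem exists_greenCoeff_le {h : ℝ} (hh : 0 < h) {α β R : ℝ} (hα : 0 < α) (hαβ : α ≤ β) (hR : 0 < R) :
    ∃ C : ℝ, 0 ≤ C ∧ ∀ m ρ s, α ≤ ρ → ρ ≤ β → 0 < s → s < R → ρ ≠ s →
      |greenCoeff h m ρ s| * s ≤ C ∧ |greenDeriv h m ρ s| * s ≤ C ∧
      |greenCoeff h m ρ s| * s ≤ C * (freqWeight m ^ 2 * singWeight (ρ - s)) ∧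
      |greenDeriv h m ρ s| * s ≤ C * (freqWeight m * singWeight (ρ - s)) := by
  have hβ : 0 < β := hα.trans_le hαβ
  set A : ℝ := (1 + β / h) / (2 * π) * R + 1 / (2 * π) * (β + (1 / h) ^ 2 * β ^ 3 / 2) +
    1 / (2 * π) * R with hA
  set B : ℝ := (1 + (1 / h) ^ 2 * β ^ 2) / α * A with hB
  set L : ℝ := β + R with hL
  have hA0 : 0 ≤ A := by positivity
  have hB0 : 0 ≤ B := by positivity
  have hA1 : (1 + β / h) / (2 * π) * R ≤ A := by
    have : 0 ≤ 1 / (2 * π) * (β + (1 / h) ^ 2 * β ^ 3 / 2) + 1 / (2 * π) * R := by positivity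
    linarith
  have hA2 : 1 / (2 * π) * (β + (1 / h) ^ 2 * β ^ 3 / 2) ≤ A := by
    have : 0 ≤ (1 + β / h) / (2 * π) * R + 1 / (2 * π) * R := by positivity
    linarith
  have hA3 : 1 / (2 * π) * R ≤ A := by
    have : 0 ≤ (1 + β / h) / (2 * π) * R + 1 / (2 * π) * (β + (1 / h) ^ 2 * β ^ 3 / 2) := by positivity
    linarith
  set T : ℝ := (2 * L) ^ (3 / 4 : ℝ) with hT
  have hT0 : 0 ≤ T := by positivity
  have hCAB : A ≤ (A + B) * (1 + T) ∧ B ≤ (A + B) * (1 + T) ∧ A * T ≤ (A + B) * (1 + T) ∧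
      B * T ≤ (A + B) * (1 + T) := by
    have := mul_nonneg hA0 hT0
    have := mul_nonneg hB0 hT0
    refine ⟨?_, ?_, ?_, ?_⟩ <;> nlinarith
  refine ⟨(A + B) * (1 + T), by positivity, fun m ρ s hαρ hρβ hs hsR hne => ?_⟩
  have hρ : 0 < ρ := hα.trans_le hαρ
  have hmax : max ρ s ≤ L := max_le (by linarith) (by linarith)
  have hp : (1 + (1 / h) ^ 2 * ρ ^ 2) / ρ ≤ (1 + (1 / h) ^ 2 * β ^ 2) / α := by gcongr
  have hsw := singWeight_nonneg (ρ - s)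
  have hBk : ∀ x : ℝ, 0 ≤ x → (1 + (1 / h) ^ 2 * ρ ^ 2) / ρ * (A * x) ≤ B * x := by
    intro x hx
    rw [hB, mul_assoc]
    gcongr
  rcases eq_or_ne m 0 with rfl | hm
  · obtain ⟨h1, h2⟩ := abs_greenCoeff_zero_le h hρ hs hne
    have hF : |greenCoeff h 0 ρ s| * s ≤ A := h1.trans (le_trans (by gcongr) hA2)
    have hD : |greenDeriv h 0 ρ s| * s ≤ B := by
      calc _ ≤ (1 + (1 / h) ^ 2 * ρ ^ 2) / ρ * (1 / (2 * π)) * R := by gcongr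
        _ = (1 + (1 / h) ^ 2 * ρ ^ 2) / ρ * (1 / (2 * π) * R) := by ring
        _ ≤ (1 + (1 / h) ^ 2 * β ^ 2) / α * A := by gcongr
    -- Since `|ρ - s| ≤ 2 L`, the singular weight is bounded below, and the plain bounds for the
    -- zero mode can be put in weighted form.
    have h1T : 1 ≤ T * singWeight (ρ - s) := by
      have hd : 0 < |ρ - s| := abs_pos.2 (sub_ne_zero.2 hne)
      rw [singWeight, Real.rpow_neg hd.le, hT, ← div_eq_mul_inv, one_le_div (by positivity)]
      refine Real.rpow_le_rpow hd.le ?_ (by norm_num)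
      rw [abs_le]
      constructor <;> linarith
    have hw : freqWeight 0 = 1 := if_pos rfl
    rw [hw, one_pow, one_mul]
    refine ⟨hF.trans hCAB.1, hD.trans hCAB.2.1, ?_, ?_⟩
    · calc _ ≤ A * 1 := by linarith
        _ ≤ A * (T * singWeight (ρ - s)) := by gcongr
        _ = A * T * singWeight (ρ - s) := by ring
        _ ≤ _ := mul_le_mul_of_nonneg_right hCAB.2.2.1 (by positivity)
    · calc _ ≤ B * 1 := by linarith
        _ ≤ B * (T * singWeight (ρ - s)) := by gcongr
        _ = B * T * singWeight (ρ - s) := by ring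
        _ ≤ _ := mul_le_mul_of_nonneg_right hCAB.2.2.2 (by positivity)
  · have hn : m.natAbs ≠ 0 := Int.natAbs_ne_zero.2 hm
    obtain ⟨h1, h2⟩ := abs_greenCoeff_le hh hm hρ hs hne
    have hq := sqrt_min_div_max_pow_le hρ hs hne hmax hn
    have hw : freqWeight m = (m.natAbs : ℝ) ^ (-(3 / 4) : ℝ) := if_neg hm
    rw [← hw] at hq
    have hn1 : (1 : ℝ) ≤ m.natAbs := by exact_mod_cast Nat.one_le_iff_ne_zero.2 hn
    have hq0 : 0 ≤ √(min ρ s / max ρ s) := Real.sqrt_nonneg _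
    have hq1 : √(min ρ s / max ρ s) ^ m.natAbs ≤ 1 := by
      refine pow_le_one₀ hq0 (Real.sqrt_le_one.2 ?_)
      exact div_le_one_of_le₀ (min_le_max) (hρ.le.trans (le_max_left _ _))
    set Q : ℝ := √(min ρ s / max ρ s) ^ m.natAbs with hQ
    have hQ0 : 0 ≤ Q := by positivity
    have hinv : ((m.natAbs : ℝ))⁻¹ ≤ freqWeight m := by
      rw [hw, ← Real.rpow_neg_one]
      exact Real.rpow_le_rpow_of_exponent_le hn1 (by norm_num)
    have hinv1 : ((m.natAbs : ℝ))⁻¹ ≤ 1 := inv_le_one_of_one_le₀ hn1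
    have hA' : (1 + ρ / h) / (2 * π) * s ≤ A := le_trans (by gcongr) hA1
    have hF : |greenCoeff h m ρ s| * s ≤ A * ((m.natAbs : ℝ)⁻¹ * Q) := by
      calc _ ≤ (1 + ρ / h) / (2 * π) * (Q / m.natAbs) * s := by gcongr
        _ = (1 + ρ / h) / (2 * π) * s * ((m.natAbs : ℝ)⁻¹ * Q) := by ring
        _ ≤ _ := by gcongr
    have hD : |greenDeriv h m ρ s| * s ≤ B * Q := by
      calc _ ≤ (1 + (1 / h) ^ 2 * ρ ^ 2) / ρ * ((1 + ρ / h) / (2 * π) * Q) * s := by gcongr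
        _ = (1 + (1 / h) ^ 2 * ρ ^ 2) / ρ * ((1 + ρ / h) / (2 * π) * s * Q) := by ring
        _ ≤ (1 + (1 / h) ^ 2 * ρ ^ 2) / ρ * (A * Q) := by gcongr
        _ ≤ _ := hBk Q hQ0
    have hfw := freqWeight_pos m
    refine ⟨hF.trans ?_, hD.trans ?_, hF.trans ?_, hD.trans ?_⟩
    · calc _ ≤ A * (1 * 1) := by gcongr
        _ ≤ _ := by linarith [hCAB.1]
    · calc _ ≤ B * 1 := by gcongr
        _ ≤ _ := by linarith [hCAB.2.1]
    · calc _ ≤ A * (freqWeight m * (T * (freqWeight m * singWeight (ρ - s)))) := by gcongr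
        _ = A * T * (freqWeight m ^ 2 * singWeight (ρ - s)) := by ring
        _ ≤ _ := mul_le_mul_of_nonneg_right hCAB.2.2.1 (by positivity)
    · calc _ ≤ B * (T * (freqWeight m * singWeight (ρ - s))) := by gcongr
        _ = B * T * (freqWeight m * singWeight (ρ - s)) := by ring
        _ ≤ _ := mul_le_mul_of_nonneg_right hCAB.2.2.2 (by positivity)

/-- A function with derivative at most `C` in absolute value off one point is Lipschitz. -/
theorem abs_sub_le_of_abs_deriv_le_off_point {f : ℝ → ℝ} {a b c C : ℝ} (hf : ContinuousOn f (Icc a b))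
    (hd : ∀ x ∈ Icc a b, x ≠ c → DifferentiableAt ℝ f x ∧ |deriv f x| ≤ C) {x y : ℝ}
    (hx : x ∈ Icc a b) (hy : y ∈ Icc a b) : |f x - f y| ≤ C * |x - y| := by
  have aux : ∀ {x y : ℝ}, x ∈ Icc a b → y ∈ Icc a b → x < y → c ∉ Ioo x y →
      |f y - f x| ≤ C * (y - x) := by
    intro x y hx hy hxy hc
    have hsub : Icc x y ⊆ Icc a b := Icc_subset_Icc hx.1 hy.2
    obtain ⟨z, hz, hz'⟩ := exists_deriv_eq_slope f hxy (hf.mono hsub) fun w hw =>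
      (hd w (hsub (Ioo_subset_Icc_self hw)) (fun h => hc (h ▸ hw))).1.differentiableWithinAt
    have := (hd z (hsub (Ioo_subset_Icc_self hz)) (fun h => hc (h ▸ hz))).2
    rw [hz', abs_div, abs_of_pos (sub_pos.2 hxy), div_le_iff₀ (sub_pos.2 hxy)] at this
    exact this
  have main : ∀ {x y : ℝ}, x ∈ Icc a b → y ∈ Icc a b → x < y → |f y - f x| ≤ C * (y - x) := by
    intro x y hx hy hxy
    by_cases hc : c ∈ Ioo x y
    · have hcI : c ∈ Icc a b := ⟨hx.1.trans hc.1.le, hc.2.le.trans hy.2⟩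
      have h1 := aux hx hcI hc.1 (fun h => lt_irrefl _ h.2)
      have h2 := aux hcI hy hc.2 (fun h => lt_irrefl _ h.1)
      calc |f y - f x| = |(f y - f c) + (f c - f x)| := by ring_nf
        _ ≤ _ := abs_add_le _ _
        _ ≤ _ := by linarith
    · exact aux hx hy hxy hc
  rcases lt_trichotomy x y with h | h | h
  · rw [abs_sub_comm, abs_sub_comm x y, abs_of_pos (sub_pos.2 h)]
    exact main hx hy h
  · simp [h]
  · rw [abs_of_pos (sub_pos.2 h)]
    exact main hy hx h

theorem abs_greenCoeff_sub_le {h : ℝ} (hh : 0 < h) (m : ℤ) {α β s C : ℝ} (hα : 0 < α) (hs : 0 < s)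
    (hC : ∀ ρ, α ≤ ρ → ρ ≤ β → ρ ≠ s → |greenDeriv h m ρ s| * s ≤ C) {x y : ℝ}
    (hx : x ∈ Icc α β) (hy : y ∈ Icc α β) :
    |greenCoeff h m x s - greenCoeff h m y s| * s ≤ C * |x - y| := by
  have := abs_sub_le_of_abs_deriv_le_off_point (C := C / s) (c := s)
    ((continuousOn_greenCoeff hh m hs).mono fun r hr => hα.trans_le hr.1)
    (fun r hr hne => ⟨(hasDerivAt_greenCoeff hh m (hα.trans_le hr.1) hs hne).differentiableAt,
      (le_div_iff₀ hs).2 (hC r hr.1 hr.2 hne)⟩) hx hy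
  calc _ ≤ C / s * |x - y| * s := by gcongr
    _ = _ := by field_simp

/-! ### The radial modes -/

/-- `∫ G_m(ρ, s) a(s) s ds` over `(0, R)`. -/
def radialMode (h R : ℝ) (a : ℝ → ℂ) (m : ℤ) (ρ : ℝ) : ℂ :=
  ∫ s in Ioo 0 R, (greenCoeff h m ρ s * s) • a s

/-- `∫ ∂_ρ G_m(ρ, s) a(s) s ds` over `(0, R)`. -/
def radialModeDeriv (h R : ℝ) (a : ℝ → ℂ) (m : ℤ) (ρ : ℝ) : ℂ :=
  ∫ s in Ioo 0 R, (greenDeriv h m ρ s * s) • a s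

theorem ae_mem_Ioo_and_ne (R ρ : ℝ) :
    ∀ᵐ s ∂(volume.restrict (Ioo 0 R)), s ∈ Ioo 0 R ∧ ρ ≠ s := by
  have hne : ∀ᵐ s ∂(volume.restrict (Ioo 0 R)), s ≠ ρ := Measure.ae_ne _ ρ
  filter_upwards [hne, ae_restrict_mem measurableSet_Ioo] with s h1 h2 using ⟨h2, h1.symm⟩

theorem aestronglyMeasurable_greenCoeff {h : ℝ} (hh : 0 < h) (m : ℤ) (R : ℝ) {ρ : ℝ} (hρ : 0 < ρ) :
    AEStronglyMeasurable (fun s => greenCoeff h m ρ s) (volume.restrict (Ioo 0 R)) := by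
  obtain ⟨G, hG, hG'⟩ := exists_measurable_greenCoeff hh m
  refine (hG.comp (measurable_const.prodMk measurable_id : Measurable fun s : ℝ => (ρ, s))
    ).aestronglyMeasurable.congr ?_
  filter_upwards [ae_restrict_mem measurableSet_Ioo] with s hs using hG' ρ s hρ hs.1

theorem aestronglyMeasurable_greenDeriv {h : ℝ} (hh : 0 < h) (m : ℤ) (R : ℝ) {ρ : ℝ} (hρ : 0 < ρ) :
    AEStronglyMeasurable (fun s => greenDeriv h m ρ s) (volume.restrict (Ioo 0 R)) := by
  obtain ⟨G, hG, hG'⟩ := exists_measurable_greenDeriv hh m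
  refine (hG.comp (measurable_const.prodMk measurable_id : Measurable fun s : ℝ => (ρ, s))
    ).aestronglyMeasurable.congr ?_
  filter_upwards [ae_mem_Ioo_and_ne R ρ] with s hs using hG' ρ s hρ hs.1.1 hs.2

section

variable {h R A : ℝ} {a : ℝ → ℂ}

theorem integrableOn_greenCoeff_smul (hh : 0 < h) (hR : 0 < R) (ha : Measurable a)
    (hA : ∀ s, ‖a s‖ ≤ A) (m : ℤ) {ρ : ℝ} (hρ : 0 < ρ) :
    IntegrableOn (fun s => (greenCoeff h m ρ s * s) • a s) (Ioo 0 R) := by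
  obtain ⟨C, hC0, hC⟩ := exists_greenCoeff_le hh hρ le_rfl hR
  refine Integrable.of_bound (((aestronglyMeasurable_greenCoeff hh m R hρ).mul
    measurable_id.aestronglyMeasurable).smul ha.aestronglyMeasurable) (C * A) ?_
  filter_upwards [ae_mem_Ioo_and_ne R ρ] with s hs
  obtain ⟨⟨hs0, hsR⟩, hne⟩ := hs
  rw [norm_smul, norm_mul, Real.norm_eq_abs, Real.norm_of_nonneg hs0.le]
  exact mul_le_mul (hC m ρ s le_rfl le_rfl hs0 hsR hne).1 (hA s) (norm_nonneg _) hC0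

theorem integrableOn_greenDeriv_smul (hh : 0 < h) (hR : 0 < R) (ha : Measurable a)
    (hA : ∀ s, ‖a s‖ ≤ A) (m : ℤ) {ρ : ℝ} (hρ : 0 < ρ) :
    IntegrableOn (fun s => (greenDeriv h m ρ s * s) • a s) (Ioo 0 R) := by
  obtain ⟨C, hC0, hC⟩ := exists_greenCoeff_le hh hρ le_rfl hR
  refine Integrable.of_bound (((aestronglyMeasurable_greenDeriv hh m R hρ).mul
    measurable_id.aestronglyMeasurable).smul ha.aestronglyMeasurable) (C * A) ?_
  filter_upwards [ae_mem_Ioo_and_ne R ρ] with s hs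
  obtain ⟨⟨hs0, hsR⟩, hne⟩ := hs
  rw [norm_smul, norm_mul, Real.norm_eq_abs, Real.norm_of_nonneg hs0.le]
  exact mul_le_mul (hC m ρ s le_rfl le_rfl hs0 hsR hne).2.1 (hA s) (norm_nonneg _) hC0

/-- The kernel has a kink at `ρ = s`, so for fixed `s` it is not differentiable throughout a
neighbourhood. It is Lipschitz in `ρ` with a uniform constant after weighting by `s`, and
differentiable at the given `ρ` for almost every `s`, which is enough to differentiate under the
integral. -/
theorem hasDerivAt_radialMode (hh : 0 < h) (hR : 0 < R) (ha : Measurable a)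
    (hA : ∀ s, ‖a s‖ ≤ A) (m : ℤ) {ρ : ℝ} (hρ : 0 < ρ) :
    HasDerivAt (radialMode h R a m) (radialModeDeriv h R a m ρ) ρ := by
  obtain ⟨C, hC0, hC⟩ := exists_greenCoeff_le hh (half_pos hρ)
    (by linarith : ρ / 2 ≤ 2 * ρ) hR
  have hA0 : 0 ≤ A := (norm_nonneg _).trans (hA 0)
  refine (hasDerivAt_integral_of_dominated_loc_of_lip (μ := volume.restrict (Ioo 0 R)) (𝕜 := ℝ)
    (F := fun ρ s => (greenCoeff h m ρ s * s) • a s) (bound := fun _ => C * A)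
    (F' := fun s => (greenDeriv h m ρ s * s) • a s)
    (s := Icc (ρ / 2) (2 * ρ)) (Icc_mem_nhds (by linarith) (by linarith)) ?_
    (integrableOn_greenCoeff_smul hh hR ha hA m hρ)
    (integrableOn_greenDeriv_smul hh hR ha hA m hρ).aestronglyMeasurable ?_
    (integrable_const _) ?_).2
  · filter_upwards [Ioi_mem_nhds hρ] with r hr
    exact (integrableOn_greenCoeff_smul hh hR ha hA m hr).aestronglyMeasurable
  · filter_upwards [ae_restrict_mem measurableSet_Ioo] with s hs
    refine LipschitzOnWith.of_dist_le_mul fun x hx y hy => ?_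
    have := abs_greenCoeff_sub_le hh m (s := s) (half_pos hρ) hs.1
      (fun r h1 h2 h3 => (hC m r s h1 h2 hs.1 hs.2 h3).2.1) hx hy
    rw [dist_eq_norm, ← sub_smul, ← sub_mul, norm_smul, norm_mul, Real.norm_eq_abs,
      Real.norm_of_nonneg hs.1.le, Real.coe_nnabs, abs_of_nonneg (mul_nonneg hC0 hA0), Real.dist_eq]
    calc _ ≤ C * |x - y| * A := mul_le_mul this (hA s) (norm_nonneg _) (by positivity)
      _ = _ := by ring
  · filter_upwards [ae_mem_Ioo_and_ne R ρ] with s hs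
    exact ((hasDerivAt_greenCoeff hh m hρ hs.1.1 hs.2).mul_const s).smul_const (a s)

theorem exists_integral_norm_greenCoeff_le (hh : 0 < h) (hR : 0 < R) {α β : ℝ} (hα : 0 < α)
    (hαβ : α ≤ β) (hA0 : 0 ≤ A) : ∃ K : ℝ, 0 ≤ K ∧ ∀ (a : ℝ → ℂ), Measurable a → (∀ s, ‖a s‖ ≤ A) →
      ∀ m ρ, α ≤ ρ → ρ ≤ β →
      ∫ s in Ioo 0 R, ‖(greenCoeff h m ρ s * s) • a s‖ ≤ K * freqWeight m ^ 2 := by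
  obtain ⟨C, hC0, hC⟩ := exists_greenCoeff_le hh hα hαβ hR
  obtain ⟨J, hJ0, hJ⟩ := exists_integral_singWeight_le β R hR
  refine ⟨C * J * A, by positivity, fun a ha hA m ρ h1 h2 => ?_⟩
  have hρ : 0 < ρ := hα.trans_le h1
  calc _ ≤ ∫ s in Ioo 0 R, C * freqWeight m ^ 2 * A * singWeight (ρ - s) := by
        refine integral_mono_ae (integrableOn_greenCoeff_smul hh hR ha hA m hρ).norm
          ((hJ ρ hρ h2).1.const_mul _) ?_
        filter_upwards [ae_mem_Ioo_and_ne R ρ] with s hs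
        obtain ⟨⟨hs0, hsR⟩, hne⟩ := hs
        rw [norm_smul, norm_mul, Real.norm_eq_abs, Real.norm_of_nonneg hs0.le]
        have := (hC m ρ s h1 h2 hs0 hsR hne).2.2.1
        have hw := singWeight_nonneg (ρ - s)
        calc _ ≤ C * (freqWeight m ^ 2 * singWeight (ρ - s)) * A :=
              mul_le_mul this (hA s) (norm_nonneg _) (by positivity)
          _ = _ := by ring
    _ = C * freqWeight m ^ 2 * A * ∫ s in Ioo 0 R, singWeight (ρ - s) := integral_const_mul _ _
    _ ≤ C * freqWeight m ^ 2 * A * J := by gcongr; exact (hJ ρ hρ h2).2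
    _ = _ := by ring

theorem exists_norm_radialMode_le (hh : 0 < h) (hR : 0 < R) {α β : ℝ} (hα : 0 < α)
    (hαβ : α ≤ β) (hA0 : 0 ≤ A) : ∃ K : ℝ, 0 ≤ K ∧ ∀ (a : ℝ → ℂ), Measurable a → (∀ s, ‖a s‖ ≤ A) →
      ∀ m ρ, α ≤ ρ → ρ ≤ β → ‖radialMode h R a m ρ‖ ≤ K * freqWeight m ^ 2 := by
  obtain ⟨K, hK0, hK⟩ := exists_integral_norm_greenCoeff_le hh hR hα hαβ hA0
  exact ⟨K, hK0, fun a ha hA m ρ h1 h2 =>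
    (norm_integral_le_integral_norm _).trans (hK a ha hA m ρ h1 h2)⟩

/-- Cauchy–Schwarz in `m` is applied under the integral, pointwise in `s`, pairing the
square-summable `freqWeight` with the square-summable data. Keeping the partial sum of the weights
under the root makes the tails uniformly small. -/
theorem exists_sum_norm_radialModeDeriv_le (hh : 0 < h) (hR : 0 < R) {α β : ℝ} (hα : 0 < α)
    (hαβ : α ≤ β) {a : ℤ → ℝ → ℂ} (ha : ∀ m, Measurable (a m)) (hA : ∀ m s, ‖a m s‖ ≤ A) {B : ℝ}
    (hB0 : 0 ≤ B) (hB : ∀ (F : Finset ℤ) s, ∑ m ∈ F, ‖a m s‖ ^ 2 ≤ B ^ 2) :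
    ∃ K : ℝ, 0 ≤ K ∧ ∀ (F : Finset ℤ) ρ, α ≤ ρ → ρ ≤ β →
      ∑ m ∈ F, ‖radialModeDeriv h R (a m) m ρ‖ ≤ K * √(∑ m ∈ F, freqWeight m ^ 2) := by
  obtain ⟨C, hC0, hC⟩ := exists_greenCoeff_le hh hα hαβ hR
  obtain ⟨J, hJ0, hJ⟩ := exists_integral_singWeight_le β R hR
  refine ⟨C * J * B, by positivity, fun F ρ h1 h2 => ?_⟩
  have hρ : 0 < ρ := hα.trans_le h1
  have hint := fun m => integrableOn_greenDeriv_smul hh hR (ha m) (hA m) m hρ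
  calc _ ≤ ∑ m ∈ F, ∫ s in Ioo 0 R, ‖(greenDeriv h m ρ s * s) • a m s‖ :=
        Finset.sum_le_sum fun m _ => norm_integral_le_integral_norm _
    _ = ∫ s in Ioo 0 R, ∑ m ∈ F, ‖(greenDeriv h m ρ s * s) • a m s‖ :=
        (integral_finsetSum _ fun m _ => (hint m).norm).symm
    _ ≤ ∫ s in Ioo 0 R, C * B * √(∑ m ∈ F, freqWeight m ^ 2) * singWeight (ρ - s) := by
        refine integral_mono_ae (integrable_finsetSum _ fun m _ => (hint m).norm)
          ((hJ ρ hρ h2).1.const_mul _) ?_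
        filter_upwards [ae_mem_Ioo_and_ne R ρ] with s hs
        obtain ⟨⟨hs0, hsR⟩, hne⟩ := hs
        have hw := singWeight_nonneg (ρ - s)
        calc _ ≤ ∑ m ∈ F, C * singWeight (ρ - s) * (freqWeight m * ‖a m s‖) := by
              refine Finset.sum_le_sum fun m _ => ?_
              rw [norm_smul, norm_mul, Real.norm_eq_abs, Real.norm_of_nonneg hs0.le]
              have := (hC m ρ s h1 h2 hs0 hsR hne).2.2.2
              calc _ ≤ C * (freqWeight m * singWeight (ρ - s)) * ‖a m s‖ := by gcongr
                _ = _ := by ring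
          _ = C * singWeight (ρ - s) * ∑ m ∈ F, freqWeight m * ‖a m s‖ := by rw [Finset.mul_sum]
          _ ≤ C * singWeight (ρ - s) * (√(∑ m ∈ F, freqWeight m ^ 2) * √(∑ m ∈ F, ‖a m s‖ ^ 2)) := by
              gcongr
              exact Real.sum_mul_le_sqrt_mul_sqrt _ _ _
          _ ≤ C * singWeight (ρ - s) * (√(∑ m ∈ F, freqWeight m ^ 2) * B) := by
              gcongr
              exact Real.sqrt_le_iff.2 ⟨hB0, hB F s⟩
          _ = _ := by ring
    _ = C * B * √(∑ m ∈ F, freqWeight m ^ 2) * ∫ s in Ioo 0 R, singWeight (ρ - s) :=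
        integral_const_mul _ _
    _ ≤ C * B * √(∑ m ∈ F, freqWeight m ^ 2) * J := by gcongr; exact (hJ ρ hρ h2).2
    _ = _ := by ring

theorem radialMode_integral_weak (hh : 0 < h) (hR : 0 < R) (ha : Measurable a)
    (hA : ∀ s, ‖a s‖ ≤ A) (m : ℤ) {η η' : ℝ → ℂ} (hη : ∀ x, HasDerivAt η (η' x) x)
    (hη' : Continuous η') {α β : ℝ} (hα : 0 < α) (hαβ : α ≤ β)
    (hsupp : ∀ x, η x ≠ 0 → α ≤ x ∧ x ≤ β) :
    ∫ ρ in Ioi (0 : ℝ), ((ρ / (1 + (1 / h) ^ 2 * ρ ^ 2)) • (radialModeDeriv h R a m ρ * η' ρ) +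
      ((m : ℝ) ^ 2 / ρ) • (radialMode h R a m ρ * η ρ)) =
    -(1 / (2 * π)) • ∫ s in Ioo 0 R, s • (a s * η s) := by
  have hη0 : ∀ x, x ∉ Icc α β → η x = 0 := fun x hx => by
    by_contra h
    exact hx (hsupp x h)
  have hη'0 : ∀ x, x ∉ Icc α β → η' x = 0 := fun x hx => by
    have : η =ᶠ[𝓝 x] fun _ => 0 := by
      filter_upwards [isClosed_Icc.isOpen_compl.mem_nhds hx] with y hy using hη0 y hy
    exact ((hη x).congr_of_eventuallyEq this.symm).unique (hasDerivAt_const x 0)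
  have hηc : Continuous η := continuous_iff_continuousAt.2 fun x => (hη x).continuousAt
  set p : ℝ → ℝ := fun ρ => ρ / (1 + (1 / h) ^ 2 * ρ ^ 2) with hp
  set Θ : ℝ → ℝ → ℂ := fun ρ s => ((p ρ * greenDeriv h m ρ s) • η' ρ +
    ((m : ℝ) ^ 2 / ρ * greenCoeff h m ρ s) • η ρ) * (s • a s) with hΘ
  have hL : ∀ ρ ∈ Ioi (0 : ℝ), p ρ • (radialModeDeriv h R a m ρ * η' ρ) +
      ((m : ℝ) ^ 2 / ρ) • (radialMode h R a m ρ * η ρ) = ∫ s in Ioo 0 R, Θ ρ s := by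
    intro ρ hρ
    rw [radialModeDeriv, radialMode, ← integral_mul_const, ← integral_mul_const, ← integral_smul,
      ← integral_smul, ← integral_add]
    · refine integral_congr_ae (Eventually.of_forall fun s => ?_)
      simp only [hΘ, Complex.real_smul]
      push_cast
      ring
    · exact ((integrableOn_greenDeriv_smul hh hR ha hA m hρ).mul_const _).smul (p ρ)
    · exact ((integrableOn_greenCoeff_smul hh hR ha hA m hρ).mul_const _).smul ((m : ℝ) ^ 2 / ρ)
  have hint : Integrable (Function.uncurry Θ)
      ((volume.restrict (Ioi 0)).prod (volume.restrict (Ioo 0 R))) := by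
    obtain ⟨C, hC0, hC⟩ := exists_greenCoeff_le hh hα hαβ hR
    obtain ⟨E₁, hE₁⟩ := isCompact_Icc.exists_bound_of_continuousOn (s := Icc α β) hηc.continuousOn
    obtain ⟨E₂, hE₂⟩ := isCompact_Icc.exists_bound_of_continuousOn (s := Icc α β) hη'.continuousOn
    have hE₁0 : 0 ≤ E₁ := (norm_nonneg _).trans (hE₁ α ⟨le_rfl, hαβ⟩)
    have hE₂0 : 0 ≤ E₂ := (norm_nonneg _).trans (hE₂ α ⟨le_rfl, hαβ⟩)
    have hA0 : 0 ≤ A := (norm_nonneg _).trans (hA 0)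
    have hβ : 0 < β := hα.trans_le hαβ
    obtain ⟨G, hG, hG'⟩ := exists_measurable_greenCoeff hh m
    obtain ⟨D, hD, hD'⟩ := exists_measurable_greenDeriv hh m
    -- The measurable representative of the derivative and the kernel bounds are available only off
    -- the diagonal, which is a null set.
    have hdiag : ∀ᵐ z ∂((volume.restrict (Ioi (0 : ℝ))).prod (volume.restrict (Ioo 0 R))),
        z.1 ∈ Ioi (0 : ℝ) ∧ z.2 ∈ Ioo 0 R ∧ z.1 ≠ z.2 := by
      have hd : ∀ᵐ z ∂((volume.restrict (Ioi (0 : ℝ))).prod (volume.restrict (Ioo 0 R))),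
          z ∈ {z : ℝ × ℝ | z.1 = z.2}ᶜ := by
        rw [Measure.ae_prod_mem_iff_ae_ae_mem
          (measurableSet_eq_fun measurable_fst measurable_snd).compl]
        refine Eventually.of_forall fun x => ?_
        filter_upwards [ae_mem_Ioo_and_ne R x] with s hs using hs.2
      have h1 := (Measure.quasiMeasurePreserving_fst (μ := volume.restrict (Ioi (0 : ℝ)))
        (ν := volume.restrict (Ioo 0 R))).ae (ae_restrict_mem measurableSet_Ioi)
      have h2 := (Measure.quasiMeasurePreserving_snd (μ := volume.restrict (Ioi (0 : ℝ)))
        (ν := volume.restrict (Ioo 0 R))).ae (ae_restrict_mem measurableSet_Ioo)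
      filter_upwards [hd, h1, h2] with z hz hz1 hz2 using ⟨hz1, hz2, hz⟩
    have hbound : Integrable (fun z : ℝ × ℝ => (Icc α β).indicator
        (fun _ => (C * (β * E₂) + C * ((m : ℝ) ^ 2 / α * E₁)) * A) z.1)
        ((volume.restrict (Ioi 0)).prod (volume.restrict (Ioo 0 R))) := by
      refine Integrable.comp_fst (f := (Icc α β).indicator
        (fun _ => (C * (β * E₂) + C * ((m : ℝ) ^ 2 / α * E₁)) * A)) ?_ _
      refine IntegrableOn.integrable_indicator ?_ measurableSet_Icc
      exact integrableOn_const (by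
        rw [Measure.restrict_apply measurableSet_Icc]
        exact ((measure_mono inter_subset_left).trans_lt isCompact_Icc.measure_lt_top).ne) enorm_ne_top
    refine hbound.mono' ?_ ?_
    · have : Measurable (fun z : ℝ × ℝ => ((p z.1 * D z) • η' z.1 +
          ((m : ℝ) ^ 2 / z.1 * G z) • η z.1) * (z.2 • a z.2)) := by
        have := hηc.measurable
        have := hη'.measurable
        fun_prop
      refine this.aestronglyMeasurable.congr ?_
      filter_upwards [hdiag] with z hz
      obtain ⟨h1, h2, h3⟩ := hz
      simp only [Function.uncurry, hΘ]
      rw [← hD' z.1 z.2 h1 h2.1 h3, ← hG' z.1 z.2 h1 h2.1]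
    · filter_upwards [hdiag] with z hz
      obtain ⟨h1, ⟨h2, h2'⟩, h3⟩ := hz
      by_cases hz1 : z.1 ∈ Icc α β
      · rw [indicator_of_mem hz1]
        obtain ⟨c1, c2, -, -⟩ := hC m z.1 z.2 hz1.1 hz1.2 h2 h2' h3
        have h1' : 0 < z.1 := h1
        have hp1 : |p z.1| ≤ β := by
          have : 0 ≤ (1 / h) ^ 2 * z.1 ^ 2 := by positivity
          rw [hp, abs_of_nonneg (by positivity)]
          exact (div_le_self h1'.le (by linarith)).trans hz1.2
        have hm1 : (m : ℝ) ^ 2 / z.1 ≤ (m : ℝ) ^ 2 / α := by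
          have := hz1.1
          gcongr
        have e : Function.uncurry Θ z = ((greenDeriv h m z.1 z.2 * z.2) • (p z.1 • η' z.1) +
            (greenCoeff h m z.1 z.2 * z.2) • (((m : ℝ) ^ 2 / z.1) • η z.1)) * a z.2 := by
          simp only [Function.uncurry, hΘ, Complex.real_smul]
          push_cast
          ring
        rw [e, norm_mul]
        refine mul_le_mul ((norm_add_le _ _).trans (add_le_add ?_ ?_)) (hA _) (norm_nonneg _)
          (by positivity)
        · rw [norm_smul, norm_smul, norm_mul, Real.norm_eq_abs, Real.norm_of_nonneg h2.le, Real.norm_eq_abs]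
          exact mul_le_mul c2 (mul_le_mul hp1 (hE₂ _ hz1) (norm_nonneg _) hβ.le) (by positivity) hC0
        · rw [norm_smul, norm_smul, norm_mul, Real.norm_eq_abs, Real.norm_of_nonneg h2.le,
            Real.norm_of_nonneg (r := (m : ℝ) ^ 2 / z.1) (by positivity)]
          exact mul_le_mul c1 (mul_le_mul hm1 (hE₁ _ hz1) (norm_nonneg _) (by positivity))
            (by positivity) hC0
      · rw [indicator_of_notMem hz1]
        simp [Function.uncurry, hΘ, hη0 _ hz1, hη'0 _ hz1]
  rw [setIntegral_congr_fun measurableSet_Ioi hL, integral_integral_swap hint, ← integral_smul]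
  refine setIntegral_congr_fun measurableSet_Ioo fun s hs => ?_
  simp only [hΘ]
  rw [integral_mul_const, (greenCoeff_integral_weak hh m hs.1 hη hη' hα hsupp).2]
  simp only [Complex.real_smul]
  ring

end

/-! ### Series of modes -/

/-- The angular mode `e^{imφ}`. -/
def angularMode (m : ℤ) (φ : ℝ) : ℂ := Complex.exp (Complex.I * m * φ)

theorem norm_angularMode (m : ℤ) (φ : ℝ) : ‖angularMode m φ‖ = 1 := by
  rw [angularMode, show Complex.I * m * φ = ((m * φ : ℝ) : ℂ) * Complex.I by push_cast; ring,
    Complex.norm_exp_ofReal_mul_I]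

@[fun_prop]
theorem continuous_angularMode (m : ℤ) : Continuous (angularMode m) := by
  unfold angularMode
  fun_prop

theorem hasDerivAt_angularMode (m : ℤ) (φ : ℝ) :
    HasDerivAt (angularMode m) (Complex.I * m * angularMode m φ) φ := by
  have h1 : HasDerivAt (fun φ : ℝ => Complex.I * m * (φ : ℂ)) (Complex.I * m * 1) φ :=
    (Complex.ofRealCLM.hasDerivAt (x := φ)).const_mul _
  convert! h1.cexp using 1
  rw [angularMode]
  ring

theorem angularMode_two_pi (m : ℤ) : angularMode m (2 * π) = 1 := by
  rw [angularMode, Complex.exp_eq_one_iff]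
  exact ⟨m, by push_cast; ring⟩

theorem angularMode_zero_right (m : ℤ) : angularMode m 0 = 1 := by
  simp [angularMode]

theorem greenTerm_eq (h ρ φ ρ₀ φ₀ : ℝ) (m : ℤ) : greenTerm h ρ φ ρ₀ φ₀ m =
    greenCoeff h m ρ ρ₀ * (angularMode m φ * angularMode (-m) φ₀) := by
  rw [greenTerm, angularMode, angularMode, ← Complex.exp_add]
  congr 2
  push_cast
  ring

/-- The hypothesis holds for every finite set, so applied to `F' \ F` it bounds the tail by `K`
times the root of the tail of `∑ w`, uniformly in `x`. It replaces the Weierstrass test for the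
derivative series, for which no summable majorant of the single terms is at hand. -/
theorem tendstoUniformlyOn_tsum_of_sum_norm_le {ι X : Type*} {w : ι → ℝ} (hw : Summable w)
    (hw0 : ∀ i, 0 ≤ w i) {f : ι → X → ℂ} {S : Set X} {K : ℝ} (hK : 0 ≤ K)
    (hf : ∀ (F : Finset ι), ∀ x ∈ S, ∑ i ∈ F, ‖f i x‖ ≤ K * √(∑ i ∈ F, w i)) :
    (∀ x ∈ S, Summable fun i => f i x) ∧
    TendstoUniformlyOn (fun (F : Finset ι) x => ∑ i ∈ F, f i x) (fun x => ∑' i, f i x) atTop S := by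
  classical
  have hs : ∀ x ∈ S, Summable fun i => f i x := by
    intro x hx
    refine Summable.of_norm (summable_of_sum_le (c := K * √(∑' i, w i)) (fun i => norm_nonneg _)
      fun F => (hf F x hx).trans ?_)
    gcongr
    exact hw.sum_le_tsum F fun i _ => hw0 i
  refine ⟨hs, Metric.tendstoUniformlyOn_iff.2 fun ε hε => ?_⟩
  have ht : Tendsto (fun F : Finset ι => K * √(∑' i, w i - ∑ i ∈ F, w i)) atTop (𝓝 0) := by
    have h1 : Tendsto (fun F : Finset ι => ∑' i, w i - ∑ i ∈ F, w i) atTop (𝓝 0) := by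
      simpa using tendsto_const_nhds (x := ∑' i, w i).sub hw.hasSum
    simpa using ((Real.continuous_sqrt.tendsto 0).comp h1).const_mul K
  filter_upwards [ht.eventually (gt_mem_nhds hε)] with F hF x hx
  refine lt_of_le_of_lt ?_ hF
  rw [dist_eq_norm]
  refine le_of_tendsto ((hs x hx).hasSum.sub_const (∑ i ∈ F, f i x)).norm ?_
  filter_upwards [eventually_ge_atTop F] with F' hF'
  rw [← Finset.sum_sdiff hF', add_sub_cancel_right]
  refine (norm_sum_le _ _).trans ((hf _ x hx).trans ?_)
  gcongr
  rw [le_sub_iff_add_le, Finset.sum_sdiff hF']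
  exact hw.sum_le_tsum F' fun i _ => hw0 i

section

variable {h R A B : ℝ} {a : ℤ → ℝ → ℂ}

theorem hasDerivAt_tsum_radialMode (hh : 0 < h) (hR : 0 < R) (ha : ∀ m, Measurable (a m))
    (hA : ∀ m s, ‖a m s‖ ≤ A) (hB0 : 0 ≤ B)
    (hB : ∀ (F : Finset ℤ) s, ∑ m ∈ F, ‖a m s‖ ^ 2 ≤ B ^ 2) {ρ : ℝ} (hρ : 0 < ρ) (φ : ℝ) :
    HasDerivAt (fun r => ∑' m, radialMode h R (a m) m r * angularMode m φ)
      (∑' m, radialModeDeriv h R (a m) m ρ * angularMode m φ) ρ := by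
  have hA0 : 0 ≤ A := (norm_nonneg _).trans (hA 0 0)
  have hαβ : ρ / 2 ≤ 2 * ρ := by linarith
  obtain ⟨K, hK0, hK⟩ := exists_sum_norm_radialModeDeriv_le hh hR (half_pos hρ) hαβ ha hA hB0 hB
  obtain ⟨K', hK'0, hK'⟩ := exists_norm_radialMode_le hh hR (half_pos hρ) hαβ hA0
  have hu := tendstoUniformlyOn_tsum_of_sum_norm_le summable_freqWeight_sq (fun m => sq_nonneg _)
    (f := fun m r => radialModeDeriv h R (a m) m r * angularMode m φ) (S := Ioo (ρ / 2) (2 * ρ)) hK0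
    (fun F r hr => by
      simp only [norm_mul, norm_angularMode, mul_one]
      exact hK F r hr.1.le hr.2.le)
  refine hasDerivAt_of_tendstoUniformlyOn isOpen_Ioo hu.2
    (f := fun F r => ∑ m ∈ F, radialMode h R (a m) m r * angularMode m φ)
    (Eventually.of_forall fun F r hr => ?_) (fun r hr => ?_) ⟨by linarith, by linarith⟩
  · exact HasDerivAt.fun_sum fun m _ =>
      (hasDerivAt_radialMode hh hR (ha m) (hA m) m ((half_pos hρ).trans hr.1)).mul_const _
  · refine (Summable.of_norm_bounded (summable_freqWeight_sq.mul_left K') fun m => ?_).hasSum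
    rw [norm_mul, norm_angularMode, mul_one]
    exact hK' (a m) (ha m) (hA m) m r hr.1.le hr.2.le

end

/-! ### Angular Fourier coefficients -/

/-- `∫ e^{-imt} f(s, t) dt` over `(0, 2π)`. -/
def angularCoeff (f : ℝ × ℝ → ℂ) (m : ℤ) (s : ℝ) : ℂ :=
  ∫ t in Ioo 0 (2 * π), angularMode (-m) t * f (s, t)

theorem measurable_angularCoeff {f : ℝ × ℝ → ℂ} (hf : Measurable f) (m : ℤ) :
    Measurable (angularCoeff f m) := by
  have : Measurable (Function.uncurry fun s t : ℝ => angularMode (-m) t * f (s, t)) := by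
    have := (continuous_angularMode (-m)).measurable
    exact (this.comp measurable_snd).mul hf
  exact (this.stronglyMeasurable.integral_prod_right).measurable

theorem norm_angularCoeff_le {f : ℝ × ℝ → ℂ} {M : ℝ} (hM : ∀ q, ‖f q‖ ≤ M) (m : ℤ) (s : ℝ) :
    ‖angularCoeff f m s‖ ≤ 2 * π * M := by
  have := norm_setIntegral_le_of_norm_le_const (μ := volume) (s := Ioo 0 (2 * π)) (C := M)
    (f := fun t => angularMode (-m) t * f (s, t)) measure_Ioo_lt_top (fun t _ => by
      rw [norm_mul, norm_angularMode, one_mul]; exact hM _)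
  rw [Real.volume_real_Ioo_of_le (by positivity), sub_zero] at this
  rw [angularCoeff]
  linarith

theorem fourierCoeffOn_eq_angularIntegral (g : ℝ → ℂ) (m : ℤ) :
    fourierCoeffOn Real.two_pi_pos g m =
      (1 / (2 * π)) • ∫ t in Ioo 0 (2 * π), angularMode (-m) t * g t := by
  rw [fourierCoeffOn_eq_integral, sub_zero, intervalIntegral.integral_of_le Real.two_pi_pos.le,
    integral_Ioc_eq_integral_Ioo]
  congr 2
  funext t
  rw [fourier_coe_apply, smul_eq_mul, angularMode]
  congr 2
  have : (π : ℂ) ≠ 0 := by exact_mod_cast Real.pi_ne_zero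
  push_cast
  field_simp

/-- This is Bessel's inequality on each circle `ρ = s`; it holds for every `s` because `f` is
bounded everywhere, not merely almost everywhere. -/
theorem sum_sq_norm_angularCoeff_le {f : ℝ × ℝ → ℂ} (hf : Measurable f) {M : ℝ}
    (hM : ∀ q, ‖f q‖ ≤ M) (F : Finset ℤ) (s : ℝ) :
    ∑ m ∈ F, ‖angularCoeff f m s‖ ^ 2 ≤ (2 * π * M) ^ 2 := by
  have hmeas : Measurable fun t => f (s, t) := hf.comp (by fun_prop)
  have hL2 : MemLp (fun t => f (s, t)) 2 (volume.restrict (Ioc 0 (2 * π))) :=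
    MemLp.of_bound hmeas.aestronglyMeasurable M (Eventually.of_forall fun t => hM _)
  have hsum := hasSum_sq_fourierCoeffOn Real.two_pi_pos hL2
  have h1 := sum_le_hasSum F (fun i _ => sq_nonneg _) hsum
  have h2 : ∫ x in (0 : ℝ)..2 * π, ‖f (s, x)‖ ^ 2 ≤ 2 * π * M ^ 2 := by
    have : ∫ x in (0 : ℝ)..2 * π, M ^ 2 = 2 * π * M ^ 2 := by simp
    rw [← this]
    refine intervalIntegral.integral_mono_on Real.two_pi_pos.le ?_ (by simp) fun t _ => ?_
    · rw [intervalIntegrable_iff_integrableOn_Ioc_of_le Real.two_pi_pos.le]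
      exact Integrable.of_bound (hmeas.norm.pow_const 2).aestronglyMeasurable (M ^ 2) (Eventually.of_forall fun t => by
        rw [Real.norm_of_nonneg (sq_nonneg _)]
        exact pow_le_pow_left₀ (norm_nonneg _) (hM _) 2)
    · exact pow_le_pow_left₀ (norm_nonneg _) (hM _) 2
  have h3 : ∀ m, angularCoeff f m s = (2 * π) • fourierCoeffOn Real.two_pi_pos (fun t => f (s, t)) m := by
    intro m
    rw [fourierCoeffOn_eq_angularIntegral, smul_smul, mul_one_div_cancel Real.two_pi_pos.ne', one_smul,
      angularCoeff]
  calc _ = (2 * π) ^ 2 * ∑ m ∈ F, ‖fourierCoeffOn Real.two_pi_pos (fun t => f (s, t)) m‖ ^ 2 := by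
        rw [Finset.mul_sum]
        refine Finset.sum_congr rfl fun m _ => ?_
        rw [h3, norm_smul, Real.norm_of_nonneg Real.two_pi_pos.le, mul_pow]
    _ ≤ (2 * π) ^ 2 * ((2 * π - 0)⁻¹ • ∫ x in (0 : ℝ)..2 * π, ‖f (s, x)‖ ^ 2) := by gcongr
    _ ≤ (2 * π) ^ 2 * ((2 * π - 0)⁻¹ • (2 * π * M ^ 2)) := by
        rw [smul_eq_mul, smul_eq_mul, sub_zero]; gcongr
    _ = _ := by
        rw [smul_eq_mul, sub_zero]
        field_simp

/-! ### The Green operator as a series of modes -/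

theorem summable_greenTerm {h : ℝ} (hh : 0 < h) {ρ ρ₀ : ℝ} (φ φ₀ : ℝ) (hρ : 0 < ρ) (hρ₀ : 0 < ρ₀)
    (hne : ρ ≠ ρ₀) : Summable (greenTerm h ρ φ ρ₀ φ₀) := by
  obtain ⟨C, hC0, hC⟩ := exists_greenCoeff_le hh hρ le_rfl (show 0 < ρ₀ + 1 by linarith)
  refine Summable.of_norm_bounded (summable_freqWeight_sq.mul_left (C * singWeight (ρ - ρ₀) / ρ₀))
    fun m => ?_
  have := (hC m ρ ρ₀ le_rfl le_rfl hρ₀ (by linarith) hne).2.2.1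
  rw [greenTerm_eq, norm_mul, norm_mul, norm_angularMode, norm_angularMode, mul_one, mul_one,
    Complex.norm_real, Real.norm_eq_abs]
  rw [← le_div_iff₀ hρ₀] at this
  refine this.trans (le_of_eq ?_)
  ring

theorem volume_restrict_polarStrip : (volume : Measure (ℝ × ℝ)).restrict polarStrip =
    (volume.restrict (Ioi 0)).prod (volume.restrict (Ioo 0 (2 * π))) := by
  rw [polarStrip, Measure.prod_restrict, Measure.volume_eq_prod]

theorem measurableSet_polarStrip : MeasurableSet polarStrip :=
  measurableSet_Ioi.prod measurableSet_Ioo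

/-- Lebesgue measure on `(0, R) × (0, 2π)`. -/
def boxMeasure (R : ℝ) : Measure (ℝ × ℝ) :=
  (volume.restrict (Ioo 0 R)).prod (volume.restrict (Ioo 0 (2 * π)))

instance (R : ℝ) : IsFiniteMeasure (boxMeasure R) := by unfold boxMeasure; infer_instance

theorem boxMeasure_eq (R : ℝ) :
    boxMeasure R = volume.restrict (Ioo 0 R ×ˢ Ioo 0 (2 * π)) := by
  rw [boxMeasure, Measure.prod_restrict, Measure.volume_eq_prod]

theorem polarStrip_of_box {R : ℝ} {g : ℝ × ℝ → ℂ} (hg : ∀ q : ℝ × ℝ, R ≤ q.1 → g q = 0) :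
    (Integrable g (boxMeasure R) → IntegrableOn g polarStrip) ∧
    ∫ q in polarStrip, g q = ∫ q, g q ∂(boxMeasure R) := by
  have hsub : Ioo 0 R ×ˢ Ioo 0 (2 * π) ⊆ polarStrip := prod_mono Ioo_subset_Ioi_self le_rfl
  have hz : ∀ q ∈ polarStrip \ (Ioo 0 R ×ˢ Ioo 0 (2 * π)), g q = 0 := by
    rintro q ⟨hq, hq'⟩
    refine hg q (not_lt.1 fun h => hq' ⟨⟨hq.1, h⟩, hq.2⟩)
  rw [boxMeasure_eq]
  exact ⟨fun h => IntegrableOn.of_forall_sdiff_eq_zero h measurableSet_polarStrip hz,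
    setIntegral_eq_of_subset_of_forall_sdiff_eq_zero measurableSet_polarStrip hsub hz⟩

theorem ae_boxMeasure (R ρ : ℝ) :
    ∀ᵐ q ∂(boxMeasure R), (q.1 ∈ Ioo 0 R ∧ ρ ≠ q.1) ∧ q.2 ∈ Ioo 0 (2 * π) := by
  have h1 := (Measure.quasiMeasurePreserving_fst (μ := volume.restrict (Ioo (0 : ℝ) R))
    (ν := volume.restrict (Ioo 0 (2 * π)))).ae (ae_mem_Ioo_and_ne R ρ)
  have h2 := (Measure.quasiMeasurePreserving_snd (μ := volume.restrict (Ioo (0 : ℝ) R))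
    (ν := volume.restrict (Ioo 0 (2 * π)))).ae (ae_restrict_mem measurableSet_Ioo)
  filter_upwards [h1, h2] with q hq1 hq2 using ⟨hq1, hq2⟩

/-- Each term is dominated by `freqWeight m ^ 2` times one integrable function, so the Fourier
series of the kernel may be integrated term by term. The angular integral then produces the Fourier
coefficients of `f`. -/
theorem greenOp_eq_neg_tsum {h R M : ℝ} {f : ℝ × ℝ → ℂ} (hh : 0 < h) (hR : 0 < R)
    (hf : Measurable f) (hM : ∀ q, ‖f q‖ ≤ M) (hfR : ∀ q : ℝ × ℝ, R ≤ q.1 → f q = 0)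
    {ρ : ℝ} (hρ : 0 < ρ) (φ : ℝ) :
    IntegrableOn (fun q : ℝ × ℝ => greenH h ρ φ q.1 q.2 * f q * (q.1 : ℂ)) polarStrip ∧
    greenOp h f ρ φ = -∑' m, radialMode h R (angularCoeff f m) m ρ * angularMode m φ := by
  have hM0 : 0 ≤ M := (norm_nonneg _).trans (hM 0)
  obtain ⟨C, hC0, hC⟩ := exists_greenCoeff_le hh hρ le_rfl hR
  obtain ⟨J, hJ0, hJ⟩ := exists_integral_singWeight_le ρ R hR
  have hJi := (hJ ρ hρ le_rfl).1
  set T : ℤ → ℝ × ℝ → ℂ := fun m q => greenTerm h ρ φ q.1 q.2 m * f q * (q.1 : ℂ) with hT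
  have hTn : ∀ m (q : ℝ × ℝ), q.1 ∈ Ioo 0 R → ρ ≠ q.1 →
      ‖T m q‖ ≤ freqWeight m ^ 2 * (C * M * singWeight (ρ - q.1)) := by
    intro m q hq hne
    have := (hC m ρ q.1 le_rfl le_rfl hq.1 hq.2 hne).2.2.1
    simp only [hT]
    rw [greenTerm_eq, norm_mul, norm_mul, norm_mul, norm_mul, norm_angularMode, norm_angularMode,
      mul_one, mul_one, Complex.norm_real, Complex.norm_real, Real.norm_eq_abs,
      Real.norm_of_nonneg hq.1.le]
    have hw := singWeight_nonneg (ρ - q.1)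
    calc _ = |greenCoeff h m ρ q.1| * q.1 * ‖f q‖ := by ring
      _ ≤ C * (freqWeight m ^ 2 * singWeight (ρ - q.1)) * M :=
          mul_le_mul this (hM q) (norm_nonneg _) (by positivity)
      _ = _ := by ring
  have hbd : Integrable (fun q : ℝ × ℝ => C * M * singWeight (ρ - q.1)) (boxMeasure R) :=
    Integrable.comp_fst (f := fun s => C * M * singWeight (ρ - s)) (hJi.const_mul _) _
  have hTm : ∀ m, AEStronglyMeasurable (T m) (boxMeasure R) := by
    intro m
    have h1 : AEStronglyMeasurable (fun q : ℝ × ℝ => greenCoeff h m ρ q.1) (boxMeasure R) :=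
      (aestronglyMeasurable_greenCoeff hh m R hρ).comp_fst
    have h2 : Measurable fun q : ℝ × ℝ => angularMode m φ * angularMode (-m) q.2 * f q * (q.1 : ℂ) := by
      have := (continuous_angularMode (-m)).measurable
      fun_prop
    refine ((Complex.continuous_ofReal.comp_aestronglyMeasurable h1).mul
      h2.aestronglyMeasurable).congr (Eventually.of_forall fun q => ?_)
    simp only [hT, Pi.mul_apply, greenTerm_eq]
    ring
  have hTi : ∀ m, Integrable (T m) (boxMeasure R) := fun m =>
    (hbd.const_mul (freqWeight m ^ 2)).mono' (hTm m) (by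
      filter_upwards [ae_boxMeasure R ρ] with q hq using hTn m q hq.1.1 hq.1.2)
  have hTs : Summable fun m => ∫ q, ‖T m q‖ ∂(boxMeasure R) := by
    refine Summable.of_nonneg_of_le (fun m => integral_nonneg fun q => norm_nonneg _) (fun m => ?_)
      (summable_freqWeight_sq.mul_right (∫ q : ℝ × ℝ, C * M * singWeight (ρ - q.1) ∂(boxMeasure R)))
    rw [← integral_const_mul]
    refine integral_mono_ae (hTi m).norm (hbd.const_mul _) ?_
    filter_upwards [ae_boxMeasure R ρ] with q hq using hTn m q hq.1.1 hq.1.2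
  have hsum := hasSum_integral_of_summable_integral_norm hTi hTs
  have hTint : ∀ m, ∫ q, T m q ∂(boxMeasure R) =
      radialMode h R (angularCoeff f m) m ρ * angularMode m φ := by
    intro m
    rw [boxMeasure, integral_prod _ (hTi m), radialMode, ← integral_mul_const]
    refine integral_congr_ae (Eventually.of_forall fun s => ?_)
    simp only [hT, greenTerm_eq, angularCoeff, Complex.real_smul]
    rw [← integral_const_mul, ← integral_mul_const]
    refine integral_congr_ae (Eventually.of_forall fun t => ?_)
    simp only
    push_cast
    ring
  have hGH : ∀ q : ℝ × ℝ, greenH h ρ φ q.1 q.2 * f q * (q.1 : ℂ) = -∑' m, T m q := by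
    intro q
    simp only [hT, greenH, tsum_mul_right, neg_mul]
  have hz : ∀ q : ℝ × ℝ, R ≤ q.1 → greenH h ρ φ q.1 q.2 * f q * (q.1 : ℂ) = 0 := by
    intro q hq
    rw [hfR q hq, mul_zero, zero_mul]
  obtain ⟨hb1, hb2⟩ := polarStrip_of_box hz
  have hsummable : ∀ᵐ q ∂(boxMeasure R), Summable fun m => ‖T m q‖ := by
    filter_upwards [ae_boxMeasure R ρ] with q hq
    exact Summable.of_nonneg_of_le (fun m => norm_nonneg _) (fun m => hTn m q hq.1.1 hq.1.2)
      (summable_freqWeight_sq.mul_right _)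
  constructor
  · refine hb1 ?_
    simp only [hGH]
    refine Integrable.neg ((hbd.const_mul (∑' m, freqWeight m ^ 2)).mono' ?_ ?_)
    · refine aestronglyMeasurable_of_tendsto_ae atTop (f := fun (F : Finset ℤ) q => ∑ m ∈ F, T m q)
        (fun F => Finset.aestronglyMeasurable_fun_sum F fun m _ => hTm m) ?_
      filter_upwards [hsummable] with q hq using hq.of_norm.hasSum
    · filter_upwards [ae_boxMeasure R ρ, hsummable] with q hq hqs
      refine (norm_tsum_le_tsum_norm hqs).trans ?_
      rw [← tsum_mul_right]
      exact hqs.tsum_le_tsum (fun m => hTn m q hq.1.1 hq.1.2) (summable_freqWeight_sq.mul_right _)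
  · rw [greenOp, hb2]
    simp only [hGH, integral_neg]
    rw [← hsum.tsum_eq]
    simp only [hTint]

/-! ### Test functions on the strip -/

theorem hasDerivAt_fst_of_contDiff {ψ : ℝ × ℝ → ℂ} (hψ : ContDiff ℝ ∞ ψ) (ρ φ : ℝ) :
    HasDerivAt (fun r => ψ (r, φ)) (fderiv ℝ ψ (ρ, φ) (1, 0)) ρ := by
  have h1 : HasFDerivAt ψ (fderiv ℝ ψ (ρ, φ)) (ρ, φ) :=
    (hψ.differentiable (by simp) (ρ, φ)).hasFDerivAt
  have h2 : HasDerivAt (fun r : ℝ => (r, φ)) ((1 : ℝ), (0 : ℝ)) ρ :=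
    (hasDerivAt_id ρ).prodMk (hasDerivAt_const ρ φ)
  exact h1.comp_hasDerivAt ρ h2

theorem hasDerivAt_snd_of_contDiff {ψ : ℝ × ℝ → ℂ} (hψ : ContDiff ℝ ∞ ψ) (ρ φ : ℝ) :
    HasDerivAt (fun t => ψ (ρ, t)) (fderiv ℝ ψ (ρ, φ) (0, 1)) φ := by
  have h1 : HasFDerivAt ψ (fderiv ℝ ψ (ρ, φ)) (ρ, φ) :=
    (hψ.differentiable (by simp) (ρ, φ)).hasFDerivAt
  have h2 : HasDerivAt (fun t : ℝ => (ρ, t)) ((0 : ℝ), (1 : ℝ)) φ :=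
    (hasDerivAt_const φ ρ).prodMk (hasDerivAt_id φ)
  exact h1.comp_hasDerivAt φ h2

theorem contDiff_fderiv_apply {ψ : ℝ × ℝ → ℂ} (hψ : ContDiff ℝ ∞ ψ) (v : ℝ × ℝ) :
    ContDiff ℝ ∞ fun p => fderiv ℝ ψ p v :=
  (hψ.fderiv_right (m := ∞) (by simp)).clm_apply contDiff_const

/-- The data of a test function: its derivatives and the bounds of its support. -/
structure IsPolarTestData (ψ ψ₁ ψ₂ ψ₂₂ : ℝ × ℝ → ℂ) (α β : ℝ) : Prop where
  pos : 0 < α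
  le : α ≤ β
  support : ∀ ρ φ, ψ (ρ, φ) ≠ 0 → α ≤ ρ ∧ ρ ≤ β
  hasDerivAt_fst : ∀ ρ φ, HasDerivAt (fun r => ψ (r, φ)) (ψ₁ (ρ, φ)) ρ
  hasDerivAt_snd : ∀ ρ φ, HasDerivAt (fun t => ψ (ρ, t)) (ψ₂ (ρ, φ)) φ
  hasDerivAt_snd_snd : ∀ ρ φ, HasDerivAt (fun t => ψ₂ (ρ, t)) (ψ₂₂ (ρ, φ)) φ
  continuous : Continuous ψ
  continuous_fst : Continuous ψ₁
  continuous_snd_snd : Continuous ψ₂₂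
  periodic : ∀ ρ φ, ψ (ρ, φ + 2 * π) = ψ (ρ, φ)

theorem IsPolarTestFunction.exists_data {ψ : ℝ × ℝ → ℂ} (hψ : IsPolarTestFunction ψ) :
    ∃ ψ₁ ψ₂ ψ₂₂ α β, IsPolarTestData ψ ψ₁ ψ₂ ψ₂₂ α β := by
  obtain ⟨a, b, ha, hab⟩ := hψ.support
  have h2 := contDiff_fderiv_apply hψ.smooth (0, 1)
  exact ⟨fun p => fderiv ℝ ψ p (1, 0), fun p => fderiv ℝ ψ p (0, 1),
    fun p => fderiv ℝ (fun p => fderiv ℝ ψ p (0, 1)) p (0, 1), a, max a b,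
    { pos := ha
      le := le_max_left _ _
      support := fun ρ φ h => ⟨(hab ρ φ h).1, (hab ρ φ h).2.trans (le_max_right _ _)⟩
      hasDerivAt_fst := fun ρ φ => hasDerivAt_fst_of_contDiff hψ.smooth ρ φ
      hasDerivAt_snd := fun ρ φ => hasDerivAt_snd_of_contDiff hψ.smooth ρ φ
      hasDerivAt_snd_snd := fun ρ φ => hasDerivAt_snd_of_contDiff h2 ρ φ
      continuous := hψ.smooth.continuous
      continuous_fst := (contDiff_fderiv_apply hψ.smooth (1, 0)).continuous
      continuous_snd_snd := (contDiff_fderiv_apply h2 (0, 1)).continuous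
      periodic := hψ.periodic }⟩

namespace IsPolarTestData

variable {ψ ψ₁ ψ₂ ψ₂₂ : ℝ × ℝ → ℂ} {α β : ℝ}

theorem eq_zero (H : IsPolarTestData ψ ψ₁ ψ₂ ψ₂₂ α β) {ρ : ℝ} (hρ : ρ ∉ Icc α β) (φ : ℝ) :
    ψ (ρ, φ) = 0 ∧ ψ₁ (ρ, φ) = 0 ∧ ψ₂₂ (ρ, φ) = 0 := by
  have h0 : ∀ r, r ∉ Icc α β → ∀ t, ψ (r, t) = 0 := fun r hr t => by
    by_contra h
    exact hr (H.support r t h)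
  refine ⟨h0 ρ hρ φ, ?_, ?_⟩
  · have : (fun r => ψ (r, φ)) =ᶠ[𝓝 ρ] fun _ => 0 := by
      filter_upwards [isClosed_Icc.isOpen_compl.mem_nhds hρ] with y hy using h0 y hy φ
    exact ((H.hasDerivAt_fst ρ φ).congr_of_eventuallyEq this.symm).unique (hasDerivAt_const ρ 0)
  · have h2 : (fun t => ψ₂ (ρ, t)) = fun _ => 0 := by
      funext t
      have := H.hasDerivAt_snd ρ t
      rw [show (fun t => ψ (ρ, t)) = fun _ => 0 from funext (h0 ρ hρ)] at this
      exact this.unique (hasDerivAt_const t 0)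
    have := H.hasDerivAt_snd_snd ρ φ
    rw [h2] at this
    exact this.unique (hasDerivAt_const φ 0)

theorem iteratedDeriv_two (H : IsPolarTestData ψ ψ₁ ψ₂ ψ₂₂ α β) (ρ φ : ℝ) :
    iteratedDeriv 2 (fun t => ψ (ρ, t)) φ = ψ₂₂ (ρ, φ) := by
  rw [iteratedDeriv_succ, iteratedDeriv_one,
    show deriv (fun t => ψ (ρ, t)) = fun t => ψ₂ (ρ, t) from
      funext fun t => (H.hasDerivAt_snd ρ t).deriv]
  exact (H.hasDerivAt_snd_snd ρ φ).deriv

theorem periodic_snd (H : IsPolarTestData ψ ψ₁ ψ₂ ψ₂₂ α β) (ρ φ : ℝ) :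
    ψ₂ (ρ, φ + 2 * π) = ψ₂ (ρ, φ) := by
  have h1 := (H.hasDerivAt_snd ρ (φ + 2 * π)).comp_add_const φ (2 * π)
  simp only [H.periodic] at h1
  exact h1.unique (H.hasDerivAt_snd ρ φ)

/-- Two integrations by parts; the boundary terms cancel because `ψ` and `ψ₂` are periodic. -/
theorem integral_angularMode_mul (H : IsPolarTestData ψ ψ₁ ψ₂ ψ₂₂ α β) (m : ℤ) (ρ : ℝ) :
    ∫ t in Ioo 0 (2 * π), angularMode m t * ψ₂₂ (ρ, t) =
      -(m : ℂ) ^ 2 * ∫ t in Ioo 0 (2 * π), angularMode m t * ψ (ρ, t) := by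
  have hc : Continuous fun t => ψ (ρ, t) := H.continuous.comp (by fun_prop)
  have hc2 : Continuous fun t => ψ₂ (ρ, t) :=
    continuous_iff_continuousAt.2 fun t => (H.hasDerivAt_snd_snd ρ t).continuousAt
  have hc22 : Continuous fun t => ψ₂₂ (ρ, t) := H.continuous_snd_snd.comp (by fun_prop)
  have hp : ψ (ρ, 2 * π) = ψ (ρ, 0) := by simpa using H.periodic ρ 0
  have hp2 : ψ₂ (ρ, 2 * π) = ψ₂ (ρ, 0) := by simpa using H.periodic_snd ρ 0
  have he : Continuous fun t => Complex.I * m * angularMode m t := by fun_prop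
  have i1 := intervalIntegral.integral_mul_deriv_eq_deriv_mul (a := 0) (b := 2 * π)
    (fun t _ => hasDerivAt_angularMode m t) (fun t _ => H.hasDerivAt_snd_snd ρ t)
    (he.intervalIntegrable _ _) (hc22.intervalIntegrable _ _)
  have i2 := intervalIntegral.integral_mul_deriv_eq_deriv_mul (a := 0) (b := 2 * π)
    (fun t _ => hasDerivAt_angularMode m t) (fun t _ => H.hasDerivAt_snd ρ t)
    (he.intervalIntegrable _ _) (hc2.intervalIntegrable _ _)
  simp only [angularMode_two_pi, angularMode_zero_right, hp, hp2, sub_self, zero_sub, mul_assoc,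
    intervalIntegral.integral_const_mul] at i1 i2
  rw [i2] at i1
  simp only [intervalIntegral.integral_of_le Real.two_pi_pos.le, integral_Ioc_eq_integral_Ioo] at i1
  rw [i1]
  linear_combination ((m : ℂ) ^ 2 * ∫ t in Ioo 0 (2 * π), angularMode m t * ψ (ρ, t)) * Complex.I_sq

theorem exists_norm_le (H : IsPolarTestData ψ ψ₁ ψ₂ ψ₂₂ α β) : ∃ E : ℝ, 0 ≤ E ∧
    ∀ ρ, ∀ φ ∈ Icc 0 (2 * π), ‖ψ (ρ, φ)‖ ≤ E ∧ ‖ψ₁ (ρ, φ)‖ ≤ E ∧ ‖ψ₂₂ (ρ, φ)‖ ≤ E := by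
  have hK : IsCompact (Icc α β ×ˢ Icc 0 (2 * π)) := isCompact_Icc.prod isCompact_Icc
  obtain ⟨E₀, h₀⟩ := hK.exists_bound_of_continuousOn H.continuous.continuousOn
  obtain ⟨E₁, h₁⟩ := hK.exists_bound_of_continuousOn H.continuous_fst.continuousOn
  obtain ⟨E₂, h₂⟩ := hK.exists_bound_of_continuousOn H.continuous_snd_snd.continuousOn
  refine ⟨max 0 (max E₀ (max E₁ E₂)), le_max_left _ _, fun ρ φ hφ => ?_⟩
  by_cases hρ : ρ ∈ Icc α β
  · have hm : ((ρ, φ) : ℝ × ℝ) ∈ Icc α β ×ˢ Icc 0 (2 * π) := ⟨hρ, hφ⟩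
    refine ⟨(h₀ _ hm).trans ?_, (h₁ _ hm).trans ?_, (h₂ _ hm).trans ?_⟩ <;> simp
  · obtain ⟨e0, e1, e2⟩ := H.eq_zero hρ φ
    simp [e0, e1, e2]

/-- The angular Fourier coefficients decay. -/
theorem exists_norm_integral_angularMode_le (H : IsPolarTestData ψ ψ₁ ψ₂ ψ₂₂ α β) :
    ∃ E : ℝ, 0 ≤ E ∧ ∀ (m : ℤ) ρ,
      ‖∫ t in Ioo 0 (2 * π), angularMode m t * ψ (ρ, t)‖ ≤ E * freqWeight m ^ 2 := by
  obtain ⟨E, hE0, hE⟩ := H.exists_norm_le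
  refine ⟨E * (2 * π), by positivity, fun m ρ => ?_⟩
  have hb : ∀ χ : ℝ × ℝ → ℂ, (∀ t ∈ Ioo 0 (2 * π), ‖χ (ρ, t)‖ ≤ E) →
      ‖∫ t in Ioo 0 (2 * π), angularMode m t * χ (ρ, t)‖ ≤ E * (2 * π) := by
    intro χ hχ
    have := norm_setIntegral_le_of_norm_le_const (μ := volume) (s := Ioo 0 (2 * π)) (C := E)
      (f := fun t => angularMode m t * χ (ρ, t)) measure_Ioo_lt_top (fun t ht => by
        rw [norm_mul, norm_angularMode, one_mul]; exact hχ t ht)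
    rwa [Real.volume_real_Ioo_of_le (by positivity), sub_zero] at this
  rcases eq_or_ne m 0 with rfl | hm
  · rw [freqWeight, if_pos rfl, one_pow, mul_one]
    exact hb ψ fun t ht => (hE ρ t (Ioo_subset_Icc_self ht)).1
  · have h1 := hb ψ₂₂ fun t ht => (hE ρ t (Ioo_subset_Icc_self ht)).2.2
    rw [H.integral_angularMode_mul, norm_mul, norm_neg, norm_pow, Complex.norm_intCast] at h1
    have hm1 : (1 : ℝ) ≤ |(m : ℝ)| := by exact_mod_cast Int.one_le_abs hm
    rw [mul_comm, ← le_div_iff₀ (by positivity)] at h1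
    refine h1.trans ?_
    rw [div_eq_mul_inv]
    gcongr
    rw [freqWeight, if_neg hm, Nat.cast_natAbs, Int.cast_abs, ← inv_pow, ← Real.rpow_neg_one]
    have : |(m : ℝ)| ^ (-1 : ℝ) ≤ |(m : ℝ)| ^ (-(3 / 4) : ℝ) :=
      Real.rpow_le_rpow_of_exponent_le hm1 (by norm_num)
    gcongr

/-- The Fourier series of a test function in the angle. -/
theorem hasSum_angularMode (H : IsPolarTestData ψ ψ₁ ψ₂ ψ₂₂ α β) (ρ φ : ℝ) :
    HasSum (fun m : ℤ => 1 / (2 * π) * (∫ t in Ioo 0 (2 * π), angularMode m t * ψ (ρ, t)) *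
      angularMode (-m) φ) (ψ (ρ, φ)) := by
  have : Fact (0 < 2 * π) := ⟨Real.two_pi_pos⟩
  obtain ⟨E, hE0, hE⟩ := H.exists_norm_integral_angularMode_le
  have hper : Function.Periodic (fun t => ψ (ρ, t)) (2 * π) := fun t => H.periodic ρ t
  have hc : Continuous fun t => ψ (ρ, t) := H.continuous.comp (by fun_prop)
  let g : C(AddCircle (2 * π), ℂ) := ⟨hper.lift, continuous_coinduced_dom.mpr hc⟩
  have hg : ∀ t : ℝ, g (t : AddCircle (2 * π)) = ψ (ρ, t) := fun t => hper.lift_coe t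
  have hfour : ∀ (m : ℤ) (t : ℝ), fourier m (t : AddCircle (2 * π)) = angularMode m t := by
    intro m t
    rw [fourier_coe_apply, angularMode]
    congr 1
    have : (π : ℂ) ≠ 0 := by exact_mod_cast Real.pi_ne_zero
    push_cast
    field_simp
  have hcoef : ∀ m, fourierCoeff g m =
      1 / (2 * π) * ∫ t in Ioo 0 (2 * π), angularMode (-m) t * ψ (ρ, t) := by
    intro m
    rw [fourierCoeff_eq_intervalIntegral _ _ 0, zero_add,
      intervalIntegral.integral_of_le Real.two_pi_pos.le, integral_Ioc_eq_integral_Ioo,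
      Complex.real_smul]
    simp only [hfour, hg, smul_eq_mul]
    push_cast
    rfl
  have hs : Summable (fourierCoeff g) := by
    have hs' : Summable fun m : ℤ => freqWeight (-m) ^ 2 :=
      summable_freqWeight_sq.comp_injective neg_injective
    refine Summable.of_norm_bounded (hs'.mul_left (‖(1 / (2 * π) : ℂ)‖ * E)) fun m => ?_
    rw [hcoef, norm_mul, mul_assoc]
    gcongr
    exact hE (-m) ρ
  have h1 := has_pointwise_sum_fourier_series_of_summable hs (φ : AddCircle (2 * π))
  rw [hg] at h1
  -- The statement integrates against `e^{imt}`, the pairing that occurs in the weak form, whereas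
  -- Fourier coefficients use `e^{-imt}`; hence the reindexing by negation.
  rw [← (Equiv.neg ℤ).hasSum_iff]
  convert! h1 using 2 with m
  simp only [Function.comp, Equiv.neg_apply, neg_neg, hcoef, hfour, smul_eq_mul]

end IsPolarTestData

/-! ### The weak form -/

theorem ae_polarStrip : ∀ᵐ p ∂((volume : Measure (ℝ × ℝ)).restrict polarStrip),
    0 < p.1 ∧ p.2 ∈ Ioo 0 (2 * π) :=
  (ae_restrict_mem measurableSet_polarStrip).mono fun _ hp => hp

theorem integrable_indicator_fst (α β c : ℝ) :
    IntegrableOn (fun p : ℝ × ℝ => (Icc α β).indicator (fun _ => c) p.1) polarStrip := by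
  rw [IntegrableOn, volume_restrict_polarStrip]
  refine Integrable.comp_fst (f := (Icc α β).indicator (fun _ => c)) ?_ _
  refine IntegrableOn.integrable_indicator ?_ measurableSet_Icc
  exact integrableOn_const (by
    rw [Measure.restrict_apply measurableSet_Icc]
    exact ((measure_mono inter_subset_left).trans_lt isCompact_Icc.measure_lt_top).ne) enorm_ne_top

/-- A bounded factor times a bounded function supported in `α ≤ ρ ≤ β` is bounded by an indicator. -/
theorem norm_mul_le_indicator {α β B E : ℝ} (hB : 0 ≤ B) {x χ : ℂ} {ρ : ℝ}
    (hx : ρ ∈ Icc α β → ‖x‖ ≤ B) (hχ : ‖χ‖ ≤ E) (hχ0 : ρ ∉ Icc α β → χ = 0) :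
    ‖x * χ‖ ≤ (Icc α β).indicator (fun _ => B * E) ρ := by
  by_cases hρ : ρ ∈ Icc α β
  · rw [indicator_of_mem hρ, norm_mul]
    exact mul_le_mul (hx hρ) hχ (norm_nonneg _) hB
  · rw [indicator_of_notMem hρ, hχ0 hρ, mul_zero, norm_zero]

section

variable {h R A : ℝ} {a : ℝ → ℂ}

theorem aestronglyMeasurable_radialMode (hh : 0 < h) (hR : 0 < R) (ha : Measurable a)
    (hA : ∀ s, ‖a s‖ ≤ A) (m : ℤ) :
    AEStronglyMeasurable (fun p : ℝ × ℝ => radialMode h R a m p.1 * angularMode m p.2)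
      (volume.restrict polarStrip) := by
  rw [volume_restrict_polarStrip]
  have h1 : AEStronglyMeasurable (radialMode h R a m) (volume.restrict (Ioi 0)) := by
    refine ContinuousOn.aestronglyMeasurable (fun ρ hρ => ?_) measurableSet_Ioi
    exact (hasDerivAt_radialMode hh hR ha hA m hρ).continuousAt.continuousWithinAt
  exact h1.comp_fst.mul ((continuous_angularMode m).comp continuous_snd).aestronglyMeasurable

theorem aestronglyMeasurable_radialModeDeriv (hh : 0 < h) (hR : 0 < R) (ha : Measurable a)
    (hA : ∀ s, ‖a s‖ ≤ A) (m : ℤ) :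
    AEStronglyMeasurable (fun p : ℝ × ℝ => radialModeDeriv h R a m p.1 * angularMode m p.2)
      (volume.restrict polarStrip) := by
  rw [volume_restrict_polarStrip]
  have h1 : AEStronglyMeasurable (radialModeDeriv h R a m) (volume.restrict (Ioi 0)) := by
    refine (measurable_deriv (radialMode h R a m)).aestronglyMeasurable.congr ?_
    filter_upwards [ae_restrict_mem measurableSet_Ioi] with ρ hρ
    exact (hasDerivAt_radialMode hh hR ha hA m hρ).deriv
  exact h1.comp_fst.mul ((continuous_angularMode m).comp continuous_snd).aestronglyMeasurable

end

section

variable {ψ ψ₁ ψ₂ ψ₂₂ : ℝ × ℝ → ℂ} {α β : ℝ}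

/-- The measurability and the bounds of the two terms of the weak form. -/
theorem weakForm_terms (H : IsPolarTestData ψ ψ₁ ψ₂ ψ₂₂ α β) (h : ℝ) {B : ℝ} (hB : 0 ≤ B) :
    ∃ c : ℝ, ∀ u u' : ℝ × ℝ → ℂ,
      AEStronglyMeasurable u (volume.restrict polarStrip) →
      AEStronglyMeasurable u' (volume.restrict polarStrip) →
      (∀ p : ℝ × ℝ, p.1 ∈ Icc α β → ‖u p‖ ≤ B ∧ ‖u' p‖ ≤ B) →
      AEStronglyMeasurable (fun p : ℝ × ℝ => ((p.1 / (1 + (1 / h) ^ 2 * p.1 ^ 2) : ℝ) : ℂ) * u' p *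
        ψ₁ p) (volume.restrict polarStrip) ∧
      AEStronglyMeasurable (fun p : ℝ × ℝ => ((1 / p.1 : ℝ) : ℂ) * u p * ψ₂₂ p)
        (volume.restrict polarStrip) ∧
      AEStronglyMeasurable (fun p : ℝ × ℝ => ((1 / p.1 : ℝ) : ℂ) * u p * ψ p)
        (volume.restrict polarStrip) ∧
      (∀ᵐ p ∂((volume : Measure (ℝ × ℝ)).restrict polarStrip),
        ‖((p.1 / (1 + (1 / h) ^ 2 * p.1 ^ 2) : ℝ) : ℂ) * u' p * ψ₁ p‖ ≤
          (Icc α β).indicator (fun _ => c) p.1 ∧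
        ‖((1 / p.1 : ℝ) : ℂ) * u p * ψ₂₂ p‖ ≤ (Icc α β).indicator (fun _ => c) p.1 ∧
        ‖((1 / p.1 : ℝ) : ℂ) * u p * ψ p‖ ≤ (Icc α β).indicator (fun _ => c) p.1) := by
  obtain ⟨E, hE0, hE⟩ := H.exists_norm_le
  have hα := H.pos
  have hβ : 0 < β := hα.trans_le H.le
  -- On `[α, β]` this bounds both radial coefficients, `ρ/(1 + κ²ρ²) ≤ β` and `1/ρ ≤ 1/α`. The
  -- resulting majorant is independent of `u` and `u'`, so it serves all partial sums at once.
  set D : ℝ := β + 1 / α with hD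
  have hD0 : 0 ≤ D := by positivity
  refine ⟨D * B * E, fun u u' hu hu' hbd => ⟨?_, ?_, ?_, ?_⟩⟩
  · have : Measurable fun p : ℝ × ℝ => ((p.1 / (1 + (1 / h) ^ 2 * p.1 ^ 2) : ℝ) : ℂ) := by fun_prop
    exact (this.aestronglyMeasurable.mul hu').mul H.continuous_fst.aestronglyMeasurable
  · have : Measurable fun p : ℝ × ℝ => ((1 / p.1 : ℝ) : ℂ) := by fun_prop
    exact (this.aestronglyMeasurable.mul hu).mul H.continuous_snd_snd.aestronglyMeasurable
  · have : Measurable fun p : ℝ × ℝ => ((1 / p.1 : ℝ) : ℂ) := by fun_prop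
    exact (this.aestronglyMeasurable.mul hu).mul H.continuous.aestronglyMeasurable
  · filter_upwards [ae_polarStrip] with p hp
    obtain ⟨e0, e1, e2⟩ := hE p.1 p.2 (Ioo_subset_Icc_self hp.2)
    have hz := fun hρ : p.1 ∉ Icc α β => H.eq_zero hρ p.2
    have hB1 : p.1 ∈ Icc α β → ‖((p.1 / (1 + (1 / h) ^ 2 * p.1 ^ 2) : ℝ) : ℂ) * u' p‖ ≤ D * B := by
      intro hρ
      rw [norm_mul, Complex.norm_real, Real.norm_of_nonneg (div_nonneg hp.1.le (by positivity))]
      refine mul_le_mul ?_ (hbd p hρ).2 (norm_nonneg _) hD0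
      have h1 : 0 ≤ (1 / h) ^ 2 * p.1 ^ 2 := by positivity
      have h2 : 0 < 1 / α := by positivity
      exact (div_le_self hp.1.le (by linarith)).trans (by linarith [hρ.2])
    have hB2 : p.1 ∈ Icc α β → ‖((1 / p.1 : ℝ) : ℂ) * u p‖ ≤ D * B := by
      intro hρ
      rw [norm_mul, Complex.norm_real, Real.norm_of_nonneg (one_div_nonneg.2 hp.1.le)]
      refine mul_le_mul ?_ (hbd p hρ).1 (norm_nonneg _) hD0
      have := one_div_le_one_div_of_le hα hρ.1
      linarith
    exact ⟨norm_mul_le_indicator (by positivity) hB1 e1 fun hρ => (hz hρ).2.1,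
      norm_mul_le_indicator (by positivity) hB2 e2 fun hρ => (hz hρ).2.2,
      norm_mul_le_indicator (by positivity) hB2 e0 fun hρ => (hz hρ).1⟩

/-- Integrating by parts in the angle replaces `-u ∂_φ²ψ` by `m² u ψ`. For each fixed angle what
remains is the radial weak identity tested with a slice of `ψ`, and Fubini reassembles the slices.
-/
theorem integral_weak_mode {h R A : ℝ} {a : ℝ → ℂ} (hh : 0 < h) (hR : 0 < R) (ha : Measurable a)
    (hA : ∀ s, ‖a s‖ ≤ A) (H : IsPolarTestData ψ ψ₁ ψ₂ ψ₂₂ α β) (m : ℤ) {B : ℝ}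
    (hB0 : 0 ≤ B) (hB : ∀ ρ ∈ Icc α β, ‖radialMode h R a m ρ‖ ≤ B ∧ ‖radialModeDeriv h R a m ρ‖ ≤ B) :
    IntegrableOn (fun p : ℝ × ℝ => ((p.1 / (1 + (1 / h) ^ 2 * p.1 ^ 2) : ℝ) : ℂ) *
        (radialModeDeriv h R a m p.1 * angularMode m p.2) * ψ₁ p -
      ((1 / p.1 : ℝ) : ℂ) * (radialMode h R a m p.1 * angularMode m p.2) * ψ₂₂ p) polarStrip ∧
    ∫ p in polarStrip, (((p.1 / (1 + (1 / h) ^ 2 * p.1 ^ 2) : ℝ) : ℂ) *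
        (radialModeDeriv h R a m p.1 * angularMode m p.2) * ψ₁ p -
      ((1 / p.1 : ℝ) : ℂ) * (radialMode h R a m p.1 * angularMode m p.2) * ψ₂₂ p) =
    -(1 / (2 * π)) * ∫ s in Ioo 0 R, s * (a s * ∫ t in Ioo 0 (2 * π), angularMode m t * ψ (s, t)) := by
  obtain ⟨c, hc⟩ := weakForm_terms H h hB0
  obtain ⟨m1, m2, m3, hb⟩ := hc _ _ (aestronglyMeasurable_radialMode hh hR ha hA m)
    (aestronglyMeasurable_radialModeDeriv hh hR ha hA m) (fun p hp => by
      simp only [norm_mul, norm_angularMode, mul_one]; exact hB p.1 hp)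
  have hind := integrable_indicator_fst α β c
  have i1 := hind.mono' m1 (hb.mono fun _ hp => hp.1)
  have i2 := hind.mono' m2 (hb.mono fun _ hp => hp.2.1)
  have i3 := (hind.mono' m3 (hb.mono fun _ hp => hp.2.2)).const_mul ((m : ℂ) ^ 2)
  refine ⟨i1.sub i2, ?_⟩
  rw [integral_sub i1 i2]
  have hX2 : ∫ p in polarStrip, ((1 / p.1 : ℝ) : ℂ) * (radialMode h R a m p.1 * angularMode m p.2) * ψ₂₂ p =
      -∫ p in polarStrip, (m : ℂ) ^ 2 * (((1 / p.1 : ℝ) : ℂ) *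
        (radialMode h R a m p.1 * angularMode m p.2) * ψ p) := by
    rw [volume_restrict_polarStrip] at i2 i3 ⊢
    rw [integral_prod _ i2, integral_prod _ i3, ← integral_neg]
    refine integral_congr_ae (Eventually.of_forall fun ρ => ?_)
    have e1 : ∀ χ : ℝ × ℝ → ℂ, ∫ t in Ioo 0 (2 * π), ((1 / ρ : ℝ) : ℂ) *
        (radialMode h R a m ρ * angularMode m t) * χ (ρ, t) = ((1 / ρ : ℝ) : ℂ) * radialMode h R a m ρ *
        ∫ t in Ioo 0 (2 * π), angularMode m t * χ (ρ, t) := by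
      intro χ
      rw [← integral_const_mul]
      refine integral_congr_ae (Eventually.of_forall fun t => ?_)
      simp only
      ring
    simp only [integral_const_mul, e1, H.integral_angularMode_mul]
    ring
  rw [hX2, sub_neg_eq_add, ← integral_add i1 i3]
  have i13 := i1.add i3
  rw [volume_restrict_polarStrip] at i13 ⊢
  refine (integral_prod_symm _ i13).trans ?_
  simp only [Pi.add_apply]
  have hinner : ∀ t : ℝ, ∫ ρ in Ioi (0 : ℝ), (((ρ / (1 + (1 / h) ^ 2 * ρ ^ 2) : ℝ) : ℂ) *
        (radialModeDeriv h R a m ρ * angularMode m t) * ψ₁ (ρ, t) +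
      (m : ℂ) ^ 2 * (((1 / ρ : ℝ) : ℂ) * (radialMode h R a m ρ * angularMode m t) * ψ (ρ, t))) =
      -(1 / (2 * π)) * ∫ s in Ioo 0 R, s * (a s * (angularMode m t * ψ (s, t))) := by
    intro t
    have := radialMode_integral_weak hh hR ha hA m (η := fun r => ψ (r, t)) (η' := fun r => ψ₁ (r, t))
      (fun r => H.hasDerivAt_fst r t) (H.continuous_fst.comp (by fun_prop)) H.pos H.le
      (fun r => H.support r t)
    simp only [Complex.real_smul] at this
    have e1 : ∀ s : ℝ, (s : ℂ) * (a s * (angularMode m t * ψ (s, t))) =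
        angularMode m t * (s * (a s * ψ (s, t))) := fun s => by ring
    simp only [e1, integral_const_mul]
    rw [mul_left_comm]
    push_cast at this
    rw [← this, ← integral_const_mul]
    refine integral_congr_ae (Eventually.of_forall fun ρ => ?_)
    simp only
    push_cast
    ring
  obtain ⟨E, hE0, hE⟩ := H.exists_norm_le
  have hsw : Integrable (Function.uncurry fun (t s : ℝ) => (s : ℂ) * (a s * (angularMode m t * ψ (s, t))))
      ((volume.restrict (Ioo 0 (2 * π))).prod (volume.restrict (Ioo 0 R))) := by
    refine Integrable.of_bound (C := R * (A * E)) ?_ ?_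
    · have h1 := (continuous_angularMode m).measurable
      have h2 := H.continuous.measurable
      have : Measurable fun z : ℝ × ℝ => (z.2 : ℂ) * (a z.2 * (angularMode m z.1 * ψ (z.2, z.1))) := by
        fun_prop
      exact this.aestronglyMeasurable
    · have h1 := (Measure.quasiMeasurePreserving_fst (μ := volume.restrict (Ioo 0 (2 * π)))
        (ν := volume.restrict (Ioo 0 R))).ae (ae_restrict_mem measurableSet_Ioo)
      have h2 := (Measure.quasiMeasurePreserving_snd (μ := volume.restrict (Ioo 0 (2 * π)))
        (ν := volume.restrict (Ioo 0 R))).ae (ae_restrict_mem measurableSet_Ioo)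
      filter_upwards [h1, h2] with z hz1 hz2
      simp only [Function.uncurry]
      rw [norm_mul, norm_mul, norm_mul, norm_angularMode, one_mul, Complex.norm_real,
        Real.norm_of_nonneg hz2.1.le]
      exact mul_le_mul hz2.2.le (mul_le_mul (hA _) (hE _ _ (Ioo_subset_Icc_self hz1)).1
        (norm_nonneg _) ((norm_nonneg _).trans (hA 0))) (by positivity) hR.le
  simp only [hinner, integral_const_mul]
  rw [integral_integral_swap hsw]
  simp only [integral_const_mul]

/-- The mode expansion of the right-hand side of the weak form. -/
theorem hasSum_integral_mul_testFunction {R M : ℝ} {f : ℝ × ℝ → ℂ} (hR : 0 < R)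
    (hf : Measurable f) (hM : ∀ q, ‖f q‖ ≤ M) (hfR : ∀ q : ℝ × ℝ, R ≤ q.1 → f q = 0)
    (H : IsPolarTestData ψ ψ₁ ψ₂ ψ₂₂ α β) :
    HasSum (fun m => 1 / (2 * π) * ∫ s in Ioo 0 R, s * (angularCoeff f m s *
      ∫ t in Ioo 0 (2 * π), angularMode m t * ψ (s, t)))
      (∫ p in polarStrip, f p * ψ p * (p.1 : ℂ)) := by
  have hM0 : 0 ≤ M := (norm_nonneg _).trans (hM 0)
  obtain ⟨E, hE0, hE⟩ := H.exists_norm_integral_angularMode_le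
  set J : ℤ → ℝ → ℂ := fun m s => ∫ t in Ioo 0 (2 * π), angularMode m t * ψ (s, t) with hJ
  have hJm : ∀ m, Measurable (J m) := by
    intro m
    have : Measurable (Function.uncurry fun s t : ℝ => angularMode m t * ψ (s, t)) :=
      ((continuous_angularMode m).measurable.comp measurable_snd).mul H.continuous.measurable
    exact (this.stronglyMeasurable.integral_prod_right).measurable
  -- The Fourier series of `ψ` is inserted into `f ψ ρ`. Its coefficients decay like `freqWeight m ^
  -- 2`, so it can be integrated term by term, and the factor `e^{-imφ}` turns `f` into its own
  -- Fourier coefficient.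
  set T : ℤ → ℝ × ℝ → ℂ := fun m q => f q * q.1 * (1 / (2 * π) * J m q.1 * angularMode (-m) q.2) with hT
  have hTm : ∀ m, Measurable (T m) := by
    intro m
    have h1 := (continuous_angularMode (-m)).measurable
    have h2 := hJm m
    fun_prop
  have hTb : ∀ m, ∀ᵐ q ∂(boxMeasure R),
      ‖T m q‖ ≤ M * R * ‖(1 / (2 * π) : ℂ)‖ * E * freqWeight m ^ 2 := by
    intro m
    filter_upwards [ae_boxMeasure R 0] with q hq
    simp only [hT]
    rw [norm_mul, norm_mul, norm_mul, norm_mul, norm_angularMode, mul_one, Complex.norm_real,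
      Real.norm_of_nonneg hq.1.1.1.le]
    calc _ ≤ (M * R) * (‖(1 / (2 * π) : ℂ)‖ * (E * freqWeight m ^ 2)) := by
          have e1 := hM q
          have e2 := hq.1.1.2.le
          have e3 := hE m q.1
          have e4 := hq.1.1.1.le
          gcongr
      _ = _ := by ring
  have hTi : ∀ m, Integrable (T m) (boxMeasure R) := fun m =>
    Integrable.of_bound (hTm m).aestronglyMeasurable _ (hTb m)
  have hTs : Summable fun m => ∫ q, ‖T m q‖ ∂(boxMeasure R) := by
    refine Summable.of_nonneg_of_le (fun m => integral_nonneg fun q => norm_nonneg _) (fun m => ?_)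
      (summable_freqWeight_sq.mul_left
        ((boxMeasure R).real univ * (M * R * ‖(1 / (2 * π) : ℂ)‖ * E)))
    refine (integral_mono_ae (hTi m).norm (integrable_const _) (hTb m)).trans (le_of_eq ?_)
    rw [integral_const, smul_eq_mul]
    ring
  have hsum := hasSum_integral_of_summable_integral_norm hTi hTs
  have hz : ∀ q : ℝ × ℝ, R ≤ q.1 → f q * ψ q * (q.1 : ℂ) = 0 := fun q hq => by
    rw [hfR q hq, zero_mul, zero_mul]
  rw [(polarStrip_of_box hz).2]
  convert! hsum using 1
  · funext m
    rw [boxMeasure, integral_prod _ (hTi m), ← integral_const_mul]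
    refine integral_congr_ae (Eventually.of_forall fun s => ?_)
    simp only [hT, angularCoeff]
    rw [← integral_mul_const, ← integral_const_mul, ← integral_const_mul]
    refine integral_congr_ae (Eventually.of_forall fun t => ?_)
    simp only
    ring
  · congr 1
    funext q
    have e : ∑' m, 1 / (2 * π) * J m q.1 * angularMode (-m) q.2 = ψ q :=
      (H.hasSum_angularMode q.1 q.2).tsum_eq
    simp only [hT]
    rw [tsum_mul_left, e]
    ring

end

/-! ### Summation of the modes in the weak equation -/

theorem isWeakHelicalSolution_of_bounded {h R M : ℝ} {f : ℝ × ℝ → ℂ} (hh : 0 < h) (hR : 0 < R)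
    (hf : Measurable f) (hM : ∀ q, ‖f q‖ ≤ M) (hfR : ∀ q : ℝ × ℝ, R ≤ q.1 → f q = 0) :
    IsWeakHelicalSolution h (greenOp h f) f := by
  have hM0 : 0 ≤ M := (norm_nonneg _).trans (hM 0)
  set a := angularCoeff f with ha_def
  have ha : ∀ m, Measurable (a m) := measurable_angularCoeff hf
  have hA : ∀ m s, ‖a m s‖ ≤ 2 * π * M := norm_angularCoeff_le hM
  have hA0 : 0 ≤ 2 * π * M := by positivity
  have hB := sum_sq_norm_angularCoeff_le hf hM
  set r : ℤ → ℝ × ℝ → ℂ := fun m p => radialMode h R (a m) m p.1 * angularMode m p.2 with hr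
  set r' : ℤ → ℝ × ℝ → ℂ := fun m p => radialModeDeriv h R (a m) m p.1 * angularMode m p.2 with hr'
  have hu : ∀ ρ φ, 0 < ρ → greenOp h f ρ φ = -∑' m, r m (ρ, φ) := fun ρ φ hρ =>
    (greenOp_eq_neg_tsum hh hR hf hM hfR hρ φ).2
  have hd : ∀ ρ φ, 0 < ρ → HasDerivAt (fun r => greenOp h f r φ) (-∑' m, r' m (ρ, φ)) ρ := by
    intro ρ φ hρ
    refine (hasDerivAt_tsum_radialMode hh hR ha hA hA0 hB hρ φ).neg.congr_of_eventuallyEq ?_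
    filter_upwards [Ioi_mem_nhds hρ] with x hx using hu x φ hx
  refine ⟨fun ρ φ hρ => (hd ρ φ hρ).differentiableAt, fun ψ hψ => ?_⟩
  obtain ⟨ψ₁, ψ₂, ψ₂₂, α, β, H⟩ := hψ.exists_data
  obtain ⟨K, hK0, hK⟩ := exists_sum_norm_radialModeDeriv_le hh hR H.pos H.le ha hA hA0 hB
  obtain ⟨K', hK'0, hK'⟩ := exists_norm_radialMode_le (R := R) hh hR H.pos H.le hA0
  have hwle : ∀ F : Finset ℤ, ∑ m ∈ F, freqWeight m ^ 2 ≤ ∑' m, freqWeight m ^ 2 := fun F =>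
    summable_freqWeight_sq.sum_le_tsum F fun m _ => sq_nonneg _
  set w : ℝ := ∑' m, freqWeight m ^ 2 with hw
  have hw0 : 0 ≤ w := tsum_nonneg fun m => sq_nonneg _
  -- One bound for all partial sums on the support of the test function: the second summand controls
  -- the modes, the first their radial derivatives.
  set B : ℝ := K * √w + K' * w with hBdef
  have hB0 : 0 ≤ B := by positivity
  have hsum : ∀ (F : Finset ℤ) (p : ℝ × ℝ), p.1 ∈ Icc α β →
      ∑ m ∈ F, ‖r m p‖ ≤ B ∧ ∑ m ∈ F, ‖r' m p‖ ≤ B := by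
    intro F p hp
    simp only [hr, hr', norm_mul, norm_angularMode, mul_one]
    constructor
    · calc _ ≤ ∑ m ∈ F, K' * freqWeight m ^ 2 :=
            Finset.sum_le_sum fun m _ => hK' (a m) (ha m) (hA m) m p.1 hp.1 hp.2
        _ = K' * ∑ m ∈ F, freqWeight m ^ 2 := (Finset.mul_sum _ _ _).symm
        _ ≤ K' * w := by gcongr; exact hwle F
        _ ≤ B := le_add_of_nonneg_left (by positivity)
    · calc _ ≤ K * √(∑ m ∈ F, freqWeight m ^ 2) := hK F p.1 hp.1 hp.2
        _ ≤ K * √w := by gcongr; exact hwle F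
        _ ≤ B := le_add_of_nonneg_right (by positivity)
  have hsummable : ∀ p : ℝ × ℝ, 0 < p.1 → Summable (fun m => r m p) ∧ Summable (fun m => r' m p) := by
    intro p hp
    obtain ⟨L, hL0, hL⟩ := exists_sum_norm_radialModeDeriv_le hh hR hp le_rfl ha hA hA0 hB
    obtain ⟨L', hL'0, hL'⟩ := exists_norm_radialMode_le (R := R) hh hR hp le_rfl hA0
    constructor
    · refine Summable.of_norm_bounded (summable_freqWeight_sq.mul_left L') fun m => ?_
      simp only [hr, norm_mul, norm_angularMode, mul_one]
      exact hL' (a m) (ha m) (hA m) m p.1 le_rfl le_rfl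
    · refine Summable.of_norm (summable_of_sum_le (c := L * √w) (fun m => norm_nonneg _) fun F => ?_)
      simp only [hr', norm_mul, norm_angularMode, mul_one]
      refine (hL F p.1 le_rfl le_rfl).trans ?_
      gcongr
      exact hwle F
  have htends : ∀ p : ℝ × ℝ, 0 < p.1 →
      Tendsto (fun F : Finset ℤ => -∑ m ∈ F, r m p) atTop (𝓝 (-∑' m, r m p)) ∧
      Tendsto (fun F : Finset ℤ => -∑ m ∈ F, r' m p) atTop (𝓝 (-∑' m, r' m p)) := fun p hp =>
    ⟨Tendsto.neg (hsummable p hp).1.hasSum, Tendsto.neg (hsummable p hp).2.hasSum⟩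
  have hmF : ∀ F : Finset ℤ, AEStronglyMeasurable (fun p => -∑ m ∈ F, r m p) (volume.restrict polarStrip) ∧
      AEStronglyMeasurable (fun p => -∑ m ∈ F, r' m p) (volume.restrict polarStrip) := fun F =>
    ⟨(Finset.aestronglyMeasurable_fun_sum F fun m _ =>
        aestronglyMeasurable_radialMode hh hR (ha m) (hA m) m).neg,
      (Finset.aestronglyMeasurable_fun_sum F fun m _ =>
        aestronglyMeasurable_radialModeDeriv hh hR (ha m) (hA m) m).neg⟩
  have hlim : ∀ᵐ p ∂((volume : Measure (ℝ × ℝ)).restrict polarStrip),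
      Tendsto (fun F : Finset ℤ => -∑ m ∈ F, r m p) atTop (𝓝 (greenOp h f p.1 p.2)) ∧
      Tendsto (fun F : Finset ℤ => -∑ m ∈ F, r' m p) atTop (𝓝 (deriv (fun r => greenOp h f r p.2) p.1)) := by
    filter_upwards [ae_polarStrip] with p hp
    rw [hu p.1 p.2 hp.1, (hd p.1 p.2 hp.1).deriv]
    exact htends p hp.1
  have hm1 : AEStronglyMeasurable (fun p : ℝ × ℝ => greenOp h f p.1 p.2) (volume.restrict polarStrip) :=
    aestronglyMeasurable_of_tendsto_ae atTop (fun F => (hmF F).1) (hlim.mono fun p hp => hp.1)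
  have hm2 : AEStronglyMeasurable (fun p : ℝ × ℝ => deriv (fun r => greenOp h f r p.2) p.1)
      (volume.restrict polarStrip) :=
    aestronglyMeasurable_of_tendsto_ae atTop (fun F => (hmF F).2) (hlim.mono fun p hp => hp.2)
  obtain ⟨c, hc⟩ := weakForm_terms H h hB0
  have hind := integrable_indicator_fst α β c
  have hbF : ∀ F : Finset ℤ, ∀ p : ℝ × ℝ, p.1 ∈ Icc α β →
      ‖-∑ m ∈ F, r m p‖ ≤ B ∧ ‖-∑ m ∈ F, r' m p‖ ≤ B := fun F p hp => by
    rw [norm_neg, norm_neg]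
    exact ⟨(norm_sum_le _ _).trans (hsum F p hp).1, (norm_sum_le _ _).trans (hsum F p hp).2⟩
  have hbu : ∀ p : ℝ × ℝ, p.1 ∈ Icc α β →
      ‖greenOp h f p.1 p.2‖ ≤ B ∧ ‖deriv (fun r => greenOp h f r p.2) p.1‖ ≤ B := by
    intro p hp
    have hp0 : 0 < p.1 := H.pos.trans_le hp.1
    rw [hu p.1 p.2 hp0, (hd p.1 p.2 hp0).deriv]
    exact ⟨le_of_tendsto (htends p hp0).1.norm
        (Eventually.of_forall fun F => (hbF F p hp).1),
      le_of_tendsto (htends p hp0).2.norm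
        (Eventually.of_forall fun F => (hbF F p hp).2)⟩
  obtain ⟨n1, n2, -, hb⟩ := hc _ _ hm1 hm2 hbu
  have e1 : ∀ p : ℝ × ℝ, deriv (fun r => ψ (r, p.2)) p.1 = ψ₁ p := fun p =>
    (H.hasDerivAt_fst p.1 p.2).deriv
  have e2 : ∀ p : ℝ × ℝ, iteratedDeriv 2 (fun t => ψ (p.1, t)) p.2 = ψ₂₂ p := fun p =>
    H.iteratedDeriv_two p.1 p.2
  simp only [e1, e2]
  have I1 := hind.mono' n1 (hb.mono fun _ hp => hp.1)
  have I2 := hind.mono' n2 (hb.mono fun _ hp => hp.2.1)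
  refine ⟨I1, I2, ?_⟩
  -- The bound for a single mode is the partial-sum bound for a singleton.
  have hweak := fun m => integral_weak_mode hh hR (ha m) (hA m) H m hB0 (fun ρ hρ => by
    have := hsum {m} (ρ, 0) hρ
    simpa [hr, hr', norm_angularMode] using this)
  -- The left side of the weak form passes to the limit along finite sets of modes by dominated
  -- convergence. Evaluated mode by mode, the same partial sums converge to the right side, and
  -- uniqueness of limits concludes.
  have hT : Tendsto (fun F : Finset ℤ => ∫ p in polarStrip,
      (((p.1 / (1 + (1 / h) ^ 2 * p.1 ^ 2) : ℝ) : ℂ) * (-∑ m ∈ F, r' m p) * ψ₁ p -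
        ((1 / p.1 : ℝ) : ℂ) * (-∑ m ∈ F, r m p) * ψ₂₂ p)) atTop
      (𝓝 (∫ p in polarStrip, (((p.1 / (1 + (1 / h) ^ 2 * p.1 ^ 2) : ℝ) : ℂ) *
        deriv (fun r => greenOp h f r p.2) p.1 * ψ₁ p -
        ((1 / p.1 : ℝ) : ℂ) * greenOp h f p.1 p.2 * ψ₂₂ p))) := by
    refine tendsto_integral_filter_of_dominated_convergence
      (fun p => (Icc α β).indicator (fun _ => c) p.1 + (Icc α β).indicator (fun _ => c) p.1)
      (Eventually.of_forall fun F => ?_) (Eventually.of_forall fun F => ?_) (hind.add hind) ?_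
    · obtain ⟨k1, k2, -, -⟩ := hc _ _ (hmF F).1 (hmF F).2 (hbF F)
      exact k1.sub k2
    · obtain ⟨-, -, -, hbd⟩ := hc _ _ (hmF F).1 (hmF F).2 (hbF F)
      exact hbd.mono fun p hp => (norm_sub_le _ _).trans (add_le_add hp.1 hp.2.1)
    · filter_upwards [hlim] with p hp
      exact ((hp.2.const_mul _).mul_const _).sub ((hp.1.const_mul _).mul_const _)
  refine tendsto_nhds_unique hT ((hasSum_integral_mul_testFunction hR hf hM hfR H).congr fun F => ?_)
  have e3 : ∀ p : ℝ × ℝ, ((p.1 / (1 + (1 / h) ^ 2 * p.1 ^ 2) : ℝ) : ℂ) * (-∑ m ∈ F, r' m p) * ψ₁ p -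
      ((1 / p.1 : ℝ) : ℂ) * (-∑ m ∈ F, r m p) * ψ₂₂ p =
      -∑ m ∈ F, (((p.1 / (1 + (1 / h) ^ 2 * p.1 ^ 2) : ℝ) : ℂ) * r' m p * ψ₁ p -
        ((1 / p.1 : ℝ) : ℂ) * r m p * ψ₂₂ p) := by
    intro p
    rw [Finset.sum_sub_distrib, ← Finset.sum_mul, ← Finset.sum_mul, ← Finset.mul_sum, ← Finset.mul_sum]
    ring
  simp only [e3]
  rw [integral_neg, integral_finsetSum _ fun m _ => (hweak m).1, ← Finset.sum_neg_distrib]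
  refine Finset.sum_congr rfl fun m _ => ?_
  rw [(hweak m).2]
  ring

/-! ### The main theorem -/

/-- The estimates above hold slice by slice and need a source that is bounded and measurable
everywhere and vanishes identically for large `ρ`; changing `f` on a null set affects neither the
operator nor the weak form. -/
theorem exists_bounded_representative {f : ℝ × ℝ → ℂ} (hf : MemLp f ∞ (volume.restrict polarStrip))
    (hR : ∃ R : ℝ, ∀ᵐ p ∂(volume.restrict polarStrip), R < p.1 → f p = 0) :
    ∃ (g : ℝ × ℝ → ℂ) (R M : ℝ), 0 < R ∧ Measurable g ∧ (∀ q, ‖g q‖ ≤ M) ∧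
      (∀ q : ℝ × ℝ, R ≤ q.1 → g q = 0) ∧ f =ᵐ[volume.restrict polarStrip] g := by
  obtain ⟨R, hR⟩ := hR
  set M : ℝ := (eLpNorm f ∞ (volume.restrict polarStrip)).toReal with hM
  have hbd : ∀ᵐ p ∂(volume.restrict polarStrip), ‖f p‖ ≤ M := by
    filter_upwards [ae_le_eLpNormEssSup (f := f) (μ := volume.restrict polarStrip)] with p hp
    rw [← eLpNorm_exponent_top] at hp
    rw [← toReal_enorm]
    exact ENNReal.toReal_mono hf.2.ne hp
  set g₀ := hf.1.mk f with hg₀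
  have hg₀m : Measurable g₀ := hf.1.stronglyMeasurable_mk.measurable
  -- The cut-off radius is positive and strictly larger than `R`, so every point beyond it, its
  -- boundary included, satisfies the strict inequality under which `f` is known to vanish.
  set S : Set (ℝ × ℝ) := {q | ‖g₀ q‖ ≤ M ∧ q.1 < max R 0 + 1} with hS
  have hSm : MeasurableSet S :=
    (measurableSet_le hg₀m.norm measurable_const).inter
      (measurableSet_lt measurable_fst measurable_const)
  refine ⟨S.indicator g₀, max R 0 + 1, M, by positivity, hg₀m.indicator hSm, fun q => ?_, fun q hq => ?_, ?_⟩
  · by_cases hq : q ∈ S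
    · rw [indicator_of_mem hq]
      exact hq.1
    · rw [indicator_of_notMem hq, norm_zero]
      exact ENNReal.toReal_nonneg
  · exact indicator_of_notMem (fun h => absurd h.2 (not_lt.2 hq)) _
  · filter_upwards [hf.1.ae_eq_mk, hbd, hR] with q h1 h2 h3
    by_cases hq : q.1 < max R 0 + 1
    · rw [indicator_of_mem (show q ∈ S from ⟨by rw [hg₀, ← h1]; exact h2, hq⟩), h1]
    · rw [indicator_of_notMem (fun h => hq h.2)]
      exact h3 (by linarith [le_max_left R 0, not_lt.1 hq])

theorem greenOp_congr_ae {h : ℝ} {f g : ℝ × ℝ → ℂ} (hfg : f =ᵐ[volume.restrict polarStrip] g)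
    (ρ φ : ℝ) :
    (fun q : ℝ × ℝ => greenH h ρ φ q.1 q.2 * f q * (q.1 : ℂ)) =ᵐ[volume.restrict polarStrip]
      (fun q : ℝ × ℝ => greenH h ρ φ q.1 q.2 * g q * (q.1 : ℂ)) ∧
    greenOp h f ρ φ = greenOp h g ρ φ := by
  have : (fun q : ℝ × ℝ => greenH h ρ φ q.1 q.2 * f q * (q.1 : ℂ)) =ᵐ[volume.restrict polarStrip]
      (fun q : ℝ × ℝ => greenH h ρ φ q.1 q.2 * g q * (q.1 : ℂ)) := by
    filter_upwards [hfg] with q hq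
    rw [hq]
  exact ⟨this, integral_congr_ae this⟩

theorem IsWeakHelicalSolution.congr_ae {h : ℝ} {u : ℝ → ℝ → ℂ} {f g : ℝ × ℝ → ℂ}
    (hfg : f =ᵐ[volume.restrict polarStrip] g) (hu : IsWeakHelicalSolution h u g) :
    IsWeakHelicalSolution h u f := by
  refine ⟨hu.1, fun ψ hψ => ⟨(hu.2 ψ hψ).1, (hu.2 ψ hψ).2.1, (hu.2 ψ hψ).2.2.trans ?_⟩⟩
  refine integral_congr_ae ?_
  filter_upwards [hfg] with q hq
  rw [hq]

theorem greenCoeff_integral_weak_real {h : ℝ} (hh : 0 < h) (m : ℤ) {s : ℝ} (hs : 0 < s) {φ : ℝ → ℝ}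
    (hφ : ContDiff ℝ ∞ φ) (hc : HasCompactSupport φ) (hsupp : tsupport φ ⊆ Ioi 0) :
    IntegrableOn (fun ρ => ρ / (1 + (1 / h) ^ 2 * ρ ^ 2) * greenDeriv h m ρ s * deriv φ ρ +
      (m : ℝ) ^ 2 / ρ * greenCoeff h m ρ s * φ ρ) (Ioi 0) ∧
    ∫ ρ in Ioi (0 : ℝ), (ρ / (1 + (1 / h) ^ 2 * ρ ^ 2) * greenDeriv h m ρ s * deriv φ ρ +
      (m : ℝ) ^ 2 / ρ * greenCoeff h m ρ s * φ ρ) = -(φ s) / (2 * π) := by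
  have hd : ∀ x, HasDerivAt φ (deriv φ x) x := fun x =>
    (hφ.differentiable (by simp) x).hasDerivAt
  obtain ⟨α, β, hα, hαβ⟩ : ∃ α β : ℝ, 0 < α ∧ ∀ x, φ x ≠ 0 → α ≤ x ∧ x ≤ β := by
    rcases (tsupport φ).eq_empty_or_nonempty with he | hne
    · refine ⟨1, 1, one_pos, fun x hx => ?_⟩
      have := subset_tsupport φ hx
      rw [he] at this
      exact this.elim
    · have hK : IsCompact (tsupport φ) := hc
      obtain ⟨α, hα, hα'⟩ := hK.exists_isLeast hne
      obtain ⟨β, hβ, hβ'⟩ := hK.exists_isGreatest hne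
      exact ⟨α, β, hsupp hα, fun x hx => ⟨hα' (subset_tsupport φ hx), hβ' (subset_tsupport φ hx)⟩⟩
  have key := greenCoeff_integral_weak hh m hs hd (hφ.continuous_deriv (by simp)) hα hαβ
  simp only [smul_eq_mul] at key
  exact ⟨key.1, key.2.trans (by ring)⟩

end

theorem mainTheorem5 (h : ℝ) (hh : 0 < h) :
    (∀ (m : ℤ) (ρ₀ : ℝ), 0 < ρ₀ →
      ContinuousOn (fun ρ => greenCoeff h m ρ ρ₀) (Ioi 0) ∧
      (∀ ρ : ℝ, 0 < ρ → ρ ≠ ρ₀ → DifferentiableAt ℝ (fun r => greenCoeff h m r ρ₀) ρ) ∧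
      ∀ φ : ℝ → ℝ, ContDiff ℝ ∞ φ → HasCompactSupport φ → tsupport φ ⊆ Ioi 0 →
        IntegrableOn (fun ρ => ρ / (1 + (1 / h) ^ 2 * ρ ^ 2) *
            deriv (fun r => greenCoeff h m r ρ₀) ρ * deriv φ ρ +
          (m : ℝ) ^ 2 / ρ * greenCoeff h m ρ ρ₀ * φ ρ) (Ioi 0) ∧
        ∫ ρ in Ioi (0 : ℝ), (ρ / (1 + (1 / h) ^ 2 * ρ ^ 2) *
            deriv (fun r => greenCoeff h m r ρ₀) ρ * deriv φ ρ +
          (m : ℝ) ^ 2 / ρ * greenCoeff h m ρ ρ₀ * φ ρ) = -(φ ρ₀) / (2 * π)) ∧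
    (∀ ρ φ ρ₀ φ₀ : ℝ, 0 < ρ → 0 < ρ₀ → ρ ≠ ρ₀ → Summable (greenTerm h ρ φ ρ₀ φ₀)) ∧
    ∀ f : ℝ × ℝ → ℂ, MemLp f ∞ (volume.restrict polarStrip) →
      (∃ R : ℝ, ∀ᵐ p ∂(volume.restrict polarStrip), R < p.1 → f p = 0) →
      (∀ ρ φ : ℝ, 0 < ρ →
        IntegrableOn (fun q : ℝ × ℝ => greenH h ρ φ q.1 q.2 * f q * (q.1 : ℂ)) polarStrip) ∧
      IsWeakHelicalSolution h (greenOp h f) f := by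
  refine ⟨fun m ρ₀ hρ₀ => ⟨continuousOn_greenCoeff hh m hρ₀,
      fun ρ hρ hne => (hasDerivAt_greenCoeff hh m hρ hρ₀ hne).differentiableAt,
      fun φ hφ hc hsupp => greenCoeff_integral_weak_real hh m hρ₀ hφ hc hsupp⟩,
    fun ρ φ ρ₀ φ₀ hρ hρ₀ hne => summable_greenTerm hh φ φ₀ hρ hρ₀ hne, fun f hf hR => ?_⟩
  obtain ⟨g, R, M, hR0, hg, hM, hgR, hfg⟩ := exists_bounded_representative hf hR
  have hop : greenOp h f = greenOp h g := by
    funext ρ φ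
    exact (greenOp_congr_ae hfg ρ φ).2
  refine ⟨fun ρ φ hρ => ?_, ?_⟩
  · exact (greenOp_eq_neg_tsum hh hR0 hg hM hgR hρ φ).1.congr (greenOp_congr_ae hfg ρ φ).1.symm
  · rw [hop]
    exact (isWeakHelicalSolution_of_bounded hh hR0 hg hM hgR).congr_ae hfg
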